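/- Let $\mathcal S^{\mathrm{poly}}$ denote the class of meromorphic functions $L$ on $\mathbb C$ that satisfy the axioms of the Selberg class: (i) $L(s)=\sum_{n\ge1}a_L(n)n^{-s}$, absolutely convergent for $\Re s>1$; (ii) $(s-1)^mL(s)$ is entire of finite order for some integer $m\ge 0$; (iii) $\Phi(s)=\omega\,\overline{\Phi(1-\overline s)}$, where $\Phi(s)=L(s)Q^s\prod_{j=1}^f\Gamma(\lambda_js+\mu_j)$ for some $|\omega|=1$, $Q>0$, $\lambda_j>0$ and $\mu_j\in\mathbb C$ with $\Re\mu_j\ge0$; (iv) $a_L(n)=O_\varepsilon(n^\varepsilon)$ for every $\varepsilon>0$; (v) $L(s)=\prod_p\exp\big(\sum_{j\ge1}b_L(p^j)p^{-js}\big)$ for $\Re s>1$, where $b_L(p^j)=O(p^{j\eta})$ for some $\eta<1/2$; and which moreover have a polynomial Euler product: there are an integer $r_L\ge 0$ and complex numbers $\nu_{L,j}(p)$ such that $L(s)=\prod_p\prod_{j=1}^{r_L}\big(1-\nu_{L,j}(p)p^{-s}\big)^{-1}$ for $\Re s>1$. Let $\sigma_0\in(1/2,1)$ be fixed and let $L_1,\dots,L_k$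 be distinct elements of $\mathcal S^{\mathrm{poly}}$. Assume that there are real numbers $\kappa_1,\dots,\kappa_k>0$ such that, for every $A>0$ and all $i,j\in\{1,\dots,k\}$, as $x\to\infty$, $$\sum_{p\le x}a_{L_i}(p)\overline{a_{L_j}(p)}=\begin{cases}\kappa_j\operatorname{Li}(x)+O_A\big(x/\log^Ax\big)&\text{if } i=j,\\ O_A\big(x/\log^Ax\big)&\text{if } i\ne j,\end{cases}$$ where $p$ runs over primes and $\operatorname{Li}(x)=\int_2^x\frac{du}{\log u}$. Assume also that there is $\delta>0$ such that, for $j=1,\dots,k$, as $T\to\infty$, $$N_{L_j}(\sigma_0,T):=\sharp\{\rho=\beta+i\gamma:\ L_j(\rho)=0,\ \beta\ge\sigma_0,\ \gamma\in[0,T]\}\ll T^{1-\delta}.$$ Then there is a constant $c>0$ (depending on $\sigma_0$, the functions $L_j$ and $\delta$, but not on the angles below) such that for all real $\theta_1,\dots,\theta_k$ and all sufficiently large $T$ there are $t_1,\dots,t_k\in[T,2T]$ with $$|t_i-t_j|\le 2(\log T)^{(1+\sigma_0)/2}(\log\log T)^{1/2}\qquad(1\le i,j\le k)$$ such that, for every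 $j=1,\dots,k$, the function $L_j$ has no zero on the half-line $\{x+it_j: x\ge\sigma_0\}$ and $$\Re\big(e^{-i\theta_j}\log L_j(\sigma_0+it_j)\big)\ge c\,\frac{(\log T)^{1-\sigma_0}}{\log\log T}.$$ Here $\log L_j(\sigma_0+it_j)$ is the value obtained by continuous variation of $\log L_j(x+it_j)$ along this half-line, from the limit $0$ at $x=+\infty$. -/

import Mathlib

open Filter Topology Asymptotics Bornology
open scoped ComplexConjugate

noncomputable section

namespace JointExtreme

/-- The Selberg class: the meromorphic function `L`, with Dirichlet coefficients `a n` (`n ≥ 1`),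
satisfies the five axioms. The only possible pole is at `s = 1`; there the value `L 1` of the total
function `L : ℂ → ℂ` carries no information when `L` has a pole. -/
structure IsSelberg (L : ℂ → ℂ) (a : ℕ → ℂ) : Prop where
  /-- Absolutely convergent Dirichlet series for `Re s > 1`. -/
  dirichlet : ∀ s : ℂ, 1 < s.re → LSeriesHasSum a s (L s)
  /-- `(s - 1) ^ m * L s` is entire of finite order. -/
  continuation : ∃ (m : ℕ) (G : ℂ → ℂ), Differentiable ℂ G ∧
    (∀ s : ℂ, s ≠ 1 → G s = (s - 1) ^ m * L s) ∧
    ∃ B : ℝ, 0 < B ∧ G =O[cobounded ℂ] fun s : ℂ => Real.exp (‖s‖ ^ B)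
  /-- At `s = 1` the function `L` is continuous (hence analytic), unless it has a pole. -/
  at_one : ContinuousAt L 1 ∨ Tendsto L (𝓝[≠] 1) (cobounded ℂ)
  /-- Functional equation, stated at all points where neither side meets a pole of `L` or of one
  of the Gamma factors. -/
  functional : ∃ (f : ℕ) (Q : ℝ) (lam : Fin f → ℝ) (mu : Fin f → ℂ) (ω : ℂ),
    0 < Q ∧ (∀ j, 0 < lam j) ∧ (∀ j, 0 ≤ (mu j).re) ∧ ‖ω‖ = 1 ∧
    ∀ Φ : ℂ → ℂ,
      (∀ s, Φ s = L s * (Q : ℂ) ^ s * ∏ j, Complex.Gamma (lam j * s + mu j)) →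
      ∀ s : ℂ, s ≠ 0 → s ≠ 1 →
        (∀ (j : Fin f) (n : ℕ), (lam j : ℂ) * s + mu j ≠ -(n : ℂ)) →
        (∀ (j : Fin f) (n : ℕ), (lam j : ℂ) * (1 - conj s) + mu j ≠ -(n : ℂ)) →
        Φ s = ω * conj (Φ (1 - conj s))
  /-- Ramanujan hypothesis. -/
  ramanujan : ∀ ε : ℝ, 0 < ε → a =O[atTop] fun n : ℕ => (n : ℝ) ^ ε
  /-- Euler product. -/
  euler : ∃ (b : ℕ → ℂ) (η C : ℝ), η < 1 / 2 ∧
    (∀ p : ℕ, p.Prime → ∀ j : ℕ, 1 ≤ j → ‖b (p ^ j)‖ ≤ C * (p : ℝ) ^ ((j : ℝ) * η)) ∧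
    ∀ s : ℂ, 1 < s.re →
      HasProd (fun p : Nat.Primes =>
        Complex.exp (∑' j : ℕ, b ((p : ℕ) ^ (j + 1)) / ((p : ℕ) : ℂ) ^ (((j : ℂ) + 1) * s))) (L s)

/-- The Selberg class with polynomial Euler product. -/
structure IsSelbergPoly (L : ℂ → ℂ) (a : ℕ → ℂ) : Prop extends IsSelberg L a where
  poly_euler : ∃ (r : ℕ) (ν : Fin r → ℕ → ℂ), ∀ s : ℂ, 1 < s.re →
    HasProd (fun p : Nat.Primes =>
      ∏ j : Fin r, (1 - ν j p / ((p : ℕ) : ℂ) ^ s)⁻¹) (L s)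

/-- The logarithmic integral `∫_2^x dt / log t`. -/
def Li (x : ℝ) : ℝ := ∫ t in (2 : ℝ)..x, (Real.log t)⁻¹

/-- `∑_{p ≤ x} a(p) * conj (b(p))`, over primes. -/
def primeCorr (a b : ℕ → ℂ) (x : ℝ) : ℂ :=
  ∑ p ∈ Finset.Icc 1 ⌊x⌋₊ with p.Prime, a p * conj (b p)

/-- Strong Selberg orthonormality condition, with error `O_A(x / (log x) ^ A)` for every `A > 0`. -/
def SSOC {k : ℕ} (a : Fin k → ℕ → ℂ) (κ : Fin k → ℝ) : Prop :=
  ∀ A : ℝ, 0 < A → ∀ i j : Fin k,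
    (fun x : ℝ => primeCorr (a i) (a j) x - if i = j then ((κ j * Li x : ℝ) : ℂ) else 0)
      =O[atTop] fun x : ℝ => x / Real.log x ^ A

/-- Zeros `β + iγ` of `L` with `β ≥ σ` and `0 ≤ γ ≤ T`. (Analyticity only excludes a meaningless
value at a pole.) -/
def zeroSet (L : ℂ → ℂ) (σ T : ℝ) : Set ℂ :=
  {ρ | AnalyticAt ℂ L ρ ∧ L ρ = 0 ∧ σ ≤ ρ.re ∧ 0 ≤ ρ.im ∧ ρ.im ≤ T}

/-- `N_L(σ, T) ≪ T ^ (1 - δ)` as `T → ∞`. -/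
def ZeroDensity (L : ℂ → ℂ) (σ δ : ℝ) : Prop :=
  ∃ C : ℝ, ∀ᶠ T : ℝ in atTop,
    (zeroSet L σ T).Finite ∧ ((zeroSet L σ T).ncard : ℝ) ≤ C * T ^ (1 - δ)

/-- `w` is the value at `s` of `log L`, obtained by continuous variation along the horizontal
half-line from `s` to `+∞ + i Im s` (on which `L` must not vanish), starting from the value `0`
at `+∞`. -/
def IsLogValue (L : ℂ → ℂ) (s w : ℂ) : Prop :=
  ∃ g : ℝ → ℂ, ContinuousOn g (Set.Ici s.re) ∧
    (∀ x : ℝ, s.re ≤ x → Complex.exp (g x) = L (x + s.im * Complex.I)) ∧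
    Tendsto g atTop (𝓝 0) ∧ g s.re = w

end JointExtreme

end

/-!
In `Re s > 1` the logarithm of a polynomial Euler product is the prime sum `∑ a(p) p⁻ˢ` plus a part
which stays bounded on `Re s ≥ σ > 1 / 2`. Above a zero-free half-strip the logarithm continues
analytically to `Re s ≥ σ`. There, moving a Gaussian-weighted vertical integral from `Re s = 2` to
`Re s = σ` shows that a short average of `log L` on the line `Re s = σ` around `σ + i t` is the
prime sum with the Gaussian cut-off `exp (-(log p)² / (4 A))`, up to small errors; so if the
smoothed sum is large in a given direction, then `log L` is large in that direction at some nearby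
ordinate.

It remains to choose `t`, common to all `L_j`. The Riesz product `∏ (1 + Re (β_p p^{it}))` over the
primes in a dyadic block of size about `log T` is a nonnegative density with mean about `1` on
`[T, 2T]`. Its frequencies are smaller than a small power of `T`, so different monomials are almost
orthogonal: under this density `p^{-it}` has mean about `β_p / 2`, and a second moment estimate
produces `t` at which every smoothed sum is close to its mean, while the weight of the
neighbourhoods of the few zeros is negligible. With `β_p` proportional to
`∑ e^{iθ_j} conj (a_j(p))`, Selberg orthonormality separates the functions, and each mean has real
part of order `(log T)^(1 - σ) / log log T` in its own direction.
-/

namespace JointExtreme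

/-! ### Local roots of a polynomial Euler product -/

/-- The polynomial Euler product of the class `𝒮ᵖᵒˡʸ`, with local roots `ν j p` at the prime `p`. -/
def HasLocalRoots {ι : Type*} [Fintype ι] (L : ℂ → ℂ) (ν : ι → ℕ → ℂ) : Prop :=
  ∀ s : ℂ, 1 < s.re → HasProd (fun p : Nat.Primes => ∏ j, (1 - ν j p / ((p : ℕ) : ℂ) ^ s)⁻¹) (L s)

lemma tendsto_cofinite_one_of_hasProd {ι 𝕜 : Type*} [NormedField 𝕜] {f : ι → 𝕜} {z : 𝕜}
    (hf : HasProd f z) (hz : z ≠ 0) : Tendsto f cofinite (𝓝 1) := by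
  classical
  have hf' : Tendsto (fun s : Finset ι => ∏ i ∈ s, f i) atTop (𝓝 z) := hf
  have hquot : Tendsto (fun q : Finset ι × Finset ι => (∏ i ∈ q.2, f i) / ∏ i ∈ q.1, f i)
      (atTop ×ˢ atTop) (𝓝 1) := by
    rw [← div_self hz]
    exact (hf'.comp tendsto_snd).div (hf'.comp tendsto_fst) hz
  rw [prod_atTop_atTop_eq] at hquot
  intro V hV
  obtain ⟨⟨s₁, s₂⟩, hs⟩ := eventually_atTop.mp (hquot.eventually hV)
  obtain ⟨s₃, hs₃⟩ := eventually_atTop.mp (hf'.eventually_ne hz)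
  set s := s₁ ∪ s₂ ∪ s₃
  have hs₁ : s₁ ≤ s := Finset.subset_union_left.trans Finset.subset_union_left
  have hs₂ : s₂ ≤ s := Finset.subset_union_right.trans Finset.subset_union_left
  refine (Finset.finite_toSet s).subset fun i hi => ?_
  by_contra his
  have hmem := hs (s, insert i s) ⟨hs₁, hs₂.trans (Finset.subset_insert i s)⟩
  rw [Finset.prod_insert his, mul_div_cancel_right₀ _ (hs₃ s Finset.subset_union_right)] at hmem
  exact hi hmem

lemma eventually_LSeries_ne_zero {f : ℕ → ℂ} (hf : ∃ n ≠ 0, f n ≠ 0)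
    (habs : LSeries.abscissaOfAbsConv f < ⊤) : ∀ᶠ x : ℝ in atTop, LSeries f x ≠ 0 := by
  classical
  set g : ℕ → ℂ := fun n => if n = 0 then 0 else f n with hg_def
  have hfg : ∀ {n : ℕ}, n ≠ 0 → f n = g n := fun hn => by simp [hg_def, hn]
  have hg : ∃ n, g n ≠ 0 := let ⟨n, hn, hfn⟩ := hf; ⟨n, hfg hn ▸ hfn⟩
  obtain ⟨n, hn⟩ : ∃ n, Nat.find hg = n + 1 :=
    Nat.exists_eq_succ_of_ne_zero fun h => Nat.find_spec hg (by rw [h]; simp [hg_def])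
  have hlim := LSeries.tendsto_cpow_mul_atTop (f := g) (n := n)
    (fun m hm => not_not.mp (Nat.find_min hg (by omega)))
    (LSeries.abscissaOfAbsConv_congr hfg ▸ habs)
  filter_upwards [hlim.eventually_ne (hn ▸ Nat.find_spec hg)] with x hx h0
  exact hx (by rw [← LSeries_congr hfg, h0, mul_zero])

lemma exists_forall_le_norm_one_sub_div_pow {ι : Type*} [Fintype ι] (z : ι → ℂ) {q : ℝ}
    (hq : 2 ≤ q) (m : ℕ) :
    ∃ i : Fin (Fintype.card ι + 1), ∀ j, 1 / 4 ≤ ‖1 - z j / (q : ℂ) ^ (m + i : ℕ)‖ := by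
  -- A factor below `1 / 4` forces `‖z j‖` to be comparable to `q ^ (m + i)`, so that each `j` can
  -- spoil at most one exponent.
  by_contra! hcon
  choose f hf using hcon
  have hq0 : 0 < q := by linarith
  have hnorm : ∀ n : ℕ, ∀ w : ℂ, ‖w / (q : ℂ) ^ n‖ = ‖w‖ / q ^ n := fun n w => by
    rw [norm_div, norm_pow, Complex.norm_real, Real.norm_of_nonneg hq0.le]
  have hupper : ∀ i : Fin (Fintype.card ι + 1), ‖z (f i)‖ ≤ 5 / 4 * q ^ (m + i : ℕ) := fun i => by
    rw [← div_le_iff₀ (by positivity), ← hnorm]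
    have := norm_le_norm_add_norm_sub (1 : ℂ) (z (f i) / (q : ℂ) ^ (m + i : ℕ))
    rw [norm_one] at this
    linarith [hf i]
  have hlower : ∀ i : Fin (Fintype.card ι + 1), 3 / 4 * q ^ (m + i : ℕ) ≤ ‖z (f i)‖ := fun i => by
    rw [← le_div_iff₀ (by positivity), ← hnorm]
    have := norm_le_norm_add_norm_sub' (1 : ℂ) (z (f i) / (q : ℂ) ^ (m + i : ℕ))
    rw [norm_one] at this
    linarith [hf i]
  have hlt : ∀ i i', i < i' → f i ≠ f i' := fun i i' hii heq => by
    have h₁ := hupper i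
    have h₂ := hlower i'
    have hstep : q ^ (m + i : ℕ) * q ≤ q ^ (m + i' : ℕ) := by
      rw [← pow_succ]
      exact pow_le_pow_right₀ (by linarith) (by have : (i : ℕ) < i' := hii; omega)
    have hpos : 0 < q ^ (m + i : ℕ) := by positivity
    rw [← heq] at h₂
    nlinarith
  have hinj : Function.Injective f := fun i i' heq => by
    by_contra hne
    exact (lt_or_gt_of_ne hne).elim (fun h => hlt i i' h heq) fun h => hlt i' i h heq.symm
  simpa using Fintype.card_le_of_injective f hinj

lemma norm_le_of_prod_norm_one_sub_le {ι : Type*} [Fintype ι] (z : ι → ℂ) {q : ℝ} (hq : 2 ≤ q)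
    (m : ℕ)
    (h : ∀ i : Fin (Fintype.card ι + 1), ∏ j, ‖1 - z j / (q : ℂ) ^ (m + i : ℕ)‖ ≤ 2) (j : ι) :
    ‖z j‖ ≤ 3 * 4 ^ Fintype.card ι * q ^ (m + Fintype.card ι) := by
  classical
  have hq0 : 0 < q := by linarith
  obtain ⟨i, hi⟩ := exists_forall_le_norm_one_sub_div_pow z hq m
  have hothers : (1 / 4 : ℝ) ^ Fintype.card ι ≤
      ∏ x ∈ Finset.univ.erase j, ‖1 - z x / (q : ℂ) ^ (m + i : ℕ)‖ :=
    calc (1 / 4 : ℝ) ^ Fintype.card ι ≤ (1 / 4 : ℝ) ^ (Finset.univ.erase j).card :=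
          pow_le_pow_of_le_one (by norm_num) (by norm_num) (Finset.card_le_univ _)
      _ = ∏ x ∈ Finset.univ.erase j, (1 / 4 : ℝ) := by rw [Finset.prod_const]
      _ ≤ _ := Finset.prod_le_prod (fun _ _ => by norm_num) (fun x _ => hi x)
  have hfactor : ‖1 - z j / (q : ℂ) ^ (m + i : ℕ)‖ ≤ 2 * 4 ^ Fintype.card ι := by
    have hprod := h i
    rw [← Finset.mul_prod_erase _ _ (Finset.mem_univ j)] at hprod
    have := (mul_le_mul_of_nonneg_left hothers (norm_nonneg _)).trans hprod
    rwa [one_div, inv_pow, ← div_eq_mul_inv, div_le_iff₀ (by positivity)] at this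
  have hquot : ‖z j / (q : ℂ) ^ (m + i : ℕ)‖ ≤ 3 * 4 ^ Fintype.card ι := by
    have := norm_le_norm_add_norm_sub (1 : ℂ) (z j / (q : ℂ) ^ (m + i : ℕ))
    rw [norm_one] at this
    have : (1 : ℝ) ≤ 4 ^ Fintype.card ι := one_le_pow₀ (by norm_num)
    linarith
  rw [norm_div, norm_pow, Complex.norm_real, Real.norm_of_nonneg hq0.le,
    div_le_iff₀ (by positivity)] at hquot
  refine hquot.trans ?_
  gcongr
  · linarith
  · omega

lemma exists_eventually_norm_localRoot_le {ι : Type*} [Fintype ι] {L : ℂ → ℂ} {ν : ι → ℕ → ℂ}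
    (hL : ∀ᶠ x : ℝ in atTop, L x ≠ 0) (hν : HasLocalRoots L ν) :
    ∃ (C : ℝ) (K : ℕ), ∀ᶠ p : Nat.Primes in cofinite, ∀ j, ‖ν j p‖ ≤ C * ((p : ℕ) : ℝ) ^ K := by
  obtain ⟨x₀, hx₀⟩ := eventually_atTop.mp hL
  obtain ⟨m, hm⟩ := exists_nat_ge (max x₀ 2)
  refine ⟨3 * 4 ^ Fintype.card ι, m + Fintype.card ι, ?_⟩
  have hprod : ∀ i : Fin (Fintype.card ι + 1), ∀ᶠ p : Nat.Primes in cofinite,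
      ∏ j, ‖1 - ν j p / (((p : ℕ) : ℝ) : ℂ) ^ (m + i : ℕ)‖ ≤ 2 := fun i => by
    have hmi : max x₀ 2 ≤ ((m + i : ℕ) : ℝ) := hm.trans (by push_cast; simp)
    have hre : 1 < ((m + i : ℕ) : ℂ).re := by
      rw [Complex.natCast_re]; linarith [le_max_right x₀ 2]
    have hne : L ((m + i : ℕ) : ℂ) ≠ 0 := by
      simpa using hx₀ ((m + i : ℕ) : ℝ) ((le_max_left _ _).trans hmi)
    have hlim := ((tendsto_cofinite_one_of_hasProd (hν _ hre) hne).inv₀ one_ne_zero).norm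
    rw [inv_one, norm_one] at hlim
    filter_upwards [hlim.eventually_le_const one_lt_two] with p hp
    simpa only [Complex.cpow_natCast, Finset.prod_inv_distrib, inv_inv, norm_prod,
      Complex.ofReal_natCast] using hp
  filter_upwards [eventually_all.mpr hprod] with p hp j
  exact norm_le_of_prod_norm_one_sub_le (fun j => ν j p) (by exact_mod_cast p.2.two_le) m hp j

lemma exists_norm_localRoot_le_pow {ι : Type*} [Fintype ι] {L : ℂ → ℂ} {ν : ι → ℕ → ℂ}
    (hL : ∀ᶠ x : ℝ in atTop, L x ≠ 0) (hν : HasLocalRoots L ν) :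
    ∃ K : ℕ, ∀ p : ℕ, p.Prime → ∀ j, ‖ν j p‖ ≤ (p : ℝ) ^ K := by
  obtain ⟨C, K, hCK⟩ := exists_eventually_norm_localRoot_le hL hν
  have hexc : {p : Nat.Primes | ¬ ∀ j, ‖ν j p‖ ≤ C * ((p : ℕ) : ℝ) ^ K}.Finite :=
    eventually_cofinite.mp hCK
  obtain ⟨M, hM⟩ := (hexc.image fun p : Nat.Primes => ∑ j, ‖ν j p‖).bddAbove
  obtain ⟨K', hK'⟩ := pow_unbounded_of_one_lt (max M C) (by norm_num : (1 : ℝ) < 2)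
  refine ⟨K' + K, fun p hp j => ?_⟩
  have hp2 : (2 : ℝ) ≤ p := by exact_mod_cast hp.two_le
  have hmax : max M C ≤ (p : ℝ) ^ K' := hK'.le.trans (by gcongr)
  rw [pow_add]
  by_cases hgood : ∀ j, ‖ν j p‖ ≤ C * (p : ℝ) ^ K
  · exact (hgood j).trans (by gcongr; exact (le_max_right _ _).trans hmax)
  · calc ‖ν j p‖ ≤ ∑ j, ‖ν j p‖ :=
          Finset.single_le_sum (f := fun j => ‖ν j p‖) (fun _ _ => norm_nonneg _)
            (Finset.mem_univ j)
      _ ≤ M := hM ⟨⟨p, hp⟩, hgood, rfl⟩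
      _ ≤ (p : ℝ) ^ K' := (le_max_left _ _).trans hmax
      _ ≤ _ := le_mul_of_one_le_right (by positivity) (one_le_pow₀ (by linarith))

/-- The completely multiplicative function with prescribed values `v p` at the primes; its Dirichlet
series is one of the factors of a polynomial Euler product. -/
def complMul (v : ℕ → ℂ) : ℕ →*₀ ℂ where
  toFun n := if n = 0 then 0 else n.factorization.prod fun p e => v p ^ e
  map_zero' := by simp
  map_one' := by simp
  map_mul' m n := by
    by_cases hm : m = 0
    · simp [hm]
    by_cases hn : n = 0
    · simp [hn]
    simp only [hm, hn, mul_eq_zero, or_self, if_false]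
    rw [Nat.factorization_mul hm hn, Finsupp.prod_add_index' (by simp) (by simp [pow_add])]

lemma complMul_prime (v : ℕ → ℂ) {p : ℕ} (hp : p.Prime) : complMul v p = v p := by
  change (if p = 0 then 0 else p.factorization.prod fun p e => v p ^ e) = v p
  simp [hp.ne_zero, hp.factorization]

lemma norm_complMul_le {v : ℕ → ℂ} {K : ℕ} (hv : ∀ p : ℕ, p.Prime → ‖v p‖ ≤ (p : ℝ) ^ K)
    {n : ℕ} (hn : n ≠ 0) : ‖complMul v n‖ ≤ (n : ℝ) ^ K := by
  induction n using Nat.recOnMul with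
  | zero => exact absurd rfl hn
  | one => simp
  | prime p hp => rw [complMul_prime v hp]; exact hv p hp
  | mul m n hm hn' =>
    obtain ⟨hm0, hn0⟩ := mul_ne_zero_iff.mp hn
    rw [map_mul, norm_mul, Nat.cast_mul, mul_pow]
    exact mul_le_mul (hm hm0) (hn' hn0) (norm_nonneg _) (by positivity)

lemma LSeriesSummable_complMul {v : ℕ → ℂ} {K : ℕ}
    (hv : ∀ p : ℕ, p.Prime → ‖v p‖ ≤ (p : ℝ) ^ K) {s : ℂ} (hs : (K : ℝ) + 1 < s.re) :
    LSeriesSummable (complMul v) s := by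
  refine LSeriesSummable_of_le_const_mul_rpow (x := K + 1) hs ⟨1, fun n hn => ?_⟩
  rw [one_mul, add_sub_cancel_right, Real.rpow_natCast]
  exact norm_complMul_le hv hn

lemma hasProd_LSeries_complMul {v : ℕ → ℂ} {s : ℂ}
    (hsum : LSeriesSummable (complMul v) s) :
    HasProd (fun p : Nat.Primes => (1 - v p / ((p : ℕ) : ℂ) ^ s)⁻¹) (LSeries (complMul v) s) := by
  let f : ℕ →*₀ ℂ :=
    { toFun := fun n => complMul v n * (n : ℂ) ^ (-s)
      map_zero' := by simp
      map_one' := by simp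
      map_mul' := fun m n => by
        rw [map_mul, Nat.cast_mul, Complex.natCast_mul_natCast_cpow]; ring }
  have hterm : ∀ n, f n = LSeries.term (complMul v) s n := fun n => by
    change complMul v n * (n : ℂ) ^ (-s) = _
    rw [LSeries.term_def₀ (map_zero _)]
  have hf : Summable (‖f ·‖) := by simpa only [hterm] using hsum.norm
  convert EulerProduct.eulerProduct_completely_multiplicative_hasProd hf using 1
  · funext p
    change _ = (1 - complMul v p * ((p : ℕ) : ℂ) ^ (-s))⁻¹
    rw [complMul_prime v p.2, Complex.cpow_neg, div_eq_mul_inv]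
  · exact (tsum_congr hterm).symm

/-- `complMul v` as an arithmetic function, for Dirichlet convolution. -/
def complMulArith (v : ℕ → ℂ) : ArithmeticFunction ℂ := ⟨complMul v, map_zero _⟩

lemma LSeriesHasSum_prod_complMulArith {ι : Type*} {ν : ι → ℕ → ℂ} {s : ℂ} {S : Finset ι}
    (h : ∀ j ∈ S, LSeriesSummable (complMul (ν j)) s) :
    LSeriesHasSum (∏ j ∈ S, complMulArith (ν j) : ArithmeticFunction ℂ) s
      (∏ j ∈ S, LSeries (complMul (ν j)) s) := by
  classical
  induction S using Finset.induction_on with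
  | empty =>
    have hone := hasSum_single (f := LSeries.term (1 : ArithmeticFunction ℂ) s) 1
      (fun n hn => by simp [LSeries.term, hn])
    rwa [show LSeries.term (1 : ArithmeticFunction ℂ) s 1 = 1 by simp [LSeries.term]] at hone
  | insert j S hj ih =>
    rw [Finset.prod_insert hj, Finset.prod_insert hj]
    exact ArithmeticFunction.LSeriesHasSum_mul (h j (Finset.mem_insert_self j S)).LSeriesHasSum
      (ih fun i hi => h i (Finset.mem_insert_of_mem hi))

lemma coeff_eq_prod_complMulArith {ι : Type*} [Fintype ι] {L : ℂ → ℂ} {a : ℕ → ℂ}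
    {ν : ι → ℕ → ℂ} (hd : ∀ s : ℂ, 1 < s.re → LSeriesHasSum a s (L s))
    (ha : ∃ n ≠ 0, a n ≠ 0) (hν : HasLocalRoots L ν) {n : ℕ} (hn : n ≠ 0) :
    a n = (∏ j, complMulArith (ν j) : ArithmeticFunction ℂ) n := by
  have hlt : ∀ {f : ℕ → ℂ} {s : ℂ}, LSeriesSummable f s → LSeries.abscissaOfAbsConv f < ⊤ :=
    fun h => h.abscissaOfAbsConv_le.trans_lt (EReal.coe_lt_top _)
  have habs := hlt (hd 2 (by norm_num)).LSeriesSummable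
  have hL : ∀ᶠ x : ℝ in atTop, L x ≠ 0 := by
    filter_upwards [eventually_LSeries_ne_zero ha habs, eventually_gt_atTop 1] with x hx hx1
    rwa [(hd x hx1).LSeries_eq] at hx
  obtain ⟨K, hK⟩ := exists_norm_localRoot_le_pow hL hν
  have hsum : ∀ s : ℂ, (K : ℝ) + 1 < s.re → ∀ j, LSeriesSummable (complMul (ν j)) s :=
    fun s hs j => LSeriesSummable_complMul (fun p hp => hK p hp j) hs
  refine LSeries.eq_of_LSeries_eventually_eq (f := a) (g := (∏ j, complMulArith (ν j) : _)) habs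
    (hlt (s := ((K + 2 : ℝ) : ℂ)) (LSeriesHasSum_prod_complMulArith fun j _ => hsum _ (by
      rw [Complex.ofReal_re]; linarith) j).LSeriesSummable) ?_ hn
  filter_upwards [eventually_gt_atTop ((K : ℝ) + 1)] with x hx
  have hx1 : 1 < x := by linarith [K.cast_nonneg (α := ℝ)]
  rw [(hd x hx1).LSeries_eq,
    (LSeriesHasSum_prod_complMulArith fun j _ => hsum x hx j).LSeries_eq]
  exact (hν x hx1).unique
    (hasProd_prod fun j _ => hasProd_LSeries_complMul (hsum x hx j))

/-- The local factor of a Dirichlet series at `p`: the generating series of its coefficients at the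
powers of `p`. -/
def localSeries (p : ℕ) (f : ℕ → ℂ) : PowerSeries ℂ :=
  PowerSeries.mk fun m => f (p ^ m)

lemma localSeries_mul {p : ℕ} (hp : p.Prime) (f g : ArithmeticFunction ℂ) :
    localSeries p (f * g : ArithmeticFunction ℂ) = localSeries p f * localSeries p g := by
  ext m
  rw [localSeries, PowerSeries.coeff_mk, PowerSeries.coeff_mul, ArithmeticFunction.mul_apply,
    Nat.sum_divisorsAntidiagonal (fun i j => f i * g j), Nat.sum_divisors_prime_pow hp,
    Finset.Nat.sum_antidiagonal_eq_sum_range_succ_mk]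
  refine Finset.sum_congr rfl fun i hi => ?_
  have him : i ≤ m := by simpa [Nat.lt_succ_iff] using hi
  simp only [localSeries, PowerSeries.coeff_mk]
  rw [Nat.pow_div him hp.pos]

lemma localSeries_one {p : ℕ} (hp : p.Prime) :
    localSeries p (1 : ArithmeticFunction ℂ) = 1 := by
  ext m
  rw [localSeries, PowerSeries.coeff_mk, PowerSeries.coeff_one, ArithmeticFunction.one_apply]
  congr 1
  simp [hp.ne_one]

lemma localSeries_prod {p : ℕ} (hp : p.Prime) {ι : Type*} (S : Finset ι)
    (f : ι → ArithmeticFunction ℂ) :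
    localSeries p (∏ j ∈ S, f j : ArithmeticFunction ℂ) = ∏ j ∈ S, localSeries p (f j) := by
  classical
  induction S using Finset.induction_on with
  | empty => rw [Finset.prod_empty, Finset.prod_empty, localSeries_one hp]
  | insert j S hj ih => rw [Finset.prod_insert hj, Finset.prod_insert hj, localSeries_mul hp, ih]

lemma localSeries_complMulArith_mul {p : ℕ} (hp : p.Prime) (v : ℕ → ℂ) :
    localSeries p (complMulArith v) * (1 - PowerSeries.C (v p) * PowerSeries.X) = 1 := by
  have hpow : ∀ m, complMulArith v (p ^ m) = v p ^ m := fun m => by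
    change complMul v (p ^ m) = _
    rw [map_pow, complMul_prime v hp]
  ext m
  rw [mul_sub, mul_one, ← mul_assoc, map_sub]
  rcases m with _ | m
  · simp [localSeries, hpow, PowerSeries.coeff_zero_mul_X]
  · rw [PowerSeries.coeff_succ_mul_X, PowerSeries.coeff_mul_C]
    simp [localSeries, hpow, pow_succ, PowerSeries.coeff_one]

lemma localSeries_mul_prod_eq_one {ι : Type*} [Fintype ι] {L : ℂ → ℂ} {a : ℕ → ℂ}
    {ν : ι → ℕ → ℂ} (hd : ∀ s : ℂ, 1 < s.re → LSeriesHasSum a s (L s))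
    (ha : ∃ n ≠ 0, a n ≠ 0) (hν : HasLocalRoots L ν) {p : ℕ} (hp : p.Prime) :
    localSeries p a * ∏ j, (1 - PowerSeries.C (ν j p) * PowerSeries.X) = 1 := by
  have hloc : localSeries p a =
      localSeries p (∏ j, complMulArith (ν j) : ArithmeticFunction ℂ) := by
    ext m
    simp only [localSeries, PowerSeries.coeff_mk]
    exact coeff_eq_prod_complMulArith hd ha hν (pow_ne_zero _ hp.ne_zero)
  rw [hloc, localSeries_prod hp, ← Finset.prod_mul_distrib]
  exact Finset.prod_eq_one fun j _ => localSeries_complMulArith_mul hp (ν j)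

lemma hasSum_coeff_mul_one_sub {A : PowerSeries ℂ} {z w : ℂ}
    (hA : HasSum (fun m => A.coeff m * z ^ m) w) (c : ℂ) :
    HasSum (fun m => (A * (1 - PowerSeries.C c * PowerSeries.X)).coeff m * z ^ m)
      (w * (1 - c * z)) := by
  have hshift : HasSum (fun m => (A * (PowerSeries.C c * PowerSeries.X)).coeff m * z ^ m)
      (w * (c * z)) := by
    rw [← hasSum_nat_add_iff' 1]
    simp only [Finset.range_one, Finset.sum_singleton]
    rw [← mul_assoc, PowerSeries.coeff_zero_mul_X, zero_mul, sub_zero]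
    refine (hA.mul_right (c * z)).congr_fun fun m => ?_
    rw [PowerSeries.coeff_succ_mul_X, PowerSeries.coeff_mul_C]
    ring
  have hsub := hA.sub hshift
  rw [← mul_one_sub] at hsub
  exact hsub.congr_fun fun m => by rw [mul_sub, mul_one, map_sub, sub_mul]

lemma hasSum_coeff_mul_prod_one_sub {ι : Type*} {A : PowerSeries ℂ} {z w : ℂ}
    (hA : HasSum (fun m => A.coeff m * z ^ m) w) (S : Finset ι) (c : ι → ℂ) :
    HasSum (fun m => (A * ∏ i ∈ S, (1 - PowerSeries.C (c i) * PowerSeries.X)).coeff m * z ^ m)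
      (w * ∏ i ∈ S, (1 - c i * z)) := by
  classical
  induction S using Finset.induction_on with
  | empty => simpa using hA
  | insert i S hi ih =>
    rw [Finset.prod_insert hi, Finset.prod_insert hi, mul_comm (1 - PowerSeries.C (c i) * _),
      mul_comm (1 - c i * z), ← mul_assoc, ← mul_assoc]
    exact hasSum_coeff_mul_one_sub ih (c i)

lemma coeff_zero_prod_one_sub {ι : Type*} (S : Finset ι) (c : ι → ℂ) :
    (∏ j ∈ S, (1 - PowerSeries.C (c j) * PowerSeries.X)).coeff 0 = 1 := by
  simp [map_prod]

lemma coeff_one_prod_one_sub {ι : Type*} (S : Finset ι) (c : ι → ℂ) :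
    (∏ j ∈ S, (1 - PowerSeries.C (c j) * PowerSeries.X)).coeff 1 = -∑ j ∈ S, c j := by
  classical
  induction S using Finset.induction_on with
  | empty => simp [PowerSeries.coeff_one]
  | insert j S hj ih =>
    rw [Finset.prod_insert hj, sub_mul, one_mul, mul_assoc, mul_comm PowerSeries.X, ← mul_assoc,
      map_sub, ih, PowerSeries.coeff_succ_mul_X 0, PowerSeries.coeff_C_mul,
      coeff_zero_prod_one_sub, Finset.sum_insert hj]
    ring

lemma coeff_prime_eq_sum_localRoots {ι : Type*} [Fintype ι] {a : ℕ → ℂ} {p : ℕ} {c : ι → ℂ}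
    (h : localSeries p a * ∏ j, (1 - PowerSeries.C (c j) * PowerSeries.X) = 1) :
    a p = ∑ j, c j := by
  have h₀ := congrArg (PowerSeries.coeff 0) h
  have h₁ := congrArg (PowerSeries.coeff 1) h
  rw [PowerSeries.coeff_mul, Finset.Nat.sum_antidiagonal_eq_sum_range_succ_mk] at h₀ h₁
  simp only [Finset.sum_range_succ, Finset.range_zero, Finset.sum_empty, zero_add, localSeries,
    PowerSeries.coeff_mk, pow_zero, pow_one, Nat.sub_zero, Nat.sub_self, coeff_zero_prod_one_sub,
    coeff_one_prod_one_sub, PowerSeries.coeff_one, one_ne_zero, if_true, if_false,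
    mul_one] at h₀ h₁
  rw [h₀] at h₁
  linear_combination h₁

lemma summable_coeff_localSeries {a : ℕ → ℂ}
    (ha : ∀ ε : ℝ, 0 < ε → a =O[atTop] fun n : ℕ => (n : ℝ) ^ ε) {p : ℕ} (hp : p.Prime) {z : ℂ}
    (hz : ‖z‖ < 1) : Summable fun m => (localSeries p a).coeff m * z ^ m := by
  have hp1 : (1 : ℝ) < p := by exact_mod_cast hp.one_lt
  obtain ⟨ε, hlt, hε⟩ : ∃ ε : ℝ, (p : ℝ) ^ ε * ‖z‖ < 1 ∧ 0 < ε := by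
    have hcont : ContinuousAt (fun ε : ℝ => (p : ℝ) ^ ε * ‖z‖) 0 :=
      (Real.continuousAt_const_rpow (by positivity)).mul_const _
    have hev := (hcont.eventually_lt_const (by simpa using hz)).filter_mono
      (nhdsWithin_le_nhds (s := Set.Ioi 0))
    exact (hev.and self_mem_nhdsWithin).exists
  have hcoeff : (fun m => (localSeries p a).coeff m) =O[atTop] fun m : ℕ => ((p : ℝ) ^ ε) ^ m := by
    refine ((ha ε hε).comp_tendsto (tendsto_pow_atTop_atTop_of_one_lt hp.one_lt)).congr
      (fun m => by simp [localSeries]) fun m => ?_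
    rw [Function.comp_apply, Nat.cast_pow, ← Real.rpow_natCast, ← Real.rpow_natCast,
      ← Real.rpow_mul (by positivity), ← Real.rpow_mul (by positivity), mul_comm ε]
  have hgeom := hcoeff.mul (isBigO_refl (fun m : ℕ => z ^ m) atTop).norm_right
  refine summable_of_isBigO_nat (summable_geometric_of_lt_one (by positivity) hlt)
    (hgeom.congr_right fun m => ?_)
  rw [norm_pow, mul_pow]

lemma norm_localRoot_le_one {ι : Type*} [Fintype ι] {a : ℕ → ℂ}
    (ha : ∀ ε : ℝ, 0 < ε → a =O[atTop] fun n : ℕ => (n : ℝ) ^ ε) {p : ℕ} (hp : p.Prime)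
    {c : ι → ℂ} (h : localSeries p a * ∏ j, (1 - PowerSeries.C (c j) * PowerSeries.X) = 1)
    (j : ι) : ‖c j‖ ≤ 1 := by
  -- If `‖c j‖ > 1`, then the series converges at `(c j)⁻¹`, where the product vanishes.
  by_contra! hj
  have hsum := summable_coeff_localSeries ha hp (z := (c j)⁻¹)
    (by rw [norm_inv]; exact inv_lt_one_of_one_lt₀ hj)
  have hzero := hasSum_coeff_mul_prod_one_sub hsum.hasSum Finset.univ c
  have hcj : c j ≠ 0 := norm_pos_iff.mp (one_pos.trans hj)
  rw [h, Finset.prod_eq_zero (Finset.mem_univ j) (by rw [mul_inv_cancel₀ hcj, sub_self]),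
    mul_zero] at hzero
  have hone := hasSum_single (f := fun m => PowerSeries.coeff m (1 : PowerSeries ℂ) * (c j)⁻¹ ^ m) 0
    (fun m hm => by simp [PowerSeries.coeff_one, hm])
  have heq := hzero.unique hone
  simp at heq

/-! ### The logarithm of the Euler product -/

section PrimeSum

variable {a : ℕ → ℂ} {B σ : ℝ} {s w : ℂ} {p : ℕ}

lemma summable_primes_rpow {x : ℝ} (hx : 1 < x) :
    Summable fun p : Nat.Primes => ((p : ℕ) : ℝ) ^ (-x) :=
  Nat.Primes.summable_rpow.mpr (neg_lt_neg hx)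

lemma norm_div_prime_cpow_le (hp : p.Prime) (hw : ‖w‖ ≤ B) (hs : σ ≤ s.re) :
    ‖w / (p : ℂ) ^ s‖ ≤ B * (p : ℝ) ^ (-σ) := by
  have one_le_p : (1 : ℝ) ≤ p := by exact_mod_cast hp.one_le
  have hB : 0 ≤ B := (norm_nonneg w).trans hw
  rw [norm_div, Complex.norm_natCast_cpow_of_pos hp.pos, div_eq_mul_inv,
    ← Real.rpow_neg (by positivity)]
  gcongr

lemma norm_div_prime_cpow_le_of_half (hp : p.Prime) (hw : ‖w‖ ≤ 1) (hs : 1 / 2 ≤ s.re) :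
    ‖w / (p : ℂ) ^ s‖ ≤ 3 / 4 := by
  have hsqrt : (4 / 3 : ℝ) ≤ √2 := Real.le_sqrt_of_sq_le (by norm_num)
  calc ‖w / (p : ℂ) ^ s‖ ≤ 1 * (p : ℝ) ^ (-(1 / 2) : ℝ) := norm_div_prime_cpow_le hp hw hs
    _ = (p : ℝ) ^ (-(1 / 2) : ℝ) := one_mul _
    _ ≤ (2 : ℝ) ^ (-(1 / 2) : ℝ) :=
      Real.rpow_le_rpow_of_nonpos (by norm_num) (by exact_mod_cast hp.two_le) (by norm_num)
    _ = (√2)⁻¹ := by rw [Real.rpow_neg (by norm_num), ← Real.sqrt_eq_rpow]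
    _ ≤ (4 / 3 : ℝ)⁻¹ := inv_anti₀ (by norm_num) hsqrt
    _ = 3 / 4 := by norm_num

lemma differentiableAt_div_prime_cpow (hp : p.Prime) (w s : ℂ) :
    DifferentiableAt ℂ (fun s => w / (p : ℂ) ^ s) s := by
  have hp0 : (p : ℂ) ≠ 0 := by exact_mod_cast hp.ne_zero
  exact (differentiableAt_const w).div (differentiableAt_id.const_cpow (Or.inl hp0))
    (by simp [Complex.cpow_eq_zero_iff, hp0])

lemma tendsto_prime_rpow_neg (hp : p.Prime) :
    Tendsto (fun x : ℝ => (p : ℝ) ^ (-x)) atTop (𝓝 0) :=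
  (tendsto_rpow_atBot_of_base_gt_one _ (by exact_mod_cast hp.one_lt)).comp tendsto_neg_atTop_atBot

lemma isOpen_re_gt (x : ℝ) : IsOpen {s : ℂ | x < s.re} :=
  isOpen_lt continuous_const Complex.continuous_re

/-- The prime part `∑ a(p) p⁻ˢ` of the logarithm of a Dirichlet series. -/
noncomputable def primeSum (a : ℕ → ℂ) (s : ℂ) : ℂ := ∑' p : Nat.Primes, a p / ((p : ℕ) : ℂ) ^ s

lemma summable_primeSum (ha : ∀ p, p.Prime → ‖a p‖ ≤ B) (hs : 1 < s.re) :
    Summable fun p : Nat.Primes => a p / ((p : ℕ) : ℂ) ^ s :=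
  Summable.of_norm_bounded ((summable_primes_rpow hs).mul_left B)
    fun p => norm_div_prime_cpow_le p.2 (ha p p.2) le_rfl

lemma differentiableOn_primeSum (ha : ∀ p, p.Prime → ‖a p‖ ≤ B) (hσ : 1 < σ) :
    DifferentiableOn ℂ (primeSum a) {s | σ < s.re} :=
  Complex.differentiableOn_tsum_of_summable_norm
    (u := fun p : Nat.Primes => B * ((p : ℕ) : ℝ) ^ (-σ))
    ((summable_primes_rpow hσ).mul_left _)
    (fun p s _ => (differentiableAt_div_prime_cpow p.2 _ s).differentiableWithinAt)
    (isOpen_re_gt σ) fun p _ hs => norm_div_prime_cpow_le p.2 (ha p p.2) (le_of_lt hs)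

lemma exists_norm_primeSum_le (ha : ∀ p, p.Prime → ‖a p‖ ≤ B) (hσ : 1 < σ) :
    ∃ C, ∀ s : ℂ, σ ≤ s.re → ‖primeSum a s‖ ≤ C :=
  ⟨∑' p : Nat.Primes, B * ((p : ℕ) : ℝ) ^ (-σ), fun _ hs =>
    tsum_of_norm_bounded ((summable_primes_rpow hσ).mul_left B).hasSum
      fun p => norm_div_prime_cpow_le p.2 (ha p p.2) hs⟩

lemma tendsto_primeSum (ha : ∀ p, p.Prime → ‖a p‖ ≤ B) (y : ℝ) :
    Tendsto (fun x : ℝ => primeSum a (x + y * Complex.I)) atTop (𝓝 0) := by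
  rw [← tsum_zero (β := Nat.Primes)]
  refine tendsto_tsum_of_dominated_convergence
    (bound := fun p : Nat.Primes => B * ((p : ℕ) : ℝ) ^ (-2 : ℝ))
    ((summable_primes_rpow one_lt_two).mul_left B) (fun p => ?_) ?_
  · refine squeeze_zero_norm (a := fun x : ℝ => B * ((p : ℕ) : ℝ) ^ (-x))
      (fun x => norm_div_prime_cpow_le p.2 (ha p p.2) (by simp)) ?_
    simpa only [mul_zero] using (tendsto_prime_rpow_neg p.2).const_mul B
  · filter_upwards [eventually_ge_atTop 2] with x hx p
    exact norm_div_prime_cpow_le p.2 (ha p p.2) (by simpa using hx)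

end PrimeSum

section LogTail

variable {ι : Type*} [Fintype ι] {ν : ι → ℕ → ℂ} {σ : ℝ} {s : ℂ} {p : ℕ}

/-- The contribution of the higher powers of `p` to the logarithm of an Euler product with local
roots `ν`. -/
noncomputable def logTailTerm (ν : ι → ℕ → ℂ) (p : ℕ) (s : ℂ) : ℂ :=
  ∑ j, (-Complex.log (1 - ν j p / (p : ℂ) ^ s) - ν j p / (p : ℂ) ^ s)

/-- The contribution of all higher prime powers to the logarithm; it is bounded on
`Re s ≥ σ > 1 / 2`. -/
noncomputable def logTail (ν : ι → ℕ → ℂ) (s : ℂ) : ℂ :=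
  ∑' p : Nat.Primes, logTailTerm ν p s

lemma norm_log_one_sub_add_self_le {z : ℂ} (hz : ‖z‖ ≤ 3 / 4) :
    ‖-Complex.log (1 - z) - z‖ ≤ 2 * ‖z‖ ^ 2 := by
  have hlog : ‖Complex.log (1 + -z) - -z‖ ≤ ‖-z‖ ^ 2 * (1 - ‖-z‖)⁻¹ / 2 :=
    Complex.norm_log_one_add_sub_self_le (by rw [norm_neg]; linarith)
  have hinv : (1 - ‖z‖)⁻¹ ≤ 4 := by
    rw [inv_le_comm₀ (by linarith) (by norm_num)]; linarith
  calc ‖-Complex.log (1 - z) - z‖ = ‖Complex.log (1 + -z) - -z‖ := by rw [← norm_neg]; ring_nf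
    _ ≤ ‖z‖ ^ 2 * (1 - ‖z‖)⁻¹ / 2 := by simpa only [norm_neg] using hlog
    _ ≤ ‖z‖ ^ 2 * 4 / 2 := by gcongr
    _ = 2 * ‖z‖ ^ 2 := by ring

lemma norm_logTailTerm_le (hν : ∀ j p, p.Prime → ‖ν j p‖ ≤ 1) (hp : p.Prime)
    (hs : 1 / 2 ≤ s.re) (hσ : σ ≤ s.re) :
    ‖logTailTerm ν p s‖ ≤ Fintype.card ι * (2 * (p : ℝ) ^ (-(2 * σ))) := by
  have hterm (j : ι) : ‖-Complex.log (1 - ν j p / (p : ℂ) ^ s) - ν j p / (p : ℂ) ^ s‖ ≤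
      2 * (p : ℝ) ^ (-(2 * σ)) := by
    calc _ ≤ 2 * ‖ν j p / (p : ℂ) ^ s‖ ^ 2 :=
          norm_log_one_sub_add_self_le (norm_div_prime_cpow_le_of_half hp (hν j p hp) hs)
      _ ≤ 2 * (1 * (p : ℝ) ^ (-σ)) ^ 2 := by
          gcongr
          exact norm_div_prime_cpow_le hp (hν j p hp) hσ
      _ = 2 * (p : ℝ) ^ (-(2 * σ)) := by
          rw [one_mul, ← Real.rpow_mul_natCast (by positivity)]
          ring_nf
  calc ‖logTailTerm ν p s‖ ≤ ∑ _j : ι, 2 * (p : ℝ) ^ (-(2 * σ)) :=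
        norm_sum_le_of_le _ fun j _ => hterm j
    _ = _ := by rw [Finset.sum_const, Finset.card_univ, nsmul_eq_mul]

lemma one_sub_div_prime_cpow_mem_slitPlane {w : ℂ} (hw : ‖w‖ ≤ 1) (hp : p.Prime)
    (hs : 1 / 2 ≤ s.re) : 1 - w / (p : ℂ) ^ s ∈ Complex.slitPlane := by
  refine Or.inl ?_
  have hre := (Complex.re_le_norm _).trans (norm_div_prime_cpow_le_of_half hp hw hs)
  rw [Complex.sub_re, Complex.one_re]
  linarith

lemma differentiableAt_logTailTerm (hν : ∀ j p, p.Prime → ‖ν j p‖ ≤ 1) (hp : p.Prime)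
    (hs : 1 / 2 ≤ s.re) : DifferentiableAt ℂ (logTailTerm ν p) s :=
  DifferentiableAt.fun_sum fun j _ =>
    have hdiv := differentiableAt_div_prime_cpow hp (ν j p) s
    (((differentiableAt_const 1).sub hdiv).clog
      (one_sub_div_prime_cpow_mem_slitPlane (hν j p hp) hp hs)).neg.sub hdiv

lemma summable_card_mul_primes_rpow (hσ : 1 / 2 < σ) :
    Summable fun p : Nat.Primes => Fintype.card ι * (2 * ((p : ℕ) : ℝ) ^ (-(2 * σ))) :=
  ((summable_primes_rpow (by linarith)).mul_left 2).mul_left _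

lemma differentiableOn_logTail (hν : ∀ j p, p.Prime → ‖ν j p‖ ≤ 1) (hσ : 1 / 2 < σ) :
    DifferentiableOn ℂ (logTail ν) {s | σ < s.re} :=
  Complex.differentiableOn_tsum_of_summable_norm
    (summable_card_mul_primes_rpow (ι := ι) hσ)
    (fun p _ hs => (differentiableAt_logTailTerm hν p.2
      (hσ.le.trans (le_of_lt hs))).differentiableWithinAt)
    (isOpen_re_gt σ)
    fun p _ hs => norm_logTailTerm_le hν p.2 (hσ.le.trans (le_of_lt hs)) (le_of_lt hs)

lemma summable_logTailTerm (hν : ∀ j p, p.Prime → ‖ν j p‖ ≤ 1) (hs : 1 / 2 < s.re) :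
    Summable fun p : Nat.Primes => logTailTerm ν p s :=
  Summable.of_norm_bounded (summable_card_mul_primes_rpow (ι := ι) hs)
    fun p => norm_logTailTerm_le hν p.2 hs.le le_rfl

lemma exists_norm_logTail_le (hν : ∀ j p, p.Prime → ‖ν j p‖ ≤ 1) (hσ : 1 / 2 < σ) :
    ∃ C, ∀ s : ℂ, σ ≤ s.re → ‖logTail ν s‖ ≤ C :=
  ⟨∑' p : Nat.Primes, Fintype.card ι * (2 * ((p : ℕ) : ℝ) ^ (-(2 * σ))), fun _ hs =>
    tsum_of_norm_bounded (summable_card_mul_primes_rpow hσ).hasSum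
      fun p => norm_logTailTerm_le hν p.2 (hσ.le.trans hs) hs⟩

lemma tendsto_logTail (hν : ∀ j p, p.Prime → ‖ν j p‖ ≤ 1) (y : ℝ) :
    Tendsto (fun x : ℝ => logTail ν (x + y * Complex.I)) atTop (𝓝 0) := by
  rw [← tsum_zero (β := Nat.Primes)]
  refine tendsto_tsum_of_dominated_convergence
    (summable_card_mul_primes_rpow (ι := ι) (σ := 1) (by norm_num)) (fun p => ?_) ?_
  · refine squeeze_zero_norm'
      (a := fun x : ℝ => Fintype.card ι * (2 * ((p : ℕ) : ℝ) ^ (-(2 * x)))) ?_ ?_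
    · filter_upwards [eventually_ge_atTop 1] with x hx
      exact norm_logTailTerm_le hν p.2 (by simp; linarith) (by simp)
    · simpa only [mul_zero, Function.comp_def, id] using (((tendsto_prime_rpow_neg p.2).comp
        (tendsto_id.const_mul_atTop two_pos)).const_mul 2).const_mul (Fintype.card ι : ℝ)
  · filter_upwards [eventually_ge_atTop 1] with x hx p
    exact norm_logTailTerm_le hν p.2 (by simp; linarith) (by simpa using hx)

/-- `primeSum a + logTail ν`, the logarithm that the Euler product provides in `Re s > 1`. -/
noncomputable def eulerLog (a : ℕ → ℂ) (ν : ι → ℕ → ℂ) (s : ℂ) : ℂ := primeSum a s + logTail ν s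

/-- `L` has a polynomial Euler product whose local roots are at most `1` in absolute value and sum
to the coefficient `a p` at each prime `p`. -/
structure HasBoundedRoots (L : ℂ → ℂ) (a : ℕ → ℂ) (ν : ι → ℕ → ℂ) : Prop where
  hasLocalRoots : HasLocalRoots L ν
  norm_le_one : ∀ j p, p.Prime → ‖ν j p‖ ≤ 1
  coeff_prime : ∀ p, p.Prime → a p = ∑ j, ν j p

namespace HasBoundedRoots

variable {L : ℂ → ℂ} {a : ℕ → ℂ}

lemma norm_coeff_prime_le (h : HasBoundedRoots L a ν) :
    ∀ p, p.Prime → ‖a p‖ ≤ Fintype.card ι := by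
  intro p hp
  calc ‖a p‖ ≤ ∑ _j : ι, (1 : ℝ) := by
        rw [h.coeff_prime p hp]
        exact norm_sum_le_of_le _ fun j _ => h.norm_le_one j p hp
    _ = Fintype.card ι := by simp

lemma exp_coeff_div_add_logTailTerm (h : HasBoundedRoots L a ν) (hp : p.Prime)
    (hs : 1 / 2 ≤ s.re) :
    Complex.exp (a p / (p : ℂ) ^ s + logTailTerm ν p s) = ∏ j, (1 - ν j p / (p : ℂ) ^ s)⁻¹ := by
  have hsum : a p / (p : ℂ) ^ s + logTailTerm ν p s =
      ∑ j, -Complex.log (1 - ν j p / (p : ℂ) ^ s) := by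
    rw [logTailTerm, Finset.sum_sub_distrib, h.coeff_prime p hp, Finset.sum_div]
    ring
  rw [hsum, Complex.exp_sum]
  refine Finset.prod_congr rfl fun j _ => ?_
  rw [Complex.exp_neg, Complex.exp_log (Complex.slitPlane_ne_zero
    (one_sub_div_prime_cpow_mem_slitPlane (h.norm_le_one j p hp) hp hs))]

lemma exp_eulerLog (h : HasBoundedRoots L a ν) (hs : 1 < s.re) :
    Complex.exp (eulerLog a ν s) = L s := by
  have hlog : HasSum (fun p : Nat.Primes => a p / ((p : ℕ) : ℂ) ^ s + logTailTerm ν p s)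
      (eulerLog a ν s) :=
    (summable_primeSum h.norm_coeff_prime_le hs).hasSum.add
      (summable_logTailTerm h.norm_le_one (by linarith)).hasSum
  exact (hlog.cexp.congr_fun fun p =>
    (h.exp_coeff_div_add_logTailTerm p.2 (by linarith)).symm).unique (h.hasLocalRoots s hs)

lemma tendsto_eulerLog (h : HasBoundedRoots L a ν) (y : ℝ) :
    Tendsto (fun x : ℝ => eulerLog a ν (x + y * Complex.I)) atTop (𝓝 0) := by
  simpa only [eulerLog, add_zero] using
    (tendsto_primeSum h.norm_coeff_prime_le y).add (tendsto_logTail h.norm_le_one y)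

lemma differentiableAt_eulerLog (h : HasBoundedRoots L a ν) (hs : 1 < s.re) :
    DifferentiableAt ℂ (eulerLog a ν) s := by
  obtain ⟨x, hx, hxs⟩ := exists_between hs
  have hnhds := (isOpen_re_gt x).mem_nhds hxs
  exact ((differentiableOn_primeSum h.norm_coeff_prime_le hx).differentiableAt hnhds).add
    ((differentiableOn_logTail h.norm_le_one (by linarith)).differentiableAt hnhds)

end HasBoundedRoots

end LogTail

/-! ### Branches of the logarithm on half-strips -/

/-- A continuous logarithm is holomorphic: near each point it differs from the principal logarithm
of the quotient by a constant. -/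
lemma differentiableOn_of_exp_eq {U : Set ℂ} (hU : IsOpen U) {F g : ℂ → ℂ}
    (hF : ContinuousOn F U) (hg : DifferentiableOn ℂ g U)
    (hFg : ∀ s ∈ U, Complex.exp (F s) = g s) : DifferentiableOn ℂ F U := by
  intro z hz
  have hgz : g z ≠ 0 := hFg z hz ▸ Complex.exp_ne_zero _
  have hlog : DifferentiableAt ℂ (fun w => F z + Complex.log (g w / g z)) z := by
    refine (differentiableAt_const _).add (DifferentiableAt.clog ?_ ?_)
    · exact (hg.differentiableAt (hU.mem_nhds hz)).div_const _
    · rw [div_self hgz]; exact Complex.one_mem_slitPlane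
  refine (hlog.congr_of_eventuallyEq ?_).differentiableWithinAt
  have hnear : ∀ᶠ w in 𝓝 z, ‖F w - F z‖ < 1 := by
    simpa only [dist_eq_norm] using
      Metric.continuousAt_iff'.mp (hF.continuousAt (hU.mem_nhds hz)) 1 one_pos
  filter_upwards [hnear, hU.mem_nhds hz] with w hw hwU
  have hquot : g w / g z = Complex.exp (F w - F z) := by
    rw [Complex.exp_sub, hFg w hwU, hFg z hz]
  have him := abs_lt.mp ((Complex.abs_im_le_norm _).trans_lt hw)
  have hpi := Real.pi_gt_three
  rw [hquot, Complex.log_exp (by linarith) (by linarith)]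
  ring

lemma exists_differentiableOn_log {U : Set ℂ} (hU : IsOpen U) (hc : Convex ℝ U) (hne : U.Nonempty)
    {g : ℂ → ℂ} (hg : DifferentiableOn ℂ g U) (hg0 : ∀ s ∈ U, g s ≠ 0) :
    ∃ F : ℂ → ℂ, DifferentiableOn ℂ F U ∧ ∀ s ∈ U, Complex.exp (F s) = g s := by
  have hsc : IsSimplyConnected U := by
    have := hc.contractibleSpace hne
    exact SimplyConnectedSpace.ofContractible U
  obtain ⟨F, hFc, hF⟩ := Complex.exists_continuousOn_eqOn_exp_comp hsc hU hg.continuousOn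
    (by rintro ⟨s, hs, h0⟩; exact hg0 s hs h0)
  exact ⟨F, differentiableOn_of_exp_eq hU hFc hg fun s hs => hF hs, fun s hs => hF hs⟩

/-- The open half-strip `Re s > σ`, `|Im s - t| < h`. -/
def halfStrip (σ t h : ℝ) : Set ℂ := {s | σ < s.re ∧ |s.im - t| < h}

lemma isOpen_halfStrip (σ t h : ℝ) : IsOpen (halfStrip σ t h) :=
  (isOpen_re_gt σ).inter (isOpen_lt (Complex.continuous_im.sub continuous_const).abs
    continuous_const)

lemma convex_halfStrip (σ t h : ℝ) : Convex ℝ (halfStrip σ t h) := by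
  have hinter : halfStrip σ t h = {s | σ < s.re} ∩ ({s | t - h < s.im} ∩ {s | s.im < t + h}) := by
    ext s
    simp only [halfStrip, Set.mem_ofPred_eq, Set.mem_inter_iff, abs_lt, neg_lt_sub_iff_lt_add,
      sub_lt_iff_lt_add']
  rw [hinter]
  exact (convex_halfSpace_re_gt σ).inter
    ((convex_halfSpace_im_gt _).inter (convex_halfSpace_im_lt _))

lemma mem_thickening_reProdIm {σ ε : ℝ} {S : Set ℝ} {s : ℂ} (hle : s.re ≤ σ)
    (hlt : σ - ε < s.re) (hS : s.im ∈ S) : s ∈ Metric.thickening ε ({σ} ×ℂ S) := by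
  refine Metric.mem_thickening_iff.mpr ⟨σ + s.im * Complex.I, ⟨by simp, by simpa⟩, ?_⟩
  have hsub : s - (σ + s.im * Complex.I) = ((s.re - σ : ℝ) : ℂ) := by
    apply Complex.ext <;> simp
  rw [dist_eq_norm, hsub, Complex.norm_real, Real.norm_eq_abs, abs_lt]
  constructor <;> linarith

lemma exists_halfStrip_ne_zero {L : ℂ → ℂ} {σ t h : ℝ}
    (hL : ContinuousOn L {1}ᶜ) (ht : h < t)
    (hne : ∀ s : ℂ, σ ≤ s.re → |s.im - t| ≤ h → L s ≠ 0) :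
    ∃ ε > 0, ∀ s ∈ halfStrip (σ - ε) t h, L s ≠ 0 := by
  have hcompact : IsCompact ({σ} ×ℂ Set.Icc (t - h) (t + h)) :=
    isCompact_singleton.reProdIm isCompact_Icc
  have hopen : IsOpen ({1}ᶜ ∩ L ⁻¹' {0}ᶜ) :=
    hL.isOpen_inter_preimage isOpen_compl_singleton isOpen_compl_singleton
  have hsub : {σ} ×ℂ Set.Icc (t - h) (t + h) ⊆ {1}ᶜ ∩ L ⁻¹' {0}ᶜ := by
    rintro s ⟨hre, him, him'⟩
    refine ⟨?_, hne s (Set.mem_singleton_iff.mp hre).ge (abs_le.mpr ⟨by linarith, by linarith⟩)⟩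
    rintro rfl
    rw [Complex.one_im] at him
    linarith
  obtain ⟨ε, hε, hthick⟩ := hcompact.exists_thickening_subset_open hopen hsub
  refine ⟨ε, hε, fun s ⟨hre, him⟩ => ?_⟩
  rcases le_or_gt σ s.re with hσs | hσs
  · exact hne s hσs him.le
  · have him' := abs_lt.mp him
    exact (hthick (mem_thickening_reProdIm hσs.le hre ⟨by linarith, by linarith⟩)).2

lemma eqOn_sub_const_of_exp_eq {U : Set ℂ} (hU : IsOpen U) (hc : IsPreconnected U) {F G : ℂ → ℂ}
    (hF : DifferentiableOn ℂ F U) (hG : DifferentiableOn ℂ G U)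
    (hFG : ∀ s ∈ U, Complex.exp (F s) = Complex.exp (G s)) {s z : ℂ} (hs : s ∈ U) (hz : z ∈ U) :
    F s - G s = F z - G z := by
  have hD : DifferentiableOn ℂ (fun s => F s - G s) U := hF.sub hG
  have hexp : ∀ s ∈ U, Complex.exp (F s - G s) = 1 := fun s hs => by
    rw [Complex.exp_sub, hFG s hs, div_self (Complex.exp_ne_zero _)]
  refine hU.is_const_of_deriv_eq_zero hc hD (fun w hw => ?_) hs hz
  have hnhds := hU.mem_nhds hw
  have hzero : HasDerivAt (fun s => Complex.exp (F s - G s)) 0 w := by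
    refine (hasDerivAt_const w (1 : ℂ)).congr_of_eventuallyEq ?_
    filter_upwards [hnhds] with v hv using hexp v hv
  simpa [hexp w hw] using (hD.differentiableAt hnhds).hasDerivAt.cexp.unique hzero

/-- `F` is the holomorphic logarithm of `L` on a half-strip that agrees with `ℓ`, a logarithm of `L`
in `Re s > 1`. -/
structure IsLogBranch (L ℓ F : ℂ → ℂ) (σ t h : ℝ) : Prop where
  differentiableOn : DifferentiableOn ℂ F (halfStrip σ t h)
  exp_eq : ∀ s ∈ halfStrip σ t h, Complex.exp (F s) = L s
  eq_of_one_lt_re : ∀ s ∈ halfStrip σ t h, 1 < s.re → F s = ℓ s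

lemma IsLogBranch.mono {L ℓ F : ℂ → ℂ} {σ σ' t h : ℝ} (hF : IsLogBranch L ℓ F σ t h)
    (hσ : σ ≤ σ') : IsLogBranch L ℓ F σ' t h where
  differentiableOn := hF.differentiableOn.mono fun _ hs => ⟨hσ.trans_lt hs.1, hs.2⟩
  exp_eq _ hs := hF.exp_eq _ ⟨hσ.trans_lt hs.1, hs.2⟩
  eq_of_one_lt_re _ hs := hF.eq_of_one_lt_re _ ⟨hσ.trans_lt hs.1, hs.2⟩

lemma exists_isLogBranch {L ℓ : ℂ → ℂ} {σ t h : ℝ} (hh : 0 < h) (hσ : σ ≤ 1)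
    (hL : DifferentiableOn ℂ L (halfStrip σ t h)) (hne : ∀ s ∈ halfStrip σ t h, L s ≠ 0)
    (hℓ : ∀ s : ℂ, 1 < s.re → DifferentiableAt ℂ ℓ s)
    (hℓL : ∀ s : ℂ, 1 < s.re → Complex.exp (ℓ s) = L s) :
    ∃ F : ℂ → ℂ, IsLogBranch L ℓ F σ t h := by
  have hmem : (2 + t * Complex.I : ℂ) ∈ halfStrip 1 t h := by
    constructor <;> simp [hh]
  have hsub : halfStrip 1 t h ⊆ halfStrip σ t h := fun s hs => ⟨hσ.trans_lt hs.1, hs.2⟩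
  obtain ⟨F, hFd, hF⟩ := exists_differentiableOn_log (isOpen_halfStrip σ t h)
    (convex_halfStrip σ t h) ⟨_, hsub hmem⟩ hL hne
  have hexp : ∀ s ∈ halfStrip 1 t h, Complex.exp (F s) = Complex.exp (ℓ s) := fun s hs => by
    rw [hF s (hsub hs), hℓL s hs.1]
  set c : ℂ := F (2 + t * Complex.I) - ℓ (2 + t * Complex.I) with hc
  have hconst : ∀ s ∈ halfStrip 1 t h, F s - ℓ s = c := fun s hs =>
    eqOn_sub_const_of_exp_eq (isOpen_halfStrip 1 t h) (convex_halfStrip 1 t h).isPreconnected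
      (hFd.mono hsub) (fun s hs => (hℓ s hs.1).differentiableWithinAt) hexp hs hmem
  refine ⟨fun s => F s - c, hFd.sub_const _, fun s hs => ?_, fun s hs hs1 => ?_⟩
  · rw [Complex.exp_sub, hc, Complex.exp_sub, hexp _ hmem, div_self (Complex.exp_ne_zero _),
      div_one, hF s hs]
  · exact sub_eq_of_eq_add (sub_eq_iff_eq_add'.mp (hconst s ⟨hs1, hs.2⟩))

lemma IsLogBranch.isLogValue {L ℓ F : ℂ → ℂ} {σ σ' t h y : ℝ} (hF : IsLogBranch L ℓ F σ' t h)
    (hσ : σ' < σ) (hy : |y - t| < h)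
    (hℓ : Tendsto (fun x : ℝ => ℓ (x + y * Complex.I)) atTop (𝓝 0)) :
    IsLogValue L (σ + y * Complex.I) (F (σ + y * Complex.I)) := by
  have hre : (σ + y * Complex.I : ℂ).re = σ := by simp
  have him : (σ + y * Complex.I : ℂ).im = y := by simp
  have hmem (x : ℝ) (hx : σ ≤ x) : (x + y * Complex.I : ℂ) ∈ halfStrip σ' t h :=
    ⟨by simp; linarith, by simpa using hy⟩
  rw [IsLogValue, hre, him]
  refine ⟨fun x => F (x + y * Complex.I), ?_, ?_, ?_, rfl⟩
  · exact hF.differentiableOn.continuousOn.comp (by fun_prop) hmem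
  · exact fun x hx => hF.exp_eq _ (hmem x hx)
  · refine hℓ.congr' ?_
    filter_upwards [eventually_gt_atTop 1, eventually_ge_atTop σ] with x hx hxσ
    exact (hF.eq_of_one_lt_re _ (hmem x hxσ) (by simpa using hx)).symm

lemma add_mem_halfStrip {σ t h y : ℝ} {z : ℂ} (hσ : 0 ≤ σ) (hy : |y - t| + 2 ≤ h)
    (hz : z ∈ Metric.ball (0 : ℂ) (2 - σ)) :
    2 + y * Complex.I + z ∈ halfStrip σ t h ∧ (2 + y * Complex.I + z).re ≤ 4 := by
  rw [mem_ball_zero_iff] at hz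
  have hre := abs_lt.mp ((Complex.abs_re_le_norm z).trans_lt hz)
  have him := (Complex.abs_im_le_norm z).trans_lt hz
  have him_eq : (2 + y * Complex.I + z).im - t = (y - t) + z.im := by simp; ring
  refine ⟨⟨by simp; linarith, ?_⟩, by simp; linarith⟩
  calc |(2 + y * Complex.I + z).im - t| ≤ |y - t| + |z.im| := by
        rw [him_eq]; exact abs_add_le _ _
    _ < h := by linarith

lemma norm_le_div_of_re_le {F : ℂ → ℂ} {σ t h M C₀ : ℝ} (hσ0 : 0 ≤ σ) (hσ2 : σ < 2) (hM : 0 < M)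
    (hF : DifferentiableOn ℂ F (halfStrip σ t h))
    (hre : ∀ s ∈ halfStrip σ t h, s.re ≤ 4 → (F s).re ≤ M)
    (hline : ∀ s ∈ halfStrip σ t h, s.re = 2 → ‖F s‖ ≤ C₀)
    {x y : ℝ} (hx : σ < x) (hx2 : x ≤ 2) (hy : |y - t| + 2 ≤ h) :
    ‖F (x + y * Complex.I)‖ ≤ (4 * M + 4 * C₀) / (x - σ) := by
  have hnorm : ‖((x - 2 : ℝ) : ℂ)‖ = 2 - x := by
    rw [Complex.norm_real, Real.norm_eq_abs, abs_of_nonpos (by linarith)]; ring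
  have hdiff : DifferentiableOn ℂ (fun z => F (2 + y * Complex.I + z)) (Metric.ball 0 (2 - σ)) :=
    hF.comp (by fun_prop) fun z hz => (add_mem_halfStrip hσ0 hy hz).1
  have hBC := Complex.borelCaratheodory (z := ((x - 2 : ℝ) : ℂ)) hM hdiff
    (fun z hz => hre _ (add_mem_halfStrip hσ0 hy hz).1 (add_mem_halfStrip hσ0 hy hz).2)
    (by linarith) (by rw [mem_ball_zero_iff, hnorm]; linarith)
  have hpt : 2 + y * Complex.I + ((x - 2 : ℝ) : ℂ) = x + y * Complex.I := by push_cast; ring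
  simp only [hpt, hnorm, add_zero] at hBC
  have hcentre : ‖F (2 + y * Complex.I)‖ ≤ C₀ := by
    refine hline _ ?_ (by simp)
    simpa only [add_zero] using
      (add_mem_halfStrip hσ0 hy (Metric.mem_ball_self (by linarith : 0 < 2 - σ))).1
  refine hBC.trans ?_
  rw [← add_div, show 2 - σ - (2 - x) = x - σ by ring]
  have hC₀ : 0 ≤ C₀ := (norm_nonneg _).trans hcentre
  have hleft : 2 * M * (2 - x) ≤ 4 * M := by nlinarith
  have hright : ‖F (2 + y * Complex.I)‖ * (2 - σ + (2 - x)) ≤ C₀ * 4 := by gcongr; linarith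
  exact div_le_div_of_nonneg_right (by linarith) (by linarith)

/-! ### Series with meromorphic continuation of finite order -/

/-- `L` is meromorphic of finite order, with at most a pole at `1`. The value `L 1` is
unconstrained. -/
def HasFiniteOrder (L : ℂ → ℂ) : Prop :=
  ∃ (m : ℕ) (G : ℂ → ℂ), Differentiable ℂ G ∧ (∀ s : ℂ, s ≠ 1 → G s = (s - 1) ^ m * L s) ∧
    ∃ B : ℝ, 0 < B ∧ G =O[cobounded ℂ] fun s : ℂ => Real.exp (‖s‖ ^ B)

lemma HasFiniteOrder.differentiableAt {L : ℂ → ℂ} (h : HasFiniteOrder L) {s : ℂ} (hs : s ≠ 1) :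
    DifferentiableAt ℂ L s := by
  obtain ⟨m, G, hG, hGL, -⟩ := h
  have hdiv : DifferentiableAt ℂ (fun s => G s / (s - 1) ^ m) s :=
    (hG s).div (by fun_prop) (pow_ne_zero _ (sub_ne_zero.mpr hs))
  refine hdiv.congr_of_eventuallyEq ?_
  filter_upwards [isOpen_compl_singleton.mem_nhds hs] with w hw
  rw [hGL w hw, mul_div_cancel_left₀ _ (pow_ne_zero _ (sub_ne_zero.mpr hw))]

lemma HasFiniteOrder.analyticAt {L : ℂ → ℂ} (h : HasFiniteOrder L) {s : ℂ} (hs : s ≠ 1) :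
    AnalyticAt ℂ L s :=
  (DifferentiableOn.analyticAt (s := {1}ᶜ)
    (fun _ hw => (h.differentiableAt hw).differentiableWithinAt)
    (isOpen_compl_singleton.mem_nhds hs))

lemma HasFiniteOrder.exists_growth {L : ℂ → ℂ} (h : HasFiniteOrder L) :
    ∃ B C R : ℝ, 0 < B ∧ 0 < C ∧ 2 ≤ R ∧ ∀ s : ℂ, R ≤ ‖s‖ → ‖L s‖ ≤ Real.exp (C * ‖s‖ ^ B) := by
  obtain ⟨m, G, -, hGL, B, hB, hO⟩ := h
  obtain ⟨c, hc⟩ := hO.bound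
  rw [← comap_norm_atTop, eventually_comap, eventually_atTop] at hc
  obtain ⟨R, hR⟩ := hc
  refine ⟨B, |Real.log (|c| + 1)| + 1, max R 2, hB, by positivity, le_max_right _ _,
    fun s hs => ?_⟩
  have hs2 : 2 ≤ ‖s‖ := (le_max_right _ _).trans hs
  have hs1 : 1 ≤ ‖s - 1‖ := by
    have := norm_sub_norm_le s 1
    rw [norm_one] at this
    linarith
  have hG := hR ‖s‖ ((le_max_left _ _).trans hs) s rfl
  rw [hGL s (by rintro rfl; norm_num at hs1), norm_mul, norm_pow,
    Real.norm_of_nonneg (Real.exp_pos _).le] at hG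
  have hlog := le_abs_self (Real.log (|c| + 1))
  calc ‖L s‖ ≤ ‖s - 1‖ ^ m * ‖L s‖ := le_mul_of_one_le_left (norm_nonneg _) (one_le_pow₀ hs1)
    _ ≤ c * Real.exp (‖s‖ ^ B) := hG
    _ ≤ (|c| + 1) * Real.exp (‖s‖ ^ B) := by
        gcongr
        linarith [le_abs_self c]
    _ = Real.exp (Real.log (|c| + 1) + ‖s‖ ^ B) := by
        rw [Real.exp_add, Real.exp_log (by positivity)]
    _ ≤ _ := by
        gcongr
        nlinarith [Real.one_le_rpow (one_le_two.trans hs2) hB.le, abs_nonneg (Real.log (|c| + 1))]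

open MeasureTheory

/-! ### A Gaussian kernel and the contour shift -/

section Kernel

variable {A H σ t c : ℝ} {f : ℂ → ℂ} {z : ℂ}

/-- The Gaussian `exp (A z²)`, shifted by a constant so that it vanishes at `z = ± i H`; it is
nonnegative on the segment between these points. -/
noncomputable def kernel (A H : ℝ) (z : ℂ) : ℂ :=
  Complex.exp (A * z ^ 2) - Real.exp (-(A * H ^ 2))

/-- The integral of `f` over the segment of half-length `H` on the line `Re s = c`, against the
kernel centred at `σ + i t`. -/
noncomputable def kernelIntegral (f : ℂ → ℂ) (A H σ t c : ℝ) : ℂ :=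
  ∫ y in (t - H)..(t + H),
    f (c + y * Complex.I) * kernel A H (c + y * Complex.I - (σ + t * Complex.I))

lemma differentiable_kernel (A H : ℝ) : Differentiable ℂ (kernel A H) := by
  unfold kernel
  fun_prop

lemma kernel_mul_I (A H u : ℝ) :
    kernel A H (u * Complex.I) = ((Real.exp (-(A * u ^ 2)) - Real.exp (-(A * H ^ 2)) : ℝ) : ℂ) := by
  rw [kernel, mul_pow, Complex.I_sq]
  push_cast
  ring_nf

lemma kernel_eq_mul_exp_sub_one (hz : |z.im| = H) :
    kernel A H z = Real.exp (-(A * H ^ 2)) *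
      (Complex.exp (A * (z.re * (z.re + 2 * z.im * Complex.I))) - 1) := by
  have him : (z.im : ℂ) ^ 2 = (H : ℂ) ^ 2 := by
    rw [← hz]
    exact_mod_cast (sq_abs z.im).symm
  rw [kernel, mul_sub, mul_one, Complex.ofReal_exp, ← Complex.exp_add]
  congr 2
  conv_lhs => rw [← Complex.re_add_im z]
  push_cast
  linear_combination (A : ℂ) * (z.im : ℂ) ^ 2 * Complex.I_sq - (A : ℂ) * him

/-- Near the corners `± i H` the kernel is small in proportion to the distance, which compensates
the pole in the Borel–Carathéodory bound. -/
lemma norm_kernel_le_of_abs_im_eq (hA : 0 ≤ A) (hz : |z.im| = H) (hz0 : 0 ≤ z.re)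
    (hz2 : z.re ≤ 2) :
    ‖kernel A H z‖ ≤ z.re * (A * (2 + 2 * H) * Real.exp (A * (4 + 4 * H - H ^ 2))) := by
  have hH : 0 ≤ H := hz ▸ abs_nonneg _
  set w : ℂ := A * (z.re * (z.re + 2 * z.im * Complex.I)) with hw
  have hfactor : ‖(z.re : ℂ) + 2 * z.im * Complex.I‖ ≤ 2 + 2 * H :=
    calc _ ≤ ‖(z.re : ℂ)‖ + ‖(2 * z.im * Complex.I : ℂ)‖ := norm_add_le _ _
      _ = z.re + 2 * H := by simp [abs_of_nonneg hz0, hz]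
      _ ≤ _ := by linarith
  have hw_le : ‖w‖ ≤ z.re * (A * (2 + 2 * H)) :=
    calc ‖w‖ = A * (z.re * ‖(z.re : ℂ) + 2 * z.im * Complex.I‖) := by
          rw [hw, norm_mul, norm_mul, Complex.norm_real, Complex.norm_real,
            Real.norm_of_nonneg hA, Real.norm_of_nonneg hz0]
      _ ≤ A * (z.re * (2 + 2 * H)) := by gcongr
      _ = _ := by ring
  have hw_le' : ‖w‖ ≤ A * (4 + 4 * H) :=
    calc ‖w‖ ≤ 2 * (A * (2 + 2 * H)) := hw_le.trans (by gcongr)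
      _ = _ := by ring
  have hexp : ‖Complex.exp w - 1‖ ≤ ‖w‖ * Real.exp ‖w‖ := by
    simpa using Complex.norm_exp_sub_sum_le_norm_mul_exp w 1
  calc ‖kernel A H z‖ = Real.exp (-(A * H ^ 2)) * ‖Complex.exp w - 1‖ := by
        rw [kernel_eq_mul_exp_sub_one hz, norm_mul, Complex.norm_real,
          Real.norm_of_nonneg (Real.exp_pos _).le]
    _ ≤ Real.exp (-(A * H ^ 2)) * (z.re * (A * (2 + 2 * H)) * Real.exp (A * (4 + 4 * H))) := by
        gcongr
        exact hexp.trans (by gcongr)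
    _ = z.re * (A * (2 + 2 * H)) * Real.exp (-(A * H ^ 2) + A * (4 + 4 * H)) := by
        rw [Real.exp_add]; ring
    _ = _ := by ring_nf

lemma norm_integral_vertical_sub_le {g : ℂ → ℂ} {x₁ x₂ y₁ y₂ E : ℝ} (hx : x₁ ≤ x₂) (hy : y₁ ≤ y₂)
    (hg : DifferentiableOn ℂ g (Set.Icc x₁ x₂ ×ℂ Set.Icc y₁ y₂))
    (hE : ∀ x ∈ Set.Ioc x₁ x₂, ∀ y ∈ ({y₁, y₂} : Set ℝ), ‖g (x + y * Complex.I)‖ ≤ E) :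
    ‖(∫ y in y₁..y₂, g (x₁ + y * Complex.I)) - ∫ y in y₁..y₂, g (x₂ + y * Complex.I)‖ ≤
      2 * (E * (x₂ - x₁)) := by
  have hcauchy := Complex.integral_boundary_rect_eq_zero_of_differentiableOn g ⟨x₁, y₁⟩ ⟨x₂, y₂⟩
    (by simpa only [Set.uIcc_of_le hx, Set.uIcc_of_le hy] using hg)
  have hhorizontal (y : ℝ) (hy : y ∈ ({y₁, y₂} : Set ℝ)) :
      ‖∫ x in x₁..x₂, g (x + y * Complex.I)‖ ≤ E * (x₂ - x₁) := by
    rw [← abs_of_nonneg (sub_nonneg.mpr hx)]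
    exact intervalIntegral.norm_integral_le_of_norm_le_const fun x hx' =>
      hE x (Set.uIoc_of_le hx ▸ hx') y hy
  have hdiff : Complex.I * ((∫ y in y₁..y₂, g (x₁ + y * Complex.I)) -
      ∫ y in y₁..y₂, g (x₂ + y * Complex.I)) =
      (∫ x in x₁..x₂, g (x + y₁ * Complex.I)) - ∫ x in x₁..x₂, g (x + y₂ * Complex.I) := by
    simp only [smul_eq_mul] at hcauchy
    linear_combination -hcauchy
  rw [← one_mul ‖_‖, ← Complex.norm_I, ← norm_mul, hdiff, two_mul]
  exact (norm_sub_le _ _).trans (add_le_add (hhorizontal _ (by simp)) (hhorizontal _ (by simp)))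

lemma norm_kernelIntegral_sub_le {Q : ℝ} (hσc : σ ≤ c) (hc : c ≤ σ + 2) (hH : 0 ≤ H) (hA : 0 ≤ A)
    (hf : DifferentiableOn ℂ f (Set.Icc σ c ×ℂ Set.Icc (t - H) (t + H)))
    (hedge : ∀ x y : ℝ, σ < x → x ≤ c → |y - t| = H → ‖f (x + y * Complex.I)‖ ≤ Q / (x - σ)) :
    ‖kernelIntegral f A H σ t σ - kernelIntegral f A H σ t c‖ ≤
      2 * (Q * (A * (2 + 2 * H) * Real.exp (A * (4 + 4 * H - H ^ 2))) * (c - σ)) := by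
  refine norm_integral_vertical_sub_le
    (g := fun s => f s * kernel A H (s - (σ + t * Complex.I))) hσc (by linarith)
    (hf.mul ((differentiable_kernel A H).comp (by fun_prop)).differentiableOn) ?_
  intro x hx y hy
  have hyt : |y - t| = H := by
    rcases hy with rfl | rfl
    · rw [sub_sub_cancel_left, abs_neg, abs_of_nonneg hH]
    · rw [add_sub_cancel_left, abs_of_nonneg hH]
  have hxσ : 0 < x - σ := sub_pos.mpr hx.1
  have hre : (x + y * Complex.I - (σ + t * Complex.I)).re = x - σ := by simp
  have him : (x + y * Complex.I - (σ + t * Complex.I)).im = y - t := by simp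
  have hker := norm_kernel_le_of_abs_im_eq hA (him.symm ▸ hyt) (hre.symm ▸ hxσ.le)
    (by rw [hre]; linarith [hx.2])
  rw [hre] at hker
  have hfx := hedge x y hx.1 hx.2 hyt
  calc ‖f (x + y * Complex.I) * kernel A H (x + y * Complex.I - (σ + t * Complex.I))‖
      ≤ Q / (x - σ) * ((x - σ) * (A * (2 + 2 * H) * Real.exp (A * (4 + 4 * H - H ^ 2)))) := by
        rw [norm_mul]
        exact mul_le_mul hfx hker (norm_nonneg _) ((norm_nonneg _).trans hfx)
    _ = _ := by field_simp

end Kernel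

/-! ### Gaussian smoothing of the prime sum -/

section Smoothing

variable {a : ℕ → ℂ} {A B H σ t c : ℝ}

/-- The sum `∑ a(p) p^{-σ-it} exp (-(log p)² / (4 * A))` over primes. -/
noncomputable def smoothSum (a : ℕ → ℂ) (A σ t : ℝ) : ℂ :=
  ∑' p : Nat.Primes, a p / ((p : ℕ) : ℂ) ^ (σ + t * Complex.I : ℂ) *
    (Real.exp (-(Real.log p ^ 2 / (4 * A))) : ℂ)

lemma norm_cexp_mul_sq (A : ℝ) (z : ℂ) :
    ‖Complex.exp (A * z ^ 2)‖ = Real.exp (A * z.re ^ 2) * Real.exp (-A * z.im ^ 2) := by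
  rw [Complex.norm_exp, ← Real.exp_add]
  congr 1
  simp only [pow_two, Complex.mul_re, Complex.mul_im, Complex.ofReal_re, Complex.ofReal_im]
  ring

lemma norm_cexp_mul_sub_sq (A c y σ t : ℝ) :
    ‖Complex.exp (A * (c + y * Complex.I - (σ + t * Complex.I)) ^ 2)‖ =
      Real.exp (A * (c - σ) ^ 2) * Real.exp (-A * (y - t) ^ 2) := by
  rw [norm_cexp_mul_sq]
  simp

lemma integrable_exp_neg_mul_sub_sq (hA : 0 < A) (t : ℝ) :
    Integrable fun y : ℝ => Real.exp (-A * (y - t) ^ 2) :=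
  (integrable_exp_neg_mul_sq hA).comp_sub_right t

lemma integral_exp_neg_mul_sub_sq (A t : ℝ) :
    ∫ y : ℝ, Real.exp (-A * (y - t) ^ 2) = √(Real.pi / A) := by
  rw [integral_sub_right_eq_self (fun y : ℝ => Real.exp (-A * y ^ 2)) t, integral_gaussian]

lemma integral_cpow_mul_gauss (hA : 0 < A) (c σ t : ℝ) {n : ℕ} (hn : 0 < n) :
    ∫ y : ℝ, ((n : ℂ) ^ (c + y * Complex.I : ℂ))⁻¹ *
        Complex.exp (A * (c + y * Complex.I - (σ + t * Complex.I)) ^ 2) =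
      (√(Real.pi / A) : ℂ) * (((n : ℂ) ^ (σ + t * Complex.I : ℂ))⁻¹ *
        (Real.exp (-(Real.log n ^ 2 / (4 * A))) : ℂ)) := by
  have hn0 : (n : ℂ) ≠ 0 := by exact_mod_cast hn.ne'
  have hA0 : (A : ℂ) ≠ 0 := by exact_mod_cast hA.ne'
  have hlog : Complex.log n = (Real.log n : ℂ) := Complex.natCast_log.symm
  set ℓ : ℝ := Real.log n
  have hquadratic (y : ℝ) : ((n : ℂ) ^ (c + y * Complex.I : ℂ))⁻¹ *
        Complex.exp (A * (c + y * Complex.I - (σ + t * Complex.I)) ^ 2) =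
      Complex.exp (-(A : ℂ) * (y : ℂ) ^ 2 +
        (2 * Complex.I * A * ((c - σ) - t * Complex.I) - Complex.I * ℓ) * y +
        (A * ((c - σ) - t * Complex.I) ^ 2 - c * ℓ)) := by
    rw [Complex.cpow_def_of_ne_zero hn0, hlog, ← Complex.exp_neg, ← Complex.exp_add]
    congr 1
    linear_combination (A : ℂ) * (y : ℂ) ^ 2 * Complex.I_sq
  have hsqrt : ((Real.pi : ℂ) / A) ^ (1 / 2 : ℂ) = (√(Real.pi / A) : ℂ) := by
    rw [Real.sqrt_eq_rpow, Complex.ofReal_cpow (by positivity)]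
    push_cast
    rfl
  simp_rw [hquadratic]
  rw [integral_cexp_quadratic (by simpa using hA), neg_neg, hsqrt,
    Complex.cpow_def_of_ne_zero hn0, hlog, ← Complex.exp_neg, Complex.ofReal_exp, ← Complex.exp_add]
  congr 2
  push_cast
  field_simp
  linear_combination ((2 * (A : ℂ) * (c - σ - t * Complex.I) - ℓ) ^ 2) * Complex.I_sq

lemma continuous_div_prime_cpow_line {p : ℕ} (hp : p.Prime) (w : ℂ) (c : ℝ) :
    Continuous fun y : ℝ => w / (p : ℂ) ^ (c + y * Complex.I : ℂ) :=
  continuous_iff_continuousAt.mpr fun _ =>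
    ((differentiableAt_div_prime_cpow hp w _).continuousAt).comp
      (f := fun y : ℝ => (c + y * Complex.I : ℂ)) (by fun_prop)

lemma integral_primeSum_mul_gauss (ha : ∀ p, p.Prime → ‖a p‖ ≤ B) (hA : 0 < A) (hc : 1 < c)
    (σ t : ℝ) :
    ∫ y : ℝ, primeSum a (c + y * Complex.I) *
        Complex.exp (A * (c + y * Complex.I - (σ + t * Complex.I)) ^ 2) =
      (√(Real.pi / A) : ℂ) * smoothSum a A σ t := by
  have hsum : Summable fun p : Nat.Primes => B * ((p : ℕ) : ℝ) ^ (-c) :=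
    (summable_primes_rpow hc).mul_left B
  have hgauss := (integrable_exp_neg_mul_sub_sq hA t).const_mul (Real.exp (A * (c - σ) ^ 2))
  have htermwise := hasSum_integral_of_dominated_convergence
    (F := fun (p : Nat.Primes) (y : ℝ) => a p / ((p : ℕ) : ℂ) ^ (c + y * Complex.I : ℂ) *
      Complex.exp (A * (c + y * Complex.I - (σ + t * Complex.I)) ^ 2))
    (fun p y => B * ((p : ℕ) : ℝ) ^ (-c) *
      (Real.exp (A * (c - σ) ^ 2) * Real.exp (-A * (y - t) ^ 2)))
    (fun p => ((continuous_div_prime_cpow_line p.2 (a p) c).mul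
      (by fun_prop)).aestronglyMeasurable)
    (fun p => Eventually.of_forall fun y => by
      rw [norm_mul, norm_cexp_mul_sub_sq]
      gcongr
      exact norm_div_prime_cpow_le p.2 (ha p p.2) (by simp))
    (Eventually.of_forall fun y => hsum.mul_right _)
    (by simpa only [tsum_mul_right] using hgauss.const_mul _)
    (Eventually.of_forall fun y =>
      (summable_primeSum ha (s := c + y * Complex.I) (by simpa using hc)).hasSum.mul_right _)
  rw [smoothSum, ← tsum_mul_left]
  refine htermwise.tsum_eq.symm.trans (tsum_congr fun p => ?_)
  simp_rw [div_eq_mul_inv, mul_assoc]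
  rw [integral_const_mul, integral_cpow_mul_gauss hA c σ t p.2.pos]
  ring_nf

lemma exp_neg_mul_sq_le_of_notMem {y : ℝ} (hA : 0 ≤ A) (hH : 0 ≤ H)
    (hy : y ∉ Set.Ioc (t - H) (t + H)) :
    Real.exp (-A * (y - t) ^ 2) ≤
      Real.exp (-(A * H ^ 2 / 2)) * Real.exp (-(A / 2) * (y - t) ^ 2) := by
  have hsq : H ^ 2 ≤ (y - t) ^ 2 := by
    rw [Set.mem_Ioc, not_and_or, not_lt, not_le] at hy
    rcases hy with hy | hy <;> nlinarith
  rw [← Real.exp_add, Real.exp_le_exp]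
  nlinarith

lemma norm_intervalIntegral_sub_integral_le {f : ℝ → ℂ} {M : ℝ} (hA : 1 ≤ A) (hH : 0 ≤ H)
    (hf : Continuous f) (hM : ∀ y, ‖f y‖ ≤ M * Real.exp (-A * (y - t) ^ 2)) :
    ‖(∫ y in (t - H)..(t + H), f y) - ∫ y, f y‖ ≤ M * 3 * Real.exp (-(A * H ^ 2 / 2)) := by
  have hA0 : 0 < A := by linarith
  have hM0 : 0 ≤ M := nonneg_of_mul_nonneg_left ((norm_nonneg _).trans (hM 0)) (Real.exp_pos _)
  have hint : Integrable f := ((integrable_exp_neg_mul_sub_sq hA0 t).const_mul M).mono'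
    hf.aestronglyMeasurable (Eventually.of_forall hM)
  set g : ℝ → ℝ := fun y => M * Real.exp (-(A * H ^ 2 / 2)) * Real.exp (-(A / 2) * (y - t) ^ 2)
  have hg : Integrable g := (integrable_exp_neg_mul_sub_sq (half_pos hA0) t).const_mul _
  have hfg : ∀ y ∈ (Set.Ioc (t - H) (t + H))ᶜ, ‖f y‖ ≤ g y := fun y hy =>
    calc ‖f y‖ ≤ M * (Real.exp (-(A * H ^ 2 / 2)) * Real.exp (-(A / 2) * (y - t) ^ 2)) :=
          (hM y).trans (by gcongr; exact exp_neg_mul_sq_le_of_notMem hA0.le hH hy)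
      _ = g y := (mul_assoc _ _ _).symm
  have hsqrt : √(Real.pi / (A / 2)) ≤ 3 := by
    rw [Real.sqrt_le_left (by norm_num), div_le_iff₀ (by positivity)]
    nlinarith [Real.pi_lt_four]
  rw [intervalIntegral.integral_of_le (by linarith),
    ← integral_add_compl measurableSet_Ioc hint, sub_add_cancel_left, norm_neg]
  calc ‖∫ y in (Set.Ioc (t - H) (t + H))ᶜ, f y‖ ≤ ∫ y in (Set.Ioc (t - H) (t + H))ᶜ, g y :=
        norm_integral_le_of_norm_le hg.integrableOn
          ((ae_restrict_iff' measurableSet_Ioc.compl).mpr (Eventually.of_forall hfg))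
    _ ≤ ∫ y, g y := setIntegral_le_integral hg (Eventually.of_forall fun y => by positivity)
    _ = M * Real.exp (-(A * H ^ 2 / 2)) * √(Real.pi / (A / 2)) := by
        rw [integral_const_mul, integral_exp_neg_mul_sub_sq]
    _ ≤ M * Real.exp (-(A * H ^ 2 / 2)) * 3 := by gcongr
    _ = _ := by ring

lemma continuous_primeSum_line (ha : ∀ p, p.Prime → ‖a p‖ ≤ B) (hc : 1 < c) :
    Continuous fun y : ℝ => primeSum a (c + y * Complex.I) := by
  obtain ⟨x, hx, hxc⟩ := exists_between hc
  exact (differentiableOn_primeSum ha hx).continuousOn.comp_continuous (by fun_prop)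
    fun y => by simpa using hxc

lemma norm_kernelIntegral_primeSum_sub_smoothSum_le {C : ℝ} (ha : ∀ p, p.Prime → ‖a p‖ ≤ B)
    (hc : 1 < c) (hC : ∀ s : ℂ, c ≤ s.re → ‖primeSum a s‖ ≤ C) (hA : 1 ≤ A) (hH : 0 ≤ H)
    (σ t : ℝ) :
    ‖kernelIntegral (primeSum a) A H σ t c - (√(Real.pi / A) : ℂ) * smoothSum a A σ t‖ ≤
      C * (2 * H + 3) * Real.exp (A * ((c - σ) ^ 2 - H ^ 2 / 2)) := by
  set P : ℝ → ℂ := fun y => primeSum a (c + y * Complex.I)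
  set e : ℝ → ℂ := fun y => Complex.exp (A * (c + y * Complex.I - (σ + t * Complex.I)) ^ 2)
  set X : ℝ := Real.exp (A * ((c - σ) ^ 2 - H ^ 2 / 2)) with hX
  have hP : Continuous P := continuous_primeSum_line ha hc
  have he : Continuous e := by fun_prop
  have hPC (y : ℝ) : ‖P y‖ ≤ C := hC _ (by simp)
  have hC0 : 0 ≤ C := (norm_nonneg _).trans (hPC 0)
  have htail : ‖(∫ y in (t - H)..(t + H), P y * e y) - ∫ y, P y * e y‖ ≤ C * 3 * X :=
    calc _ ≤ C * Real.exp (A * (c - σ) ^ 2) * 3 * Real.exp (-(A * H ^ 2 / 2)) := by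
          refine norm_intervalIntegral_sub_integral_le hA hH (hP.mul he) fun y => ?_
          rw [norm_mul, norm_cexp_mul_sub_sq, mul_assoc]
          gcongr
          exact hPC y
      _ = C * 3 * Real.exp (A * (c - σ) ^ 2 + -(A * H ^ 2 / 2)) := by rw [Real.exp_add]; ring
      _ = C * 3 * X := by rw [hX]; ring_nf
  have hconst : ‖∫ y in (t - H)..(t + H), P y * (Real.exp (-(A * H ^ 2)) : ℂ)‖ ≤
      C * X * (2 * H) := by
    have hlen : |t + H - (t - H)| = 2 * H := by rw [abs_of_nonneg (by linarith)]; ring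
    rw [← hlen]
    refine intervalIntegral.norm_integral_le_of_norm_le_const fun y _ => ?_
    rw [norm_mul, Complex.norm_real, Real.norm_of_nonneg (Real.exp_pos _).le, hX]
    gcongr
    · exact hPC y
    · nlinarith [sq_nonneg H, sq_nonneg (c - σ)]
  have hsplit : kernelIntegral (primeSum a) A H σ t c = (∫ y in (t - H)..(t + H), P y * e y) -
      ∫ y in (t - H)..(t + H), P y * (Real.exp (-(A * H ^ 2)) : ℂ) := by
    exact (intervalIntegral.integral_congr fun y _ => mul_sub _ _ _).trans
      (intervalIntegral.integral_sub ((hP.mul he).intervalIntegrable _ _)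
        ((hP.mul continuous_const).intervalIntegrable _ _))
  rw [hsplit, ← integral_primeSum_mul_gauss ha (by linarith) hc σ t, sub_right_comm]
  calc _ ≤ C * 3 * X + C * X * (2 * H) := (norm_sub_le _ _).trans (add_le_add htail hconst)
    _ = _ := by ring

end Smoothing

/-! ### Large values near a point above a zero-free half-strip -/

section LargeValues

variable {A H σ t V : ℝ} {ζ : ℂ}

lemma re_mul_integral_le {f : ℝ → ℂ} {k : ℝ → ℝ} {x₁ x₂ : ℝ} (hx : x₁ ≤ x₂)
    (hf : ContinuousOn f (Set.Icc x₁ x₂)) (hk : Continuous k)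
    (hk0 : ∀ y ∈ Set.Icc x₁ x₂, 0 ≤ k y) (hV : ∀ y ∈ Set.Icc x₁ x₂, (ζ * f y).re ≤ V) :
    (ζ * ∫ y in x₁..x₂, f y * (k y : ℂ)).re ≤ V * ∫ y in x₁..x₂, k y := by
  have hfk : IntervalIntegrable (fun y => ζ * (f y * (k y : ℂ))) volume x₁ x₂ := by
    refine ContinuousOn.intervalIntegrable ?_
    rw [Set.uIcc_of_le hx]
    exact continuousOn_const.mul (hf.mul (Complex.continuous_ofReal.comp hk).continuousOn)
  have hre : (∫ y in x₁..x₂, (ζ * f y).re * k y) = (ζ * ∫ y in x₁..x₂, f y * (k y : ℂ)).re := by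
    rw [← intervalIntegral.integral_const_mul, ← Complex.reCLM_apply,
      ← Complex.reCLM.intervalIntegral_comp_comm hfk]
    simp only [Complex.reCLM_apply, ← mul_assoc, Complex.re_mul_ofReal]
  rw [← hre, ← intervalIntegral.integral_const_mul]
  refine intervalIntegral.integral_mono_on hx (ContinuousOn.intervalIntegrable ?_)
    ((continuous_const.mul hk).intervalIntegrable _ _)
    fun y hy => mul_le_mul_of_nonneg_right (hV y hy) (hk0 y hy)
  rw [Set.uIcc_of_le hx]
  exact (Complex.continuous_re.comp_continuousOn (continuousOn_const.mul hf)).mul hk.continuousOn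

lemma integral_weight_le (hA : 0 < A) (hH : 0 ≤ H) (t : ℝ) :
    ∫ y in (t - H)..(t + H), (Real.exp (-(A * (y - t) ^ 2)) - Real.exp (-(A * H ^ 2))) ≤
      √(Real.pi / A) := by
  have hle : t - H ≤ t + H := by linarith
  calc ∫ y in (t - H)..(t + H), (Real.exp (-(A * (y - t) ^ 2)) - Real.exp (-(A * H ^ 2)))
      ≤ ∫ y in (t - H)..(t + H), Real.exp (-A * (y - t) ^ 2) := by
        refine intervalIntegral.integral_mono_on hle
          (Continuous.intervalIntegrable (by fun_prop) _ _)
          (Continuous.intervalIntegrable (by fun_prop) _ _) fun y _ => ?_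
        rw [neg_mul]
        exact sub_le_self _ (Real.exp_pos _).le
    _ ≤ ∫ y, Real.exp (-A * (y - t) ^ 2) := by
        rw [intervalIntegral.integral_of_le hle]
        exact setIntegral_le_integral (integrable_exp_neg_mul_sub_sq hA t)
          (Eventually.of_forall fun y => (Real.exp_pos _).le)
    _ = _ := integral_exp_neg_mul_sub_sq A t

lemma re_mul_kernelIntegral_le {f : ℂ → ℂ} (hA : 0 < A) (hH : 0 ≤ H) (hV0 : 0 ≤ V)
    (hf : ContinuousOn (fun y : ℝ => f (σ + y * Complex.I)) (Set.Icc (t - H) (t + H)))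
    (hV : ∀ y ∈ Set.Icc (t - H) (t + H), (ζ * f (σ + y * Complex.I)).re ≤ V) :
    (ζ * kernelIntegral f A H σ t σ).re ≤ V * √(Real.pi / A) := by
  have hweight (y : ℝ) : kernel A H (σ + y * Complex.I - (σ + t * Complex.I)) =
      ((Real.exp (-(A * (y - t) ^ 2)) - Real.exp (-(A * H ^ 2)) : ℝ) : ℂ) := by
    rw [← kernel_mul_I]
    push_cast
    ring_nf
  have hweight_nonneg : ∀ y ∈ Set.Icc (t - H) (t + H),
      0 ≤ Real.exp (-(A * (y - t) ^ 2)) - Real.exp (-(A * H ^ 2)) := fun y hy => by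
    have hsq : (y - t) ^ 2 ≤ H ^ 2 :=
      sq_le_sq' (by linarith [hy.1]) (by linarith [hy.2])
    rw [sub_nonneg, Real.exp_le_exp]
    gcongr
  simp only [kernelIntegral, hweight]
  exact (re_mul_integral_le (by linarith) hf (by fun_prop) hweight_nonneg hV).trans
    (mul_le_mul_of_nonneg_left (integral_weight_le hA hH t) hV0)

lemma exists_le_re_of_kernelIntegral {f : ℂ → ℂ} {ε : ℝ} {S : ℂ} (hA : 1 ≤ A) (hH : 0 ≤ H)
    (hf : ContinuousOn (fun y : ℝ => f (σ + y * Complex.I)) (Set.Icc (t - H) (t + H)))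
    (hV : 0 ≤ V) (hε : 0 < ε) (hζ : ‖ζ‖ ≤ 1)
    (hint : ‖kernelIntegral f A H σ t σ - (√(Real.pi / A) : ℂ) * S‖ ≤ ε)
    (hS : V + A * ε ≤ (ζ * S).re) :
    ∃ y ∈ Set.Icc (t - H) (t + H), V ≤ (ζ * f (σ + y * Complex.I)).re := by
  by_contra! hsmall
  have hA0 : 0 < A := by linarith
  have hupper := re_mul_kernelIntegral_le hA0 hH hV hf fun y hy => (hsmall y hy).le
  have hlower : √(Real.pi / A) * (ζ * S).re - ε ≤ (ζ * kernelIntegral f A H σ t σ).re := by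
    have hre : ‖(ζ * (kernelIntegral f A H σ t σ - (√(Real.pi / A) : ℂ) * S)).re‖ ≤ ε :=
      (Complex.abs_re_le_norm _).trans
        ((norm_mul_le_of_le hζ hint).trans_eq (one_mul ε))
    rw [mul_sub, mul_left_comm, Complex.sub_re, Complex.re_ofReal_mul, Real.norm_eq_abs] at hre
    linarith [(abs_le.mp hre).1]
  have hsqrt : 1 < √(Real.pi / A) * A := by
    have hsq : (√(Real.pi / A) * A) ^ 2 = Real.pi * A := by
      rw [mul_pow, Real.sq_sqrt (by positivity)]; field_simp
    nlinarith [Real.pi_gt_three, (by positivity : 0 ≤ √(Real.pi / A) * A)]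
  nlinarith [mul_le_mul_of_nonneg_left hS (Real.sqrt_nonneg (Real.pi / A))]

lemma norm_le_exp_of_mem_halfStrip {L : ℂ → ℂ} {B C R h : ℝ} (hB : 0 ≤ B) (hC : 0 ≤ C) (hR : 0 ≤ R)
    (hgrowth : ∀ s : ℂ, R ≤ ‖s‖ → ‖L s‖ ≤ Real.exp (C * ‖s‖ ^ B)) (hσ : 0 ≤ σ) (ht : R + h ≤ t)
    (ht4 : 4 ≤ t) {s : ℂ} (hs : s ∈ halfStrip σ t h) (hs4 : s.re ≤ 4) :
    ‖L s‖ ≤ Real.exp (C * (3 * t) ^ B) := by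
  have him := abs_lt.mp hs.2
  have hR_le : R ≤ ‖s‖ := by
    linarith [(le_abs_self _).trans (Complex.abs_im_le_norm s)]
  have hs_le : ‖s‖ ≤ 3 * t := by
    refine (Complex.norm_le_abs_re_add_abs_im s).trans ?_
    rw [abs_of_nonneg (hσ.trans hs.1.le), abs_of_nonneg (by linarith)]
    linarith
  exact (hgrowth s hR_le).trans (by gcongr)

variable {ι : Type*} [Fintype ι] {L F : ℂ → ℂ} {a : ℕ → ℂ} {ν : ι → ℕ → ℂ} {h C₁ C₂ σ' : ℝ}

lemma IsLogBranch.norm_sub_logTail_le {M x y : ℝ} (hF : IsLogBranch L (eulerLog a ν) F σ t h)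
    (hσ0 : 0 ≤ σ) (hC₁ : ∀ s : ℂ, 2 ≤ s.re → ‖primeSum a s‖ ≤ C₁)
    (hC₂ : ∀ s : ℂ, σ ≤ s.re → ‖logTail ν s‖ ≤ C₂) (hM : 0 < M)
    (hL : ∀ s ∈ halfStrip σ t h, s.re ≤ 4 → ‖L s‖ ≤ Real.exp M)
    (hx : σ < x) (hx2 : x ≤ 2) (hy : |y - t| + 2 ≤ h) :
    ‖F (x + y * Complex.I) - logTail ν (x + y * Complex.I)‖ ≤
      (4 * M + 4 * (C₁ + C₂) + 2 * C₂) / (x - σ) := by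
  have hre : ∀ s ∈ halfStrip σ t h, s.re ≤ 4 → (F s).re ≤ M := fun s hs hs4 => by
    rw [← Real.exp_le_exp, ← Complex.norm_exp, hF.exp_eq s hs]
    exact hL s hs hs4
  have hline : ∀ s ∈ halfStrip σ t h, s.re = 2 → ‖F s‖ ≤ C₁ + C₂ := fun s hs hs2 => by
    rw [hF.eq_of_one_lt_re s hs (by linarith)]
    exact norm_add_le_of_le (hC₁ s hs2.ge) (hC₂ s hs.1.le)
  have hF_le :=
    norm_le_div_of_re_le hσ0 (hx.trans_le hx2) hM hF.differentiableOn hre hline hx hx2 hy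
  have htail : ‖logTail ν (x + y * Complex.I)‖ ≤ 2 * C₂ / (x - σ) := by
    have hC₂_le := hC₂ (x + y * Complex.I) (by simpa using hx.le)
    rw [le_div_iff₀ (sub_pos.mpr hx)]
    nlinarith [norm_nonneg (logTail ν (x + y * Complex.I))]
  rw [add_div]
  exact norm_sub_le_of_le hF_le htail

lemma IsLogBranch.differentiableOn_sub_logTail (hF : IsLogBranch L (eulerLog a ν) F σ t h)
    (hν : HasBoundedRoots L a ν) (hσ : 1 / 2 ≤ σ) :
    DifferentiableOn ℂ (fun s => F s - logTail ν s) (halfStrip σ t h) := by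
  refine hF.differentiableOn.sub fun s hs => ?_
  obtain ⟨x, hx, hxs⟩ := exists_between (hσ.trans_lt hs.1)
  exact ((differentiableOn_logTail hν.norm_le_one hx).differentiableAt
    ((isOpen_re_gt x).mem_nhds hxs)).differentiableWithinAt

lemma exists_isLogBranch_eulerLog (hL : HasFiniteOrder L) (hν : HasBoundedRoots L a ν)
    (hσ : 1 / 2 < σ) (hσ1 : σ < 1) (hh : 0 < h) (ht : h < t)
    (hne : ∀ s : ℂ, σ ≤ s.re → |s.im - t| ≤ h → L s ≠ 0) :
    ∃ σ', 1 / 2 ≤ σ' ∧ σ' < σ ∧ ∃ F, IsLogBranch L (eulerLog a ν) F σ' t h := by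
  obtain ⟨ε, hε, hεL⟩ := exists_halfStrip_ne_zero
    (fun s hs => (hL.differentiableAt hs).continuousAt.continuousWithinAt) ht hne
  have hdiff : DifferentiableOn ℂ L (halfStrip (σ - ε) t h) := fun s hs => by
    refine (hL.differentiableAt ?_).differentiableWithinAt
    rintro rfl
    linarith [(abs_lt.mp hs.2).1, Complex.one_im]
  obtain ⟨F, hF⟩ := exists_isLogBranch hh (by linarith) hdiff hεL
    (fun s hs => hν.differentiableAt_eulerLog hs) (fun s hs => hν.exp_eulerLog hs)
  exact ⟨max (σ - ε) (1 / 2), le_max_right _ _, max_lt (by linarith) hσ, F,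
    hF.mono (le_max_left _ _)⟩

lemma IsLogBranch.kernelIntegral_sub_logTail_eq {c : ℝ}
    (hF : IsLogBranch L (eulerLog a ν) F σ' t h) (hσ' : σ' < c) (hc : 1 < c) (hHh : H < h)
    (hH : 0 ≤ H) :
    kernelIntegral (fun s => F s - logTail ν s) A H σ t c =
      kernelIntegral (primeSum a) A H σ t c := by
  refine intervalIntegral.integral_congr fun y hy => ?_
  rw [Set.uIcc_of_le (by linarith)] at hy
  have hmem : (c + y * Complex.I : ℂ) ∈ halfStrip σ' t h :=
    ⟨by simpa using hσ', abs_lt.mpr ⟨by simp; linarith [hy.1], by simp; linarith [hy.2]⟩⟩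
  simp only [hF.eq_of_one_lt_re _ hmem (by simpa using hc), eulerLog, add_sub_cancel_right]

lemma IsLogBranch.norm_kernelIntegral_sub_smoothSum_le {Q : ℝ}
    (hF : IsLogBranch L (eulerLog a ν) F σ' t h) (hν : HasBoundedRoots L a ν) (hσ' : 1 / 2 ≤ σ')
    (hσ : σ' < σ) (hσ2 : σ < 2) (hHh : H < h) (hH : 0 ≤ H) (hA : 1 ≤ A)
    (hC₁ : ∀ s : ℂ, 2 ≤ s.re → ‖primeSum a s‖ ≤ C₁)
    (hedge : ∀ x y : ℝ, σ < x → x ≤ 2 → |y - t| = H →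
      ‖F (x + y * Complex.I) - logTail ν (x + y * Complex.I)‖ ≤ Q / (x - σ)) :
    ‖kernelIntegral (fun s => F s - logTail ν s) A H σ t σ -
      (√(Real.pi / A) : ℂ) * smoothSum a A σ t‖ ≤
      (8 * Q + 3 * C₁) * (A * (H + 1) * Real.exp (A * (4 + 4 * H - H ^ 2 / 2))) := by
  have hA0 : 0 ≤ A := by linarith
  have hσ0 : 0 < 2 - σ := sub_pos.mpr hσ2
  have hC₁0 : 0 ≤ C₁ := (norm_nonneg _).trans (hC₁ 2 le_rfl)
  have hQ : 0 ≤ Q := nonneg_of_mul_nonneg_left ((norm_nonneg _).trans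
    (hedge 2 (t + H) hσ2 le_rfl (by rw [add_sub_cancel_left, abs_of_nonneg hH]))) (inv_pos.mpr hσ0)
  set X : ℝ := Real.exp (A * (4 + 4 * H - H ^ 2 / 2)) with hX
  have hsub : Set.Icc σ 2 ×ℂ Set.Icc (t - H) (t + H) ⊆ halfStrip σ' t h := fun s hs =>
    ⟨hσ.trans_le hs.1.1, abs_lt.mpr ⟨by linarith [hs.2.1], by linarith [hs.2.2]⟩⟩
  have hshift := norm_kernelIntegral_sub_le hσ2.le (by linarith) hH hA0
    ((hF.differentiableOn_sub_logTail hν hσ').mono hsub) hedge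
  have hsmooth := norm_kernelIntegral_primeSum_sub_smoothSum_le (c := 2)
    hν.norm_coeff_prime_le one_lt_two hC₁ hA hH σ t
  have hshift_le : 2 * (Q * (A * (2 + 2 * H) * Real.exp (A * (4 + 4 * H - H ^ 2))) * (2 - σ)) ≤
      8 * Q * (A * (H + 1) * X) :=
    calc _ ≤ 2 * (Q * (A * (2 + 2 * H) * X) * 2) := by
          rw [hX]
          gcongr
          · nlinarith
          · linarith
      _ = _ := by ring
  have hsmooth_le : C₁ * (2 * H + 3) * Real.exp (A * ((2 - σ) ^ 2 - H ^ 2 / 2)) ≤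
      3 * C₁ * (A * (H + 1) * X) :=
    calc _ ≤ C₁ * (3 * (1 * (H + 1))) * X := by
          rw [hX]
          gcongr
          · linarith
          · nlinarith
      _ ≤ C₁ * (3 * (A * (H + 1))) * X := by gcongr
      _ = _ := by ring
  rw [← hF.kernelIntegral_sub_logTail_eq (by linarith) one_lt_two hHh hH] at hsmooth
  calc _ ≤ 8 * Q * (A * (H + 1) * X) + 3 * C₁ * (A * (H + 1) * X) :=
        (norm_sub_le_norm_sub_add_norm_sub _ _ _).trans
          (add_le_add (hshift.trans hshift_le) (hsmooth.trans hsmooth_le))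
    _ = _ := by ring

lemma IsLogBranch.exists_isLogValue_of_kernelIntegral {ε : ℝ} {S : ℂ}
    (hF : IsLogBranch L (eulerLog a ν) F σ' t h) (hν : HasBoundedRoots L a ν) (hσ' : 1 / 2 ≤ σ')
    (hσ : σ' < σ) (hHh : H < h) (hH : 0 ≤ H) (hA : 1 ≤ A) (hV : 0 ≤ V) (hε : 0 < ε) (hζ : ‖ζ‖ ≤ 1)
    (hC₂ : ∀ s : ℂ, σ ≤ s.re → ‖logTail ν s‖ ≤ C₂)
    (hint : ‖kernelIntegral (fun s => F s - logTail ν s) A H σ t σ - (√(Real.pi / A) : ℂ) * S‖ ≤ ε)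
    (hS : V + C₂ + A * ε ≤ (ζ * S).re) :
    ∃ y ∈ Set.Icc (t - H) (t + H), ∃ w, IsLogValue L (σ + y * Complex.I) w ∧ V ≤ (ζ * w).re := by
  have hC₂0 : 0 ≤ C₂ := (norm_nonneg _).trans (hC₂ σ le_rfl)
  have hline : ∀ y ∈ Set.Icc (t - H) (t + H), |y - t| < h := fun y hy =>
    abs_lt.mpr ⟨by linarith [hy.1], by linarith [hy.2]⟩
  have hcont : ContinuousOn (fun y : ℝ => F (σ + y * Complex.I) - logTail ν (σ + y * Complex.I))
      (Set.Icc (t - H) (t + H)) :=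
    (hF.differentiableOn_sub_logTail hν hσ').continuousOn.comp
      (f := fun y : ℝ => (σ + y * Complex.I : ℂ)) (by fun_prop)
      fun y hy => ⟨by simpa using hσ, by simpa using hline y hy⟩
  obtain ⟨y, hy, hVy⟩ :=
    exists_le_re_of_kernelIntegral hA hH hcont (add_nonneg hV hC₂0) hε hζ hint hS
  refine ⟨y, hy, _, hF.isLogValue hσ (hline y hy) (hν.tendsto_eulerLog y), ?_⟩
  have htail : ‖ζ * logTail ν (σ + y * Complex.I)‖ ≤ C₂ :=
    (norm_mul_le_of_le hζ (hC₂ _ (by simp))).trans_eq (one_mul C₂)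
  rw [mul_sub, Complex.sub_re] at hVy
  linarith [(abs_le.mp ((Complex.abs_re_le_norm _).trans htail)).1]

theorem exists_large_logValue (hL : HasFiniteOrder L) (hν : HasBoundedRoots L a ν)
    (hσ : 1 / 2 < σ) (hσ1 : σ < 1) :
    ∃ D B R : ℝ, 0 < D ∧ 0 < B ∧ ∀ A H t V : ℝ, ∀ ζ : ℂ, 1 ≤ A → 1 ≤ H → R + H ≤ t →
      0 ≤ V → ‖ζ‖ ≤ 1 → (∀ s : ℂ, σ ≤ s.re → |s.im - t| ≤ H + 3 → L s ≠ 0) →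
      V + D + D * t ^ B * (A ^ 2 * (H + 1) * Real.exp (A * (4 + 4 * H - H ^ 2 / 2))) ≤
        (ζ * smoothSum a A σ t).re →
      ∃ y ∈ Set.Icc (t - H) (t + H), ∃ w, IsLogValue L (σ + y * Complex.I) w ∧
        V ≤ (ζ * w).re := by
  obtain ⟨B, C, R, hB, hC, hR, hgrowth⟩ := hL.exists_growth
  obtain ⟨C₁, hC₁⟩ := exists_norm_primeSum_le hν.norm_coeff_prime_le one_lt_two
  obtain ⟨C₂, hC₂⟩ := exists_norm_logTail_le hν.norm_le_one hσ
  have hC₁0 : 0 ≤ C₁ := (norm_nonneg _).trans (hC₁ 2 le_rfl)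
  have hC₂0 : 0 ≤ C₂ := (norm_nonneg _).trans (hC₂ σ le_rfl)
  set Q₀ : ℝ := 4 * (C * 3 ^ B) + 4 * (C₁ + C₂) + 2 * C₂
  set D : ℝ := 8 * Q₀ + 3 * C₁ + C₂ + 1 with hD
  refine ⟨D, B, R + 10, by positivity, hB, ?_⟩
  intro A H t V ζ hA hH ht hV hζ hne hS
  have htB : 1 ≤ t ^ B := Real.one_le_rpow (by linarith) hB.le
  obtain ⟨σ', hσ', hσ'σ, F, hF⟩ := exists_isLogBranch_eulerLog hL hν hσ hσ1
    (by linarith : 0 < H + 3) (by linarith) hne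
  have hgrowth_strip : ∀ s ∈ halfStrip σ t (H + 3), s.re ≤ 4 →
      ‖L s‖ ≤ Real.exp (C * 3 ^ B * t ^ B) := fun s hs hs4 => by
    rw [mul_assoc, ← Real.mul_rpow (by norm_num) (by linarith)]
    exact norm_le_exp_of_mem_halfStrip hB.le hC.le (by linarith) hgrowth (by linarith)
      (by linarith) (by linarith) hs hs4
  have hedge : ∀ x y : ℝ, σ < x → x ≤ 2 → |y - t| = H →
      ‖F (x + y * Complex.I) - logTail ν (x + y * Complex.I)‖ ≤ Q₀ * t ^ B / (x - σ) := by
    intro x y hx hx2 hy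
    refine ((hF.mono hσ'σ.le).norm_sub_logTail_le (by linarith) hC₁ hC₂ (by positivity)
      hgrowth_strip hx hx2 (by linarith)).trans (div_le_div_of_nonneg_right ?_ (by linarith))
    nlinarith [(by positivity : 0 ≤ 4 * (C₁ + C₂) + 2 * C₂)]
  set E : ℝ := A * (H + 1) * Real.exp (A * (4 + 4 * H - H ^ 2 / 2)) with hE
  have hint := hF.norm_kernelIntegral_sub_smoothSum_le hν hσ' hσ'σ (by linarith)
    (by linarith : H < H + 3) (by linarith) hA hC₁ hedge
  have herror : (8 * (Q₀ * t ^ B) + 3 * C₁) * E ≤ D * t ^ B * E := by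
    gcongr
    nlinarith
  refine hF.exists_isLogValue_of_kernelIntegral hν hσ' hσ'σ (by linarith) (by linarith) hA hV
    (by positivity) hζ hC₂ (hint.trans herror) (le_trans ?_ hS)
  have hscale : A * (D * t ^ B * E) = D * t ^ B * (A ^ 2 * (H + 1) *
      Real.exp (A * (4 + 4 * H - H ^ 2 / 2))) := by rw [hE]; ring
  have hC₂_le : C₂ ≤ D := by
    rw [hD]
    linarith [(by positivity : 0 ≤ Q₀)]
  linarith [hscale, hC₂_le]

end LargeValues

/-! ### Mean values of Riesz products over primes -/

section MeanValue

lemma norm_integral_cexp_mul_I_le {ξ : ℝ} (hξ : ξ ≠ 0) (x y : ℝ) :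
    ‖∫ t in x..y, Complex.exp ((ξ * t : ℝ) * Complex.I)‖ ≤ 2 / |ξ| := by
  have hrw (t : ℝ) : Complex.exp ((ξ * t : ℝ) * Complex.I) = Complex.exp (ξ * Complex.I * t) := by
    push_cast
    ring_nf
  have hnorm (t : ℝ) : ‖Complex.exp (ξ * Complex.I * t)‖ = 1 := by
    rw [← hrw, Complex.norm_exp_ofReal_mul_I]
  simp_rw [hrw]
  rw [integral_exp_mul_complex (by simpa using hξ), norm_div]
  gcongr
  · exact (norm_sub_le _ _).trans_eq (by rw [hnorm, hnorm, one_add_one_eq_two])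
  · simp

lemma inv_le_log_sub_log {m n Y : ℕ} (hm : 0 < m) (hmn : m < n) (hn : n ≤ Y) :
    (Y : ℝ)⁻¹ ≤ Real.log n - Real.log m := by
  have hm0 : (0 : ℝ) < m := by exact_mod_cast hm
  have hn0 : (0 : ℝ) < n := by exact_mod_cast hm.trans hmn
  have hmn' : (m : ℝ) + 1 ≤ n := by exact_mod_cast hmn
  calc (Y : ℝ)⁻¹ ≤ (n : ℝ)⁻¹ := by gcongr
    _ ≤ 1 - ((n : ℝ) / m)⁻¹ := by
        rw [inv_div, one_sub_div hn0.ne', inv_eq_one_div]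
        gcongr
        linarith
    _ ≤ Real.log (n / m) := Real.one_sub_inv_le_log_of_pos (div_pos hn0 hm0)
    _ = _ := Real.log_div hn0.ne' hm0.ne'

lemma inv_le_abs_log_sub_log {m n Y : ℕ} (hm : 0 < m) (hn : 0 < n) (hmn : m ≠ n) (hmY : m ≤ Y)
    (hnY : n ≤ Y) : (Y : ℝ)⁻¹ ≤ |Real.log m - Real.log n| := by
  rcases hmn.lt_or_gt with h | h
  · rw [abs_sub_comm]
    exact (inv_le_log_sub_log hm h hnY).trans (le_abs_self _)
  · exact (inv_le_log_sub_log hn h hmY).trans (le_abs_self _)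

variable {ι : Type*} [Fintype ι] {q : ι → ℕ}

lemma injective_prod_prime_pow (hq : ∀ i, (q i).Prime) (hinj : Function.Injective q) :
    Function.Injective fun e : ι → ℕ => ∏ i, q i ^ e i := by
  classical
  have hfactorization (e : ι → ℕ) (i : ι) : (∏ j, q j ^ e j).factorization (q i) = e i := by
    rw [Nat.factorization_prod fun j _ => pow_ne_zero _ (hq j).ne_zero, Finsupp.finsetSum_apply]
    simp [Nat.factorization_pow, (hq _).factorization, Finsupp.single_apply, hinj.eq_iff]
  intro e f hef
  funext i
  rw [← hfactorization e, ← hfactorization f]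
  exact congrArg (fun n => n.factorization (q i)) hef

lemma inv_le_abs_sum_mul_log (hq : ∀ i, (q i).Prime) (hinj : Function.Injective q) {x : ι → ℤ}
    {d : ℕ} (hx : ∀ i, |x i| ≤ d) (hx0 : x ≠ 0) :
    ((∏ i, q i ^ d : ℕ) : ℝ)⁻¹ ≤ |∑ i, (x i : ℝ) * Real.log (q i)| := by
  set u : (ι → ℤ) → ℕ := fun y => ∏ i, q i ^ (y i).toNat with hu
  have hpos (y : ι → ℤ) : 0 < u y := Finset.prod_pos fun i _ => pow_pos (hq i).pos _
  have hle (y : ι → ℤ) (hy : ∀ i, |y i| ≤ d) : u y ≤ ∏ i, q i ^ d :=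
    Finset.prod_le_prod' fun i _ => Nat.pow_le_pow_right (hq i).pos
      (Int.toNat_le.mpr ((le_abs_self _).trans (hy i)))
  have hne : u x ≠ u (-x) := fun h => hx0 <| funext fun i => by
    have hi := congrFun (injective_prod_prime_pow hq hinj h) i
    simp only [Pi.neg_apply, Pi.zero_apply] at hi ⊢
    lia
  have hlog (y : ι → ℤ) : Real.log (u y) = ∑ i, ((y i).toNat : ℝ) * Real.log (q i) := by
    simp only [hu, Nat.cast_prod, Nat.cast_pow]
    rw [Real.log_prod fun i _ => pow_ne_zero _ (by exact_mod_cast (hq i).ne_zero)]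
    exact Finset.sum_congr rfl fun i _ => Real.log_pow _ _
  have hsum : ∑ i, (x i : ℝ) * Real.log (q i) = Real.log (u x) - Real.log (u (-x)) := by
    rw [hlog, hlog, ← Finset.sum_sub_distrib]
    refine Finset.sum_congr rfl fun i _ => ?_
    rw [← sub_mul, Pi.neg_apply]
    congr 1
    exact_mod_cast (Int.toNat_sub_toNat_neg (x i)).symm
  rw [hsum]
  exact inv_le_abs_log_sub_log (hpos x) (hpos _) hne (hle x hx) (hle _ fun i => by simpa using hx i)

/-- The value `p ^ (i t)`. -/
noncomputable def phase (p : ℕ) (t : ℝ) : ℂ := Complex.exp ((t * Real.log p : ℝ) * Complex.I)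

lemma norm_phase (p : ℕ) (t : ℝ) : ‖phase p t‖ = 1 := Complex.norm_exp_ofReal_mul_I _

@[fun_prop]
lemma continuous_phase (p : ℕ) : Continuous (phase p) := by
  unfold phase
  fun_prop

lemma prod_phase_zpow (q : ι → ℕ) (e : ι → ℤ) (t : ℝ) :
    ∏ i, phase (q i) t ^ e i =
      Complex.exp (((∑ i, (e i : ℝ) * Real.log (q i)) * t : ℝ) * Complex.I) := by
  simp_rw [phase, ← Complex.exp_int_mul]
  rw [← Complex.exp_sum]
  push_cast
  simp_rw [Finset.sum_mul]
  exact congrArg _ (Finset.sum_congr rfl fun i _ => by ring)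

lemma norm_integral_prod_phase_zpow_le (hq : ∀ i, (q i).Prime) (hinj : Function.Injective q)
    {e : ι → ℤ} {d : ℕ} (he : ∀ i, |e i| ≤ d) (he0 : e ≠ 0) (x y : ℝ) :
    ‖∫ t in x..y, ∏ i, phase (q i) t ^ e i‖ ≤ 2 * ((∏ i, q i ^ d : ℕ) : ℝ) := by
  have hY : 0 < ((∏ i, q i ^ d : ℕ) : ℝ) := by
    exact_mod_cast Finset.prod_pos fun i _ => pow_pos (hq i).pos d
  have hξ := inv_le_abs_sum_mul_log hq hinj he he0
  have hξ0 := (inv_pos.mpr hY).trans_le hξ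
  simp_rw [prod_phase_zpow]
  refine (norm_integral_cexp_mul_I_le (abs_pos.mp hξ0) x y).trans ?_
  rw [div_eq_mul_inv]
  gcongr
  exact inv_le_of_inv_le₀ hY hξ

lemma norm_integral_prod_laurent_sub_le (hq : ∀ i, (q i).Prime)
    (hinj : Function.Injective q) (d : ℕ) (c : ι → ℤ → ℂ) {x y : ℝ} :
    ‖(∫ t in x..y, ∏ i, ∑ e ∈ Finset.Icc (-d : ℤ) d, c i e * phase (q i) t ^ e) -
        (y - x) * ∏ i, c i 0‖ ≤
      2 * ((∏ i, q i ^ d : ℕ) : ℝ) * ∏ i, ∑ e ∈ Finset.Icc (-d : ℤ) d, ‖c i e‖ := by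
  classical
  set E : Finset (ι → ℤ) := Fintype.piFinset fun _ => Finset.Icc (-d : ℤ) d with hE
  have hcont (e : ι → ℤ) :
      Continuous fun t => (∏ i, c i (e i)) * ∏ i, phase (q i) t ^ e i := by
    simp_rw [prod_phase_zpow]
    fun_prop
  have hexpand : (∫ t in x..y, ∏ i, ∑ e ∈ Finset.Icc (-d : ℤ) d, c i e * phase (q i) t ^ e) =
      ∑ e ∈ E, (∏ i, c i (e i)) * ∫ t in x..y, ∏ i, phase (q i) t ^ e i := by
    simp_rw [Finset.prod_univ_sum, Finset.prod_mul_distrib]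
    rw [intervalIntegral.integral_finsetSum fun e _ =>
      (hcont e).intervalIntegrable _ _]
    exact Finset.sum_congr rfl fun e _ => intervalIntegral.integral_const_mul _ _
  have hzero : (0 : ι → ℤ) ∈ E := by simp [hE]
  have hconst : (∏ i, c i 0) * (∫ t in x..y, ∏ i, phase (q i) t ^ (0 : ℤ)) =
      (y - x) * ∏ i, c i 0 := by
    simp [mul_comm]
  rw [hexpand, ← Finset.add_sum_erase _ _ hzero]
  simp only [Pi.zero_apply]
  rw [hconst, add_sub_cancel_left]
  calc ‖∑ e ∈ E.erase 0, (∏ i, c i (e i)) * ∫ t in x..y, ∏ i, phase (q i) t ^ e i‖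
      ≤ ∑ e ∈ E.erase 0, (∏ i, ‖c i (e i)‖) * (2 * ((∏ i, q i ^ d : ℕ) : ℝ)) := by
        refine norm_sum_le_of_le _ fun e he => ?_
        obtain ⟨he0, heE⟩ := Finset.mem_erase.mp he
        rw [norm_mul, norm_prod]
        gcongr
        exact norm_integral_prod_phase_zpow_le hq hinj
          (fun i => abs_le.mpr (Finset.mem_Icc.mp (Fintype.mem_piFinset.mp heE i))) he0 x y
    _ ≤ ∑ e ∈ E, (∏ i, ‖c i (e i)‖) * (2 * ((∏ i, q i ^ d : ℕ) : ℝ)) :=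
        Finset.sum_le_sum_of_subset_of_nonneg (Finset.erase_subset _ _) fun _ _ _ => by positivity
    _ = _ := by rw [← Finset.sum_mul, Finset.prod_univ_sum, mul_comm]

/-- On the unit circle `f` is a Laurent polynomial of degree at most two, with constant term `m`
and with coefficients of absolute sum at most two. -/
def IsShortLaurent (f : ℂ → ℂ) (m : ℂ) : Prop :=
  ∃ c : ℤ → ℂ, c 0 = m ∧ ∑ e ∈ Finset.Icc (-2 : ℤ) 2, ‖c e‖ ≤ 2 ∧
    ∀ z : ℂ, ‖z‖ = 1 → f z = ∑ e ∈ Finset.Icc (-2 : ℤ) 2, c e * z ^ e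

lemma norm_integral_prod_isShortLaurent_sub_le {S : Finset ℕ} (hS : ∀ p ∈ S, p.Prime)
    {f : ℕ → ℂ → ℂ} {m : ℕ → ℂ} (hf : ∀ p ∈ S, IsShortLaurent (f p) (m p)) (x y : ℝ) :
    ‖(∫ t in x..y, ∏ p ∈ S, f p (phase p t)) - (y - x) * ∏ p ∈ S, m p‖ ≤
      2 * ((∏ p ∈ S, p ^ 2 : ℕ) : ℝ) * 2 ^ S.card := by
  choose! c hcm hc hfc using hf
  have hlaurent := norm_integral_prod_laurent_sub_le (q := fun p : S => (p : ℕ))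
    (fun p => hS p p.2) Subtype.val_injective 2 (fun p => c p) (x := x) (y := y)
  simp only [Nat.cast_ofNat, Finset.prod_coe_sort S fun p => p ^ 2,
    Finset.prod_coe_sort S fun p => c p 0,
    Finset.prod_coe_sort S fun p => ∑ e ∈ Finset.Icc (-2 : ℤ) 2, ‖c p e‖,
    fun t => Finset.prod_coe_sort S fun p => ∑ e ∈ Finset.Icc (-2 : ℤ) 2, c p e * phase p t ^ e]
    at hlaurent
  rw [← Finset.prod_congr rfl hcm]
  simp_rw [Finset.prod_congr rfl fun p hp => hfc p hp _ (norm_phase p _)]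
  refine hlaurent.trans ?_
  gcongr
  rw [← Finset.prod_const]
  exact Finset.prod_le_prod (fun p _ => Finset.sum_nonneg fun e _ => norm_nonneg _) hc

end MeanValue

section Riesz

variable {b : ℂ} {β : ℕ → ℂ} {S : Finset ℕ}

lemma sum_Icc_neg_two_two {M : Type*} [AddCommMonoid M] (f : ℤ → M) :
    ∑ e ∈ Finset.Icc (-2 : ℤ) 2, f e = f (-2) + (f (-1) + (f 0 + (f 1 + f 2))) := by
  rw [show Finset.Icc (-2 : ℤ) 2 = {-2, -1, 0, 1, 2} by decide]
  simp

lemma conj_eq_inv_of_norm_eq_one {z : ℂ} (hz : ‖z‖ = 1) : conj z = z⁻¹ :=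
  (Complex.inv_eq_conj hz).symm

lemma one_add_re_mul_eq {z : ℂ} (hz : ‖z‖ = 1) :
    ((1 + (b * z).re : ℝ) : ℂ) = 1 + (b * z + conj b * z⁻¹) / 2 := by
  push_cast
  rw [Complex.re_eq_add_conj, map_mul, conj_eq_inv_of_norm_eq_one hz]

lemma IsShortLaurent.conj {f : ℂ → ℂ} {m : ℂ} (hf : IsShortLaurent f m) :
    IsShortLaurent (fun z => conj (f z)) (conj m) := by
  obtain ⟨c, rfl, hc, hfc⟩ := hf
  refine ⟨fun e => (starRingEnd ℂ) (c (-e)), by simp, ?_, fun z hz => ?_⟩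
  · simp only [RCLike.norm_conj, sum_Icc_neg_two_two, neg_neg, neg_zero] at hc ⊢
    linarith
  · simp only [hfc z hz, sum_Icc_neg_two_two, map_add, map_mul, map_zpow₀,
      conj_eq_inv_of_norm_eq_one hz, inv_zpow', neg_neg, neg_zero]
    ring

lemma isShortLaurent_one_add_re (hb : ‖b‖ ≤ 1) :
    IsShortLaurent (fun z => ((1 + (b * z).re : ℝ) : ℂ)) 1 := by
  refine ⟨fun e => if e = 0 then 1 else if e = 1 then b / 2 else if e = -1 then conj b / 2 else 0,
    by simp, ?_, fun z hz => ?_⟩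
  · simp only [sum_Icc_neg_two_two]
    simp
    linarith
  · beta_reduce
    rw [one_add_re_mul_eq hz]
    simp [sum_Icc_neg_two_two]
    ring

/-- `b / 2` is the mean of `conj z` against the density `1 + Re (b z)`. -/
lemma isShortLaurent_one_add_re_mul (hb : ‖b‖ ≤ 1) :
    IsShortLaurent (fun z => ((1 + (b * z).re : ℝ) : ℂ) * (conj z - b / 2)) 0 := by
  refine ⟨fun e => if e = -2 then conj b / 2 else if e = -1 then 1 - b * conj b / 4 else
    if e = 1 then -(b ^ 2 / 4) else 0, by simp, ?_, fun z hz => ?_⟩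
  · have hmiddle : ‖1 - b * conj b / 4‖ = 1 - ‖b‖ ^ 2 / 4 := by
      rw [Complex.mul_conj, Complex.normSq_eq_norm_sq, ← Complex.ofReal_ofNat,
        ← Complex.ofReal_div, ← Complex.ofReal_one, ← Complex.ofReal_sub, Complex.norm_real,
        Real.norm_of_nonneg (by nlinarith [norm_nonneg b])]
    simp only [sum_Icc_neg_two_two]
    norm_num [hmiddle]
    linarith
  · have hz0 : z ≠ 0 := norm_ne_zero_iff.mp (hz ▸ one_ne_zero)
    beta_reduce
    rw [one_add_re_mul_eq hz, conj_eq_inv_of_norm_eq_one hz]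
    simp only [sum_Icc_neg_two_two]
    norm_num
    field_simp
    ring

/-- The Riesz product `∏ (1 + Re (β_p p ^ (i t)))` over the primes in `S`, a nonnegative weight
that favours the ordinates `t` at which `p ^ (i t)` points in the direction of `conj β_p`. -/
noncomputable def riesz (β : ℕ → ℂ) (S : Finset ℕ) (t : ℝ) : ℝ :=
  ∏ p ∈ S, (1 + (β p * phase p t).re)

/-- The deviation of `p ^ (-i t)` from its mean `β_p / 2` against the weight `riesz β S`. -/
noncomputable def centred (β : ℕ → ℂ) (p : ℕ) (t : ℝ) : ℂ := conj (phase p t) - β p / 2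

lemma abs_re_mul_phase_le (hb : ‖b‖ ≤ 1) (p : ℕ) (t : ℝ) : |(b * phase p t).re| ≤ 1 := by
  refine (Complex.abs_re_le_norm _).trans ?_
  rwa [norm_mul, norm_phase, mul_one]

lemma riesz_nonneg (hβ : ∀ p, ‖β p‖ ≤ 1) (S : Finset ℕ) (t : ℝ) : 0 ≤ riesz β S t :=
  Finset.prod_nonneg fun p _ => by linarith [(abs_le.mp (abs_re_mul_phase_le (hβ p) p t)).1]

lemma riesz_le (hβ : ∀ p, ‖β p‖ ≤ 1) (S : Finset ℕ) (t : ℝ) : riesz β S t ≤ 2 ^ S.card := by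
  rw [← Finset.prod_const]
  exact Finset.prod_le_prod
    (fun p _ => by linarith [(abs_le.mp (abs_re_mul_phase_le (hβ p) p t)).1])
    fun p _ => by linarith [(abs_le.mp (abs_re_mul_phase_le (hβ p) p t)).2]

@[fun_prop]
lemma continuous_riesz (β : ℕ → ℂ) (S : Finset ℕ) : Continuous (riesz β S) := by
  unfold riesz
  fun_prop

@[fun_prop]
lemma continuous_centred (β : ℕ → ℂ) (p : ℕ) : Continuous (centred β p) :=
  (Complex.continuous_conj.comp (continuous_phase p)).sub continuous_const

lemma norm_centred_le (hβ : ∀ p, ‖β p‖ ≤ 1) (p : ℕ) (t : ℝ) : ‖centred β p t‖ ≤ 2 := by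
  refine (norm_sub_le _ _).trans ?_
  rw [RCLike.norm_conj, norm_phase, norm_div, Complex.norm_ofNat]
  linarith [hβ p]

lemma abs_integral_riesz_sub_le (hβ : ∀ p, ‖β p‖ ≤ 1) (hS : ∀ p ∈ S, p.Prime) (x y : ℝ) :
    |(∫ t in x..y, riesz β S t) - (y - x)| ≤ 2 * ((∏ p ∈ S, p ^ 2 : ℕ) : ℝ) * 2 ^ S.card := by
  have hmean := norm_integral_prod_isShortLaurent_sub_le hS
    (fun p _ => isShortLaurent_one_add_re (hβ p)) x y
  simp_rw [← Complex.ofReal_prod] at hmean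
  rwa [intervalIntegral.integral_ofReal, Finset.prod_const_one, mul_one, ← Complex.ofReal_sub,
    ← Complex.ofReal_sub, Complex.norm_real, Real.norm_eq_abs] at hmean

lemma prod_sq_union_le {W : Finset ℕ} (hS : ∀ p ∈ S, 0 < p) :
    ∏ p ∈ S ∪ W, p ^ 2 ≤ (∏ p ∈ S, p ^ 2) * ∏ p ∈ W, p ^ 2 := by
  rw [← Finset.prod_union_inter]
  exact Nat.le_mul_of_pos_right _
    (Finset.prod_pos fun p hp => pow_pos (hS p (Finset.mem_inter.mp hp).1) 2)

lemma isShortLaurent_one_add_re_mul_ite (hb : ‖b‖ ≤ 1) {p q : ℕ} (hpq : p ≠ q) (v : ℕ) :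
    IsShortLaurent (fun z => ((1 + (b * z).re : ℝ) : ℂ) *
      ((if v = p then conj z - b / 2 else 1) * (if v = q then conj (conj z - b / 2) else 1)))
      (if v = p ∨ v = q then 0 else 1) := by
  by_cases hvp : v = p
  · simpa [hvp, hpq] using isShortLaurent_one_add_re_mul hb
  by_cases hvq : v = q
  · simpa [hvq, hpq.symm] using (isShortLaurent_one_add_re_mul hb).conj
  · simpa [hvp, hvq] using isShortLaurent_one_add_re hb

lemma norm_integral_riesz_mul_centred_le (hβ : ∀ p, ‖β p‖ ≤ 1) (hS : ∀ p ∈ S, p.Prime)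
    (hβS : ∀ p ∉ S, β p = 0) {p q N : ℕ} (hp : p.Prime) (hq : q.Prime) (hpq : p ≠ q) (hpN : p ≤ N)
    (hqN : q ≤ N) (x y : ℝ) :
    ‖∫ t in x..y, (riesz β S t : ℂ) * (centred β p t * conj (centred β q t))‖ ≤
      8 * (N : ℝ) ^ 4 * ((∏ p ∈ S, p ^ 2 : ℕ) : ℝ) * 2 ^ S.card := by
  set V : Finset ℕ := S ∪ {p, q} with hV
  have hVprime : ∀ v ∈ V, v.Prime := by
    simpa [hV, or_imp, forall_and, hp, hq] using hS
  have hfactor (t : ℝ) : (riesz β S t : ℂ) * (centred β p t * conj (centred β q t)) =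
      ∏ v ∈ V, ((1 + (β v * phase v t).re : ℝ) : ℂ) *
        ((if v = p then conj (phase v t) - β v / 2 else 1) *
          (if v = q then conj (conj (phase v t) - β v / 2) else 1)) := by
    rw [Finset.prod_mul_distrib, Finset.prod_mul_distrib, Finset.prod_ite_eq' V p,
      Finset.prod_ite_eq' V q, if_pos (by simp [hV]), if_pos (by simp [hV]), riesz,
      Complex.ofReal_prod, Finset.prod_subset Finset.subset_union_left fun v _ hv => by
        simp [hβS v hv]]
    rfl
  have hmean := norm_integral_prod_isShortLaurent_sub_le hVprime
    (fun v _ => isShortLaurent_one_add_re_mul_ite (hβ v) hpq v) x y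
  rw [Finset.prod_eq_zero (i := p) (by simp [hV]) (by simp), mul_zero, sub_zero] at hmean
  have hprod : ((∏ v ∈ V, v ^ 2 : ℕ) : ℝ) ≤ ((∏ p ∈ S, p ^ 2 : ℕ) : ℝ) * (N : ℝ) ^ 4 := by
    have hpair : ∏ v ∈ ({p, q} : Finset ℕ), v ^ 2 ≤ N ^ 4 :=
      calc _ = p ^ 2 * q ^ 2 := Finset.prod_pair hpq
        _ ≤ N ^ 2 * N ^ 2 := by gcongr
        _ = _ := by ring
    exact_mod_cast (prod_sq_union_le fun v hv => (hS v hv).pos).trans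
      (Nat.mul_le_mul_left _ hpair)
  have hcard : (2 : ℝ) ^ V.card ≤ 2 ^ (S.card + 2) :=
    pow_le_pow_right₀ one_le_two
      ((Finset.card_union_le _ _).trans (Nat.add_le_add_left Finset.card_le_two _))
  simp_rw [hfactor]
  calc _ ≤ 2 * ((∏ v ∈ V, v ^ 2 : ℕ) : ℝ) * 2 ^ V.card := hmean
    _ ≤ 2 * (((∏ p ∈ S, p ^ 2 : ℕ) : ℝ) * (N : ℝ) ^ 4) * 2 ^ (S.card + 2) := by gcongr
    _ = _ := by ring

end Riesz

section SecondMoment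

variable {x y : ℝ} {w : ℝ → ℝ}

lemma ofReal_integral_mul_norm_sum_sq {κ : Type*} {s : Finset κ} {f : κ → ℝ → ℂ}
    (hw : Continuous w) (hf : ∀ i, Continuous (f i)) (d : κ → ℂ) :
    ((∫ t in x..y, w t * ‖∑ i ∈ s, d i * f i t‖ ^ 2 : ℝ) : ℂ) =
      ∑ i ∈ s, ∑ j ∈ s, d i * conj (d j) * ∫ t in x..y, (w t : ℂ) * (f i t * conj (f j t)) := by
  have hpointwise (t : ℝ) : ((w t * ‖∑ i ∈ s, d i * f i t‖ ^ 2 : ℝ) : ℂ) =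
      ∑ i ∈ s, ∑ j ∈ s, d i * conj (d j) * ((w t : ℂ) * (f i t * conj (f j t))) := by
    rw [Complex.ofReal_mul, ← Complex.normSq_eq_norm_sq, ← Complex.mul_conj, map_sum,
      Finset.sum_mul_sum, Finset.mul_sum]
    refine Finset.sum_congr rfl fun i _ => ?_
    rw [Finset.mul_sum]
    refine Finset.sum_congr rfl fun j _ => ?_
    rw [map_mul]
    ring
  have hcont (i j : κ) : Continuous fun t =>
      d i * conj (d j) * ((w t : ℂ) * (f i t * conj (f j t))) :=
    continuous_const.mul ((Complex.continuous_ofReal.comp hw).mul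
      ((hf i).mul (Complex.continuous_conj.comp (hf j))))
  rw [← intervalIntegral.integral_ofReal]
  simp_rw [hpointwise]
  rw [intervalIntegral.integral_finsetSum fun i _ =>
    (continuous_finsetSum _ fun j _ => hcont i j).intervalIntegrable _ _]
  refine Finset.sum_congr rfl fun i _ => ?_
  rw [intervalIntegral.integral_finsetSum fun j _ => (hcont i j).intervalIntegrable _ _]
  exact Finset.sum_congr rfl fun j _ => intervalIntegral.integral_const_mul _ _

lemma integral_mul_norm_sum_sq_le {κ : Type*} {s : Finset κ} {f : κ → ℝ → ℂ} {D E : ℝ}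
    (hw : Continuous w) (hf : ∀ i, Continuous (f i)) (hE : 0 ≤ E)
    (hdiag : ∀ i ∈ s, ‖∫ t in x..y, (w t : ℂ) * (f i t * conj (f i t))‖ ≤ D)
    (hoff : ∀ i ∈ s, ∀ j ∈ s, i ≠ j → ‖∫ t in x..y, (w t : ℂ) * (f i t * conj (f j t))‖ ≤ E)
    (d : κ → ℂ) :
    ∫ t in x..y, w t * ‖∑ i ∈ s, d i * f i t‖ ^ 2 ≤
      D * ∑ i ∈ s, ‖d i‖ ^ 2 + E * (∑ i ∈ s, ‖d i‖) ^ 2 := by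
  classical
  have hterm : ∀ i ∈ s, ∀ j ∈ s,
      ‖d i * conj (d j) * ∫ t in x..y, (w t : ℂ) * (f i t * conj (f j t))‖ ≤
        (if i = j then D * ‖d i‖ ^ 2 else 0) + E * (‖d i‖ * ‖d j‖) := fun i hi j hj => by
    rw [norm_mul, norm_mul, RCLike.norm_conj, mul_comm]
    split_ifs with hij
    · subst hij
      rw [← sq]
      exact (mul_le_mul_of_nonneg_right (hdiag i hi) (by positivity)).trans
        (le_add_of_nonneg_right (by positivity))
    · rw [zero_add]
      exact mul_le_mul_of_nonneg_right (hoff i hi j hj hij) (by positivity)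
  calc _ ≤ ‖((∫ t in x..y, w t * ‖∑ i ∈ s, d i * f i t‖ ^ 2 : ℝ) : ℂ)‖ := by
        rw [Complex.norm_real]
        exact Real.le_norm_self _
    _ ≤ ∑ i ∈ s, ∑ j ∈ s, ((if i = j then D * ‖d i‖ ^ 2 else 0) + E * (‖d i‖ * ‖d j‖)) := by
        rw [ofReal_integral_mul_norm_sum_sq hw hf]
        exact norm_sum_le_of_le _ fun i hi => norm_sum_le_of_le _ fun j hj => hterm i hi j hj
    _ = _ := by
        simp_rw [Finset.sum_add_distrib, Finset.sum_ite_eq, sq (∑ i ∈ s, ‖d i‖),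
          Finset.sum_mul_sum, Finset.mul_sum]
        exact congrArg₂ _ (Finset.sum_congr rfl fun i hi => if_pos hi) rfl

lemma integral_riesz_mul_sq_le {β : ℕ → ℂ} (hβ : ∀ p, ‖β p‖ ≤ 1) {S S' : Finset ℕ}
    (hS : ∀ p ∈ S, p.Prime) (hβS : ∀ p ∉ S, β p = 0) {N : ℕ} (hS' : ∀ p ∈ S', p.Prime ∧ p ≤ N)
    (d : ℕ → ℂ) (hxy : x ≤ y) :
    ∫ t in x..y, riesz β S t * ‖∑ p ∈ S', d p * centred β p t‖ ^ 2 ≤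
      4 * (∫ t in x..y, riesz β S t) * ∑ p ∈ S', ‖d p‖ ^ 2 +
        8 * (N : ℝ) ^ 4 * ((∏ p ∈ S, p ^ 2 : ℕ) : ℝ) * 2 ^ S.card * (∑ p ∈ S', ‖d p‖) ^ 2 := by
  refine integral_mul_norm_sum_sq_le (continuous_riesz β S) (continuous_centred β) (by positivity)
    (fun p _ => ?_) (fun p hp q hq hpq => norm_integral_riesz_mul_centred_le hβ hS hβS
      (hS' p hp).1 (hS' q hq).1 hpq (hS' p hp).2 (hS' q hq).2 x y) d
  rw [← intervalIntegral.integral_const_mul]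
  refine intervalIntegral.norm_integral_le_of_norm_le hxy (Eventually.of_forall fun t _ => ?_)
    ((continuous_const.mul (continuous_riesz β S)).intervalIntegrable _ _)
  rw [norm_mul, norm_mul, RCLike.norm_conj, Complex.norm_real,
    Real.norm_of_nonneg (riesz_nonneg hβ S t), mul_comm]
  gcongr
  · exact riesz_nonneg hβ S t
  · nlinarith [norm_nonneg (centred β p t), norm_centred_le hβ p t]

end SecondMoment

/-! ### Selecting a common ordinate -/

section Averaging

lemma exists_forall_le_of_sum_setIntegral_lt {α κ : Type*} [MeasurableSpace α] [Fintype κ]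
    {μ : Measure α} {s : Set α} (hs : MeasurableSet s) {w : α → ℝ} {Q : κ → α → ℝ} {K : ℝ}
    (hw : IntegrableOn w s μ) (hw0 : ∀ t ∈ s, 0 ≤ w t)
    (hQ : ∀ j, IntegrableOn (fun t => w t * Q j t) s μ) (hQ0 : ∀ j, ∀ t ∈ s, 0 ≤ Q j t)
    (hlt : ∑ j, ∫ t in s, w t * Q j t ∂μ < K * ∫ t in s, w t ∂μ) :
    ∃ t ∈ s, ∀ j, Q j t ≤ K := by
  by_contra! hlarge
  refine hlt.not_ge ?_
  rw [← integral_const_mul, ← integral_finsetSum _ fun j _ => hQ j]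
  refine setIntegral_mono_on (hw.const_mul K) (integrable_finsetSum _ fun j _ => hQ j) hs
    fun t ht => ?_
  obtain ⟨j, hj⟩ := hlarge t ht
  calc K * w t ≤ w t * Q j t := by
        rw [mul_comm]
        exact mul_le_mul_of_nonneg_left hj.le (hw0 t ht)
    _ ≤ ∑ j, w t * Q j t :=
        Finset.single_le_sum (f := fun j => w t * Q j t)
          (fun i _ => mul_nonneg (hw0 t ht) (hQ0 i t ht)) (Finset.mem_univ j)

/-- The closed `h`-neighbourhood of a finite set of reals. -/
def finiteThickening (F : Finset ℝ) (h : ℝ) : Set ℝ := ⋃ x ∈ F, Set.Icc (x - h) (x + h)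

variable {F : Finset ℝ} {h : ℝ}

lemma measurableSet_finiteThickening : MeasurableSet (finiteThickening F h) :=
  Finset.measurableSet_biUnion _ fun _ _ => measurableSet_Icc

lemma lt_abs_sub_of_notMem_finiteThickening {t x : ℝ} (ht : t ∉ finiteThickening F h)
    (hx : x ∈ F) : h < |t - x| := by
  contrapose! ht
  obtain ⟨hlow, hhigh⟩ := abs_le.mp ht
  exact Set.mem_biUnion hx ⟨by linarith, by linarith⟩

lemma volume_finiteThickening_lt_top : volume (finiteThickening F h) < ⊤ :=
  measure_biUnion_lt_top F.finite_toSet fun _ _ => measure_Icc_lt_top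

lemma volume_real_finiteThickening_le (hh : 0 ≤ h) :
    volume.real (finiteThickening F h) ≤ F.card * (2 * h) := by
  refine (measureReal_biUnion_finset_le F _).trans ?_
  rw [← nsmul_eq_mul]
  refine Finset.sum_le_card_nsmul _ _ _ fun x _ => ?_
  rw [Real.volume_real_Icc_of_le (by linarith)]
  linarith

end Averaging

section Ordinate

variable {β : ℕ → ℂ} {S S' : Finset ℕ} {F : Finset ℝ} {h x y : ℝ}

lemma le_setIntegral_riesz_sdiff (hβ : ∀ p, ‖β p‖ ≤ 1) (hS : ∀ p ∈ S, p.Prime) (hh : 0 ≤ h)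
    (hxy : x ≤ y) :
    y - x - 2 * ((∏ p ∈ S, p ^ 2 : ℕ) : ℝ) * 2 ^ S.card - 2 ^ S.card * (F.card * (2 * h)) ≤
      ∫ t in Set.Ioc x y \ finiteThickening F h, riesz β S t := by
  have hsplit := integral_inter_add_sdiff (μ := volume) (s := Set.Ioc x y)
    (measurableSet_finiteThickening (F := F) (h := h))
    (((continuous_riesz β S).intervalIntegrable x y).1)
  rw [← intervalIntegral.integral_of_le hxy] at hsplit
  have hnear : ∫ t in Set.Ioc x y ∩ finiteThickening F h, riesz β S t ≤
      2 ^ S.card * (F.card * (2 * h)) := by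
    have hfinite : volume (Set.Ioc x y ∩ finiteThickening F h) < ⊤ :=
      (measure_mono Set.inter_subset_right).trans_lt volume_finiteThickening_lt_top
    refine (Real.le_norm_self _).trans ((norm_setIntegral_le_of_norm_le_const hfinite
      fun t _ => (Real.norm_of_nonneg (riesz_nonneg hβ S t)).trans_le (riesz_le hβ S t)).trans ?_)
    gcongr
    exact (measureReal_mono Set.inter_subset_right volume_finiteThickening_lt_top.ne).trans
      (volume_real_finiteThickening_le hh)
  linarith [(abs_le.mp (abs_integral_riesz_sub_le hβ hS x y)).1]

lemma setIntegral_riesz_mul_sq_le (hβ : ∀ p, ‖β p‖ ≤ 1) (hS : ∀ p ∈ S, p.Prime)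
    (hβS : ∀ p ∉ S, β p = 0) {N : ℕ} (hS' : ∀ p ∈ S', p.Prime ∧ p ≤ N) {T G : ℝ} (hT : 0 ≤ T)
    {d : ℕ → ℂ} (hP : 2 * ((∏ p ∈ S, p ^ 2 : ℕ) : ℝ) * 2 ^ S.card ≤ T)
    (hd2 : 4 * ∑ p ∈ S', ‖d p‖ ^ 2 ≤ G)
    (hd1 : 8 * (N : ℝ) ^ 4 * ((∏ p ∈ S, p ^ 2 : ℕ) : ℝ) * 2 ^ S.card * (∑ p ∈ S', ‖d p‖) ^ 2 ≤ T)
    {s : Set ℝ} (hs : s ⊆ Set.Ioc T (2 * T)) :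
    ∫ t in s, riesz β S t * ‖∑ p ∈ S', d p * centred β p t‖ ^ 2 ≤ (2 * G + 1) * T := by
  have hTT : T ≤ 2 * T := by linarith
  have hmass := (abs_le.mp ((abs_integral_riesz_sub_le hβ hS T (2 * T)).trans hP)).2
  have hdiag : 4 * (∫ t in T..2 * T, riesz β S t) * ∑ p ∈ S', ‖d p‖ ^ 2 ≤ 2 * T * G :=
    calc _ = (∫ t in T..2 * T, riesz β S t) * (4 * ∑ p ∈ S', ‖d p‖ ^ 2) := by ring
      _ ≤ _ := mul_le_mul (by linarith) hd2 (by positivity) (by positivity)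
  calc _ ≤ ∫ t in T..2 * T, riesz β S t * ‖∑ p ∈ S', d p * centred β p t‖ ^ 2 := by
        rw [intervalIntegral.integral_of_le hTT]
        exact setIntegral_mono_set (Continuous.intervalIntegrable (by fun_prop) T (2 * T)).1
          (Eventually.of_forall fun t => mul_nonneg (riesz_nonneg hβ S t) (by positivity))
          hs.eventuallyLE
    _ ≤ _ := integral_riesz_mul_sq_le hβ hS hβS hS' d hTT
    _ ≤ _ := by linarith

lemma exists_ordinate {κ : Type*} [Fintype κ] (hβ : ∀ p, ‖β p‖ ≤ 1) (hS : ∀ p ∈ S, p.Prime)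
    (hβS : ∀ p ∉ S, β p = 0) {N : ℕ} (hS' : ∀ p ∈ S', p.Prime ∧ p ≤ N) {d : κ → ℕ → ℂ} {T G : ℝ}
    (hT : 0 < T) (hh : 0 ≤ h) (hG : 0 ≤ G) (hF : 2 ^ S.card * (F.card * (2 * h)) ≤ T / 8)
    (hP : 2 * ((∏ p ∈ S, p ^ 2 : ℕ) : ℝ) * 2 ^ S.card ≤ T / 8)
    (hd2 : ∀ j, 4 * ∑ p ∈ S', ‖d j p‖ ^ 2 ≤ G)
    (hd1 : ∀ j, 8 * (N : ℝ) ^ 4 * ((∏ p ∈ S, p ^ 2 : ℕ) : ℝ) * 2 ^ S.card *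
      (∑ p ∈ S', ‖d j p‖) ^ 2 ≤ T) :
    ∃ t ∈ Set.Ioc T (2 * T), (∀ x ∈ F, h < |t - x|) ∧
      ∀ j, ‖∑ p ∈ S', d j p * centred β p t‖ ^ 2 ≤ 2 * (Fintype.card κ * (2 * G + 1)) + 1 := by
  set s : Set ℝ := Set.Ioc T (2 * T) \ finiteThickening F h
  have hs_subset : s ⊆ Set.Ioc T (2 * T) := Set.sdiff_subset
  have hint {f : ℝ → ℝ} (hf : Continuous f) : IntegrableOn f s :=
    ((hf.intervalIntegrable T (2 * T)).1).mono_set hs_subset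
  have hmass : 3 / 4 * T ≤ ∫ t in s, riesz β S t := by
    linarith [le_setIntegral_riesz_sdiff (F := F) hβ hS hh (show T ≤ 2 * T by linarith)]
  have hmoment : ∑ j, ∫ t in s, riesz β S t * ‖∑ p ∈ S', d j p * centred β p t‖ ^ 2 ≤
      Fintype.card κ * ((2 * G + 1) * T) := by
    rw [← nsmul_eq_mul, ← Finset.card_univ]
    exact Finset.sum_le_card_nsmul _ _ _ fun j _ => setIntegral_riesz_mul_sq_le hβ hS hβS hS' hT.le
      (hP.trans (by linarith)) (hd2 j) (hd1 j) hs_subset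
  have hlt : Fintype.card κ * ((2 * G + 1) * T) <
      (2 * (Fintype.card κ * (2 * G + 1)) + 1) * ∫ t in s, riesz β S t := by
    have hcard : 0 ≤ (Fintype.card κ : ℝ) * (2 * G + 1) := by positivity
    calc Fintype.card κ * ((2 * G + 1) * T)
        < (2 * (Fintype.card κ * (2 * G + 1)) + 1) * (3 / 4 * T) := by nlinarith
      _ ≤ _ := by gcongr
  obtain ⟨t, ⟨htT, htF⟩, ht⟩ := exists_forall_le_of_sum_setIntegral_lt
    (Q := fun j t => ‖∑ p ∈ S', d j p * centred β p t‖ ^ 2)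
    (measurableSet_Ioc.diff measurableSet_finiteThickening) (hint (continuous_riesz β S))
    (fun t _ => riesz_nonneg hβ S t) (fun j => hint (by fun_prop)) (fun j t _ => by positivity)
    (hmoment.trans_lt hlt)
  exact ⟨t, htT, fun x hx => lt_abs_sub_of_notMem_finiteThickening htF hx, ht⟩

end Ordinate

/-! ### Orthogonality over dyadic blocks of primes -/

section Dyadic

/-- **Abel's inequality**. -/
lemma norm_sum_Ioc_smul_le {E : Type*} [NormedAddCommGroup E] [NormedSpace ℝ E] {m n : ℕ}
    (hmn : m < n) {c : ℕ → E} {g : ℕ → ℝ} {M : ℝ} (hg : AntitoneOn g (Set.Ioc m n))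
    (hgn : 0 ≤ g n) (hc : ∀ l ∈ Set.Ioc m n, ‖∑ i ∈ Finset.Ioc m l, c i‖ ≤ M) :
    ‖∑ i ∈ Finset.Ioc m n, g i • c i‖ ≤ M * g (m + 1) := by
  have hparts : ∀ l, m + 1 ≤ l → l ≤ n →
      ‖∑ i ∈ Finset.Ioc m l, g i • c i - g l • ∑ i ∈ Finset.Ioc m l, c i‖ ≤
        M * (g (m + 1) - g l) := by
    intro l hl
    induction l, hl using Nat.le_induction with
    | base => simp
    | succ l hl ih =>
      intro hln
      have hdrop : 0 ≤ g l - g (l + 1) :=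
        sub_nonneg.mpr (hg ⟨by lia, by lia⟩ ⟨by lia, by lia⟩ l.le_succ)
      have hstep : ∑ i ∈ Finset.Ioc m (l + 1), g i • c i -
          g (l + 1) • ∑ i ∈ Finset.Ioc m (l + 1), c i =
          (∑ i ∈ Finset.Ioc m l, g i • c i - g l • ∑ i ∈ Finset.Ioc m l, c i) +
            (g l - g (l + 1)) • ∑ i ∈ Finset.Ioc m l, c i := by
        rw [Finset.sum_Ioc_succ_top (by lia), Finset.sum_Ioc_succ_top (by lia)]
        module
      calc _ ≤ M * (g (m + 1) - g l) + (g l - g (l + 1)) * M := by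
            rw [hstep]
            refine norm_add_le_of_le (ih (by lia)) ?_
            rw [norm_smul, Real.norm_of_nonneg hdrop]
            exact mul_le_mul_of_nonneg_left (hc l ⟨by lia, by lia⟩) hdrop
        _ = _ := by ring
  have hlast : ‖g n • ∑ i ∈ Finset.Ioc m n, c i‖ ≤ g n * M := by
    rw [norm_smul, Real.norm_of_nonneg hgn]
    exact mul_le_mul_of_nonneg_left (hc n ⟨hmn, le_rfl⟩) hgn
  calc _ ≤ _ := norm_le_norm_sub_add _ (g n • ∑ i ∈ Finset.Ioc m n, c i)
    _ ≤ M * (g (m + 1) - g n) + g n * M := add_le_add (hparts n hmn le_rfl) hlast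
    _ = _ := by ring

/-- The primes in `(x / 2, x]`. -/
noncomputable def dyadicPrimes (x : ℝ) : Finset ℕ := {p ∈ Finset.Ioc ⌊x / 2⌋₊ ⌊x⌋₊ | p.Prime}

lemma prime_of_mem_dyadicPrimes {x : ℝ} {p : ℕ} (hp : p ∈ dyadicPrimes x) : p.Prime :=
  (Finset.mem_filter.mp hp).2

lemma le_floor_of_mem_dyadicPrimes {x : ℝ} {p : ℕ} (hp : p ∈ dyadicPrimes x) : p ≤ ⌊x⌋₊ :=
  (Finset.mem_Ioc.mp (Finset.mem_filter.mp hp).1).2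

lemma primeCorr_sub {a b : ℕ → ℂ} {x y : ℝ} (hxy : x ≤ y) :
    primeCorr a b y - primeCorr a b x =
      ∑ p ∈ Finset.Ioc ⌊x⌋₊ ⌊y⌋₊ with p.Prime, a p * conj (b p) := by
  have hIoc (n : ℕ) : Finset.Icc 1 n = Finset.Ioc 0 n := rfl
  simp only [primeCorr, Finset.sum_filter, hIoc]
  rw [← Finset.sum_Ioc_consecutive _ (Nat.zero_le _) (Nat.floor_le_floor hxy), add_sub_cancel_left]

lemma div_log_le_Li_sub {x y : ℝ} (hx : 2 ≤ x) (hxy : x ≤ y) :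
    (y - x) / Real.log y ≤ Li y - Li x := by
  have hint {u v : ℝ} (hu : 2 ≤ u) (hv : 2 ≤ v) :
      IntervalIntegrable (fun t => (Real.log t)⁻¹) volume u v :=
    ContinuousOn.intervalIntegrable fun t ht => by
      have ht2 : 2 ≤ t := (le_min hu hv).trans ht.1
      exact ((Real.continuousAt_log (by linarith)).inv₀
        (Real.log_pos (by linarith)).ne').continuousWithinAt
  calc (y - x) / Real.log y = ∫ _t in x..y, (Real.log y)⁻¹ := by
        rw [intervalIntegral.integral_const, smul_eq_mul, div_eq_mul_inv]
    _ ≤ ∫ t in x..y, (Real.log t)⁻¹ := by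
        refine intervalIntegral.integral_mono_on hxy (by simp) (hint hx (hx.trans hxy))
          fun t ht => ?_
        exact inv_anti₀ (Real.log_pos (by linarith [ht.1]))
          (Real.log_le_log (by linarith [ht.1]) ht.2)
    _ = Li y - Li x := (intervalIntegral.integral_interval_sub_left
        (hint le_rfl (hx.trans hxy)) (hint le_rfl hx)).symm

lemma eventually_norm_sub_half_le {E : Type*} [NormedAddCommGroup E] {f : ℝ → E}
    (hf : f =o[atTop] fun x => x / Real.log x) {ε : ℝ} (hε : 0 < ε) :
    ∀ᶠ x : ℝ in atTop, ∀ u ∈ Set.Icc (x / 2) x, ‖f u - f (x / 2)‖ ≤ ε * (x / Real.log x) := by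
  obtain ⟨u₀, hu₀⟩ := eventually_atTop.mp (hf.bound (c := ε / 4) (by positivity))
  filter_upwards [eventually_ge_atTop (2 * u₀), eventually_ge_atTop 4] with x hxu hx4 u hu
  have hlogx : 0 < Real.log x := Real.log_pos (by linarith)
  have hlog4 : Real.log 4 = 2 * Real.log 2 := by
    rw [show (4 : ℝ) = 2 ^ 2 by norm_num, Real.log_pow, Nat.cast_ofNat]
  have hsize : ∀ v ∈ Set.Icc (x / 2) x, ‖f v‖ ≤ ε / 2 * (x / Real.log x) := by
    intro v hv
    have hlogv : Real.log x / 2 ≤ Real.log v := by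
      have hmono := Real.log_le_log (by linarith) hv.1
      rw [Real.log_div (by linarith) two_ne_zero] at hmono
      linarith [Real.log_le_log (by norm_num) hx4]
    have hv0 : 0 ≤ v := by linarith [hv.1]
    calc ‖f v‖ ≤ ε / 4 * (v / Real.log v) := by
          have hbound := hu₀ v (by linarith [hv.1])
          rwa [Real.norm_of_nonneg (div_nonneg hv0 (by linarith))] at hbound
      _ ≤ ε / 4 * (x / (Real.log x / 2)) := by
          gcongr
          exact hv.2
      _ = _ := by ring
  calc _ ≤ ε / 2 * (x / Real.log x) + ε / 2 * (x / Real.log x) :=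
        norm_sub_le_of_le (hsize u hu) (hsize _ ⟨le_rfl, by linarith⟩)
    _ = _ := by ring

end Dyadic

section Weight

/-- The weight `p^{-σ} exp (-(log p)² / (4 * A))` with which `p` enters `smoothSum`. -/
noncomputable def weight (A σ : ℝ) (p : ℕ) : ℝ :=
  (p : ℝ) ^ (-σ) * Real.exp (-(Real.log p ^ 2 / (4 * A)))

variable {A σ x : ℝ} {p : ℕ}

lemma weight_nonneg (A σ : ℝ) (p : ℕ) : 0 ≤ weight A σ p := by
  unfold weight
  positivity

lemma weight_le_rpow (hA : 0 ≤ A) (σ : ℝ) (p : ℕ) : weight A σ p ≤ (p : ℝ) ^ (-σ) := by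
  refine mul_le_of_le_one_right (by positivity) ?_
  rw [Real.exp_le_one_iff, neg_nonpos]
  positivity

lemma antitoneOn_weight (hA : 0 ≤ A) (hσ : 0 ≤ σ) : AntitoneOn (weight A σ) (Set.Ioi 0) := by
  intro m hm n _ hmn
  have hm0 : (0 : ℝ) < m := by exact_mod_cast hm
  unfold weight
  refine mul_le_mul ?_ ?_ (Real.exp_pos _).le (by positivity)
  · exact Real.rpow_le_rpow_of_nonpos hm0 (by exact_mod_cast hmn) (by linarith)
  · gcongr

lemma half_rpow_le_weight (hσ : 0 ≤ σ) (hp : 0 < p) (hpx : p ≤ x) (hA : Real.log x ^ 2 ≤ A) :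
    x ^ (-σ) / 2 ≤ weight A σ p := by
  have hp0 : (0 : ℝ) < p := by exact_mod_cast hp
  have hexponent : Real.log p ^ 2 / (4 * A) ≤ 1 / 4 := by
    refine div_le_of_le_mul₀ (by linarith [sq_nonneg (Real.log x)]) (by norm_num) ?_
    calc Real.log p ^ 2 ≤ Real.log x ^ 2 := by gcongr
      _ ≤ 1 / 4 * (4 * A) := by linarith
  have hgauss : 1 / 2 ≤ Real.exp (-(Real.log p ^ 2 / (4 * A))) := by
    linarith [Real.add_one_le_exp (-(Real.log p ^ 2 / (4 * A)))]
  calc x ^ (-σ) / 2 = x ^ (-σ) * (1 / 2) := by ring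
    _ ≤ _ := mul_le_mul (Real.rpow_le_rpow_of_nonpos hp0 hpx (by linarith)) hgauss (by norm_num)
        (by positivity)

end Weight

section Correlation

/-- The correlation `∑ w(p) a(p) conj (b(p))` of two sequences over `S`. -/
noncomputable def weightedCorr (S : Finset ℕ) (w : ℕ → ℝ) (a b : ℕ → ℂ) : ℂ :=
  ∑ p ∈ S, w p • (a p * conj (b p))

lemma re_weightedCorr_self (S : Finset ℕ) (w : ℕ → ℝ) (a : ℕ → ℂ) :
    (weightedCorr S w a a).re = ∑ p ∈ S, w p * ‖a p‖ ^ 2 := by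
  simp [weightedCorr, Complex.mul_conj', ← Complex.ofReal_pow]

variable {a b : ℕ → ℂ} {σ : ℝ}

lemma mul_rpow_neg_eq {x : ℝ} (hx : 0 < x) (σ : ℝ) : x * x ^ (-σ) = x ^ (1 - σ) := by
  rw [sub_eq_add_neg, Real.rpow_add hx, Real.rpow_one]

lemma norm_weightedCorr_dyadicPrimes_le {x M : ℝ} (hx : 2 ≤ x) {w : ℕ → ℝ} (hw : ∀ p, 0 ≤ w p)
    (hanti : AntitoneOn w (Set.Ioi 0))
    (hM : ∀ u ∈ Set.Icc (x / 2) x, ‖primeCorr a b u - primeCorr a b (x / 2)‖ ≤ M) :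
    ‖weightedCorr (dyadicPrimes x) w a b‖ ≤ M * w (⌊x / 2⌋₊ + 1) := by
  have hfloor : (⌊x / 2⌋₊ : ℝ) ≤ x / 2 := Nat.floor_le (by linarith)
  have hlt : ⌊x / 2⌋₊ < ⌊x⌋₊ := by
    rw [← Nat.add_one_le_iff, Nat.le_floor_iff (by linarith)]
    push_cast
    linarith
  have habel := norm_sum_Ioc_smul_le hlt (c := fun p => if p.Prime then a p * conj (b p) else 0)
    (hanti.mono fun l hl => Set.mem_Ioi.mpr (Nat.zero_lt_of_lt hl.1)) (hw _) (M := M) ?_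
  · rw [weightedCorr, dyadicPrimes, Finset.sum_filter]
    simpa only [smul_ite, smul_zero] using habel
  · intro l hl
    have hlow : x / 2 ≤ l := ((Nat.floor_lt (by linarith)).mp hl.1).le
    have hhigh : (l : ℝ) ≤ x := (Nat.le_floor_iff (by linarith)).mp hl.2
    have hdiff := hM l ⟨hlow, hhigh⟩
    rwa [primeCorr_sub hlow, Nat.floor_natCast, Finset.sum_filter] at hdiff

lemma eventually_norm_weightedCorr_le (h : primeCorr a b =o[atTop] fun x => x / Real.log x)
    (hσ0 : 0 ≤ σ) (hσ1 : σ ≤ 1) {ε : ℝ} (hε : 0 < ε) :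
    ∀ᶠ x : ℝ in atTop, ∀ A, 0 ≤ A →
      ‖weightedCorr (dyadicPrimes x) (weight A σ) a b‖ ≤ ε * (x ^ (1 - σ) / Real.log x) := by
  filter_upwards [eventually_norm_sub_half_le h (half_pos hε), eventually_ge_atTop 2]
    with x hdiff hx A hA
  have hlogx : 0 < Real.log x := Real.log_pos (by linarith)
  have hweight : weight A σ (⌊x / 2⌋₊ + 1) ≤ 2 * x ^ (-σ) := by
    refine (weight_le_rpow hA _ _).trans ?_
    calc ((⌊x / 2⌋₊ + 1 : ℕ) : ℝ) ^ (-σ) ≤ (x / 2) ^ (-σ) :=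
          Real.rpow_le_rpow_of_nonpos (by linarith)
            (by exact_mod_cast (Nat.lt_floor_add_one (x / 2)).le) (by linarith)
      _ = 2 ^ σ * x ^ (-σ) := by
          rw [Real.div_rpow (by linarith) zero_le_two, Real.rpow_neg zero_le_two, div_inv_eq_mul,
            mul_comm]
      _ ≤ _ := by
          gcongr
          simpa using Real.rpow_le_rpow_of_exponent_le one_le_two hσ1
  calc _ ≤ ε / 2 * (x / Real.log x) * weight A σ (⌊x / 2⌋₊ + 1) :=
        norm_weightedCorr_dyadicPrimes_le hx (weight_nonneg A σ) (antitoneOn_weight hA hσ0) hdiff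
    _ ≤ ε / 2 * (x / Real.log x) * (2 * x ^ (-σ)) := by gcongr
    _ = _ := by
        rw [← mul_rpow_neg_eq (by linarith)]
        ring

lemma eventually_le_sum_dyadicPrimes {κ : ℝ} (hκ : 0 < κ)
    (h : (fun x => primeCorr a a x - (κ * Li x : ℝ)) =o[atTop] fun x => x / Real.log x) :
    ∀ᶠ x : ℝ in atTop, κ / 4 * (x / Real.log x) ≤ ∑ p ∈ dyadicPrimes x, ‖a p‖ ^ 2 := by
  filter_upwards [eventually_norm_sub_half_le h (show 0 < κ / 4 by positivity),
    eventually_ge_atTop 4] with x hdiff hx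
  have hre := (abs_le.mp ((Complex.abs_re_le_norm _).trans
    (hdiff x ⟨by linarith, le_rfl⟩))).1
  have hsum : ∑ p ∈ dyadicPrimes x, ‖a p‖ ^ 2 =
      (primeCorr a a x - primeCorr a a (x / 2)).re := by
    rw [primeCorr_sub (by linarith)]
    simp [dyadicPrimes, Complex.mul_conj', ← Complex.ofReal_pow]
  have hLi : κ * ((x - x / 2) / Real.log x) ≤ κ * (Li x - Li (x / 2)) := by
    gcongr
    exact div_log_le_Li_sub (by linarith) (by linarith)
  have hhalf : κ * ((x - x / 2) / Real.log x) = κ / 2 * (x / Real.log x) := by ring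
  simp only [Complex.sub_re, Complex.ofReal_re] at hre hsum
  linarith

lemma eventually_le_re_weightedCorr_self {κ : ℝ} (hκ : 0 < κ)
    (h : (fun x => primeCorr a a x - (κ * Li x : ℝ)) =o[atTop] fun x => x / Real.log x)
    (hσ : 0 ≤ σ) :
    ∀ᶠ x : ℝ in atTop, ∀ A, Real.log x ^ 2 ≤ A →
      κ / 8 * (x ^ (1 - σ) / Real.log x) ≤
        (weightedCorr (dyadicPrimes x) (weight A σ) a a).re := by
  filter_upwards [eventually_le_sum_dyadicPrimes hκ h, eventually_gt_atTop 0] with x hsum hx A hA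
  calc κ / 8 * (x ^ (1 - σ) / Real.log x)
      = x ^ (-σ) / 2 * (κ / 4 * (x / Real.log x)) := by
        rw [← mul_rpow_neg_eq hx]
        ring
    _ ≤ x ^ (-σ) / 2 * ∑ p ∈ dyadicPrimes x, ‖a p‖ ^ 2 := by gcongr
    _ ≤ ∑ p ∈ dyadicPrimes x, weight A σ p * ‖a p‖ ^ 2 := by
        rw [Finset.mul_sum]
        gcongr with p hp
        exact half_rpow_le_weight hσ (prime_of_mem_dyadicPrimes hp).pos
          ((Nat.le_floor_iff hx.le).mp (le_floor_of_mem_dyadicPrimes hp)) hA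
    _ = _ := (re_weightedCorr_self _ _ _).symm

lemma exists_ne_zero_of_primeCorr {κ : ℝ} (hκ : 0 < κ)
    (h : (fun x => primeCorr a a x - (κ * Li x : ℝ)) =o[atTop] fun x => x / Real.log x) :
    ∃ n ≠ 0, a n ≠ 0 := by
  by_contra! hzero
  obtain ⟨x, hx, hlarge⟩ :=
    ((eventually_gt_atTop 1).and (eventually_le_sum_dyadicPrimes hκ h)).exists
  have hlogx : 0 < Real.log x := Real.log_pos hx
  have hpos : 0 < κ / 4 * (x / Real.log x) := by positivity
  refine hpos.not_ge (hlarge.trans_eq (Finset.sum_eq_zero fun p hp => ?_))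
  simp [hzero p (prime_of_mem_dyadicPrimes hp).ne_zero]

end Correlation

section Direction

variable {ι : Type*} [Fintype ι] {a : ι → ℕ → ℂ} {B : ℝ} {S : Finset ℕ}

/-- Selberg orthonormality over the primes, with the weak error term `o(x / log x)`. -/
structure IsPrimeOrthogonal {ι : Type*} (a : ι → ℕ → ℂ) (κ : ι → ℝ) : Prop where
  diag : ∀ j, (fun x => primeCorr (a j) (a j) x - (κ j * Li x : ℝ)) =o[atTop]
    fun x => x / Real.log x
  offdiag : Pairwise fun i j => primeCorr (a i) (a j) =o[atTop] fun x => x / Real.log x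

/-- The direction `∑ e^{iθ_i} conj (a_i(p)) / B`, in which `p ^ (i t)` is conjugately aligned with
all the angles `θ_i` on average; it vanishes off `S`. -/
noncomputable def direction (a : ι → ℕ → ℂ) (θ : ι → ℝ) (B : ℝ) (S : Finset ℕ) (p : ℕ) : ℂ :=
  if p ∈ S then (∑ i, Complex.exp (θ i * Complex.I) * conj (a i p)) / B else 0

lemma direction_of_mem (θ : ι → ℝ) {p : ℕ} (hp : p ∈ S) :
    direction a θ B S p = (∑ i, Complex.exp (θ i * Complex.I) * conj (a i p)) / B := if_pos hp

lemma direction_of_notMem (θ : ι → ℝ) {p : ℕ} (hp : p ∉ S) : direction a θ B S p = 0 := if_neg hp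

lemma norm_direction_le (ha : ∀ p ∈ S, ∑ i, ‖a i p‖ ≤ B) (hB : 0 ≤ B) (θ : ι → ℝ) (p : ℕ) :
    ‖direction a θ B S p‖ ≤ 1 := by
  by_cases hp : p ∈ S
  · rw [direction_of_mem θ hp, norm_div, Complex.norm_real, Real.norm_of_nonneg hB]
    refine div_le_one_of_le₀ ((norm_sum_le_of_le _ fun i _ => ?_).trans (ha p hp)) hB
    rw [norm_mul, Complex.norm_exp_ofReal_mul_I, one_mul, RCLike.norm_conj]
  · simp [direction_of_notMem θ hp]

lemma exp_neg_mul_sum_direction (w : ℕ → ℝ) (θ : ι → ℝ) (j : ι) :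
    Complex.exp (-θ j * Complex.I) * ∑ p ∈ S, w p • a j p * (direction a θ B S p / 2) =
      ((2 * B)⁻¹ : ℝ) * ∑ i, Complex.exp ((θ i - θ j : ℝ) * Complex.I) *
        weightedCorr S w (a j) (a i) := by
  have hexp (i : ι) : Complex.exp ((θ i - θ j : ℝ) * Complex.I) =
      Complex.exp (-θ j * Complex.I) * Complex.exp (θ i * Complex.I) := by
    rw [← Complex.exp_add]
    push_cast
    ring_nf
  simp_rw [weightedCorr, hexp, Finset.mul_sum]
  rw [Finset.sum_comm]
  refine Finset.sum_congr rfl fun p hp => ?_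
  rw [direction_of_mem θ hp, Finset.sum_div, Finset.sum_div, Finset.mul_sum, Finset.mul_sum]
  refine Finset.sum_congr rfl fun i _ => ?_
  simp only [Complex.real_smul]
  push_cast
  ring

lemma le_re_exp_neg_mul_sum_direction (hB : 0 ≤ B) {w : ℕ → ℝ} {j : ι} {d e : ℝ}
    (hdiag : d ≤ (weightedCorr S w (a j) (a j)).re)
    (hoff : ∀ i, i ≠ j → ‖weightedCorr S w (a j) (a i)‖ ≤ e) (he : 0 ≤ e) (θ : ι → ℝ) :
    (2 * B)⁻¹ * (d - Fintype.card ι * e) ≤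
      (Complex.exp (-θ j * Complex.I) *
        ∑ p ∈ S, w p • a j p * (direction a θ B S p / 2)).re := by
  classical
  have hrest : ‖∑ i ∈ Finset.univ.erase j, Complex.exp ((θ i - θ j : ℝ) * Complex.I) *
      weightedCorr S w (a j) (a i)‖ ≤ Fintype.card ι * e := by
    calc _ ≤ ∑ _i ∈ Finset.univ.erase j, e := norm_sum_le_of_le _ fun i hi => by
          rw [norm_mul, Complex.norm_exp_ofReal_mul_I, one_mul]
          exact hoff i (Finset.ne_of_mem_erase hi)
      _ ≤ Fintype.card ι * e := by
          rw [Finset.sum_const, nsmul_eq_mul]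
          gcongr
          exact Finset.card_le_univ _
  rw [exp_neg_mul_sum_direction, Complex.re_ofReal_mul,
    ← Finset.add_sum_erase _ _ (Finset.mem_univ j), sub_self, Complex.ofReal_zero, zero_mul,
    Complex.exp_zero, one_mul, Complex.add_re]
  gcongr
  linarith [(abs_le.mp ((Complex.abs_re_le_norm _).trans hrest)).1]

lemma IsPrimeOrthogonal.exists_le_re_mean {κ : ι → ℝ} (h : IsPrimeOrthogonal a κ)
    (hκ : ∀ j, 0 < κ j) (hB : 0 < B) {σ : ℝ} (hσ0 : 0 ≤ σ) (hσ1 : σ ≤ 1) :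
    ∃ c : ℝ, 0 < c ∧ ∀ᶠ x : ℝ in atTop, ∀ A, Real.log x ^ 2 ≤ A → ∀ (θ : ι → ℝ) (j : ι),
      c * (x ^ (1 - σ) / Real.log x) ≤ (Complex.exp (-θ j * Complex.I) *
        ∑ p ∈ dyadicPrimes x,
          weight A σ p • a j p * (direction a θ B (dyadicPrimes x) p / 2)).re := by
  obtain ⟨m, hm, hmκ⟩ : ∃ m > 0, ∀ j, m ≤ κ j :=
    ((eventually_mem_nhdsWithin (a := (0 : ℝ)) (s := Set.Ioi 0)).and (eventually_all.mpr fun j =>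
      (eventually_le_nhds (hκ j)).filter_mono nhdsWithin_le_nhds)).exists
  set e : ℝ := m / (16 * (Fintype.card ι + 1)) with he
  have hcard : Fintype.card ι * e ≤ m / 16 := by
    rw [he, mul_div_assoc', div_le_div_iff₀ (by positivity) (by norm_num)]
    nlinarith
  have hoff (j i : ι) (hij : i ≠ j) := eventually_norm_weightedCorr_le (h.offdiag hij.symm) hσ0 hσ1
    (show 0 < e by positivity)
  refine ⟨(2 * B)⁻¹ * (m / 16), by positivity, ?_⟩
  filter_upwards [eventually_all.mpr fun j =>
      eventually_le_re_weightedCorr_self (hκ j) (h.diag j) hσ0,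
    eventually_all.mpr fun j => eventually_all.mpr fun i => eventually_all.mpr (hoff j i),
    eventually_gt_atTop 1] with x hdiag_x hoff_x hx A hA θ j
  have hX : 0 ≤ x ^ (1 - σ) / Real.log x := by
    have := Real.log_pos hx
    positivity
  refine le_trans ?_ (le_re_exp_neg_mul_sum_direction hB.le (hdiag_x j A hA)
    (fun i hij => hoff_x j i hij A ((sq_nonneg _).trans hA)) (by positivity) θ)
  rw [mul_assoc]
  gcongr
  nlinarith [hmκ j]

end Direction

/-! ### Truncation of the smoothed sum -/

section Truncation

lemma norm_tsum_sub_sum_le {β E : Type*} [NormedAddCommGroup E] [CompleteSpace E] {f : β → E}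
    {g : β → ℝ} {s : Finset β} (hg : Summable g) (hg0 : ∀ x, 0 ≤ g x)
    (hfg : ∀ x ∉ s, ‖f x‖ ≤ g x) : ‖∑' x, f x - ∑ x ∈ s, f x‖ ≤ ∑' x, g x := by
  have hf : Summable f := hg.of_norm_bounded_eventually (s.eventually_cofinite_notMem.mono hfg)
  rw [← hf.sum_add_tsum_compl (s := s), add_sub_cancel_left]
  exact (tsum_of_norm_bounded (hg.subtype _).hasSum fun x => hfg x x.2).trans
    (hg.tsum_subtype_le g _ hg0)

lemma sum_primes_subtype_primesLE {M : Type*} [AddCommMonoid M] (f : ℕ → M) (N : ℕ) :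
    ∑ p ∈ N.primesLE.subtype Nat.Prime, f p = ∑ p ∈ N.primesLE, f p :=
  Finset.sum_subtype_of_mem f fun _ hp => (Nat.mem_primesLE.mp hp).2

variable {A σ t : ℝ} {p : ℕ}

lemma div_cpow_mul_gauss_eq (a : ℕ → ℂ) (hp : p ≠ 0) :
    a p / (p : ℂ) ^ (σ + t * Complex.I) * (Real.exp (-(Real.log p ^ 2 / (4 * A))) : ℂ) =
      weight A σ p • a p * conj (phase p t) := by
  have hp0 : (p : ℂ) ≠ 0 := by exact_mod_cast hp
  have hphase : (p : ℂ) ^ (t * Complex.I) = phase p t := by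
    rw [Complex.cpow_def_of_ne_zero hp0, ← Complex.natCast_log, phase]
    push_cast
    ring_nf
  rw [Complex.cpow_add _ _ hp0, hphase, conj_eq_inv_of_norm_eq_one (norm_phase p t), weight,
    Complex.real_smul, Complex.ofReal_mul, Complex.ofReal_cpow p.cast_nonneg, Complex.ofReal_neg,
    Complex.cpow_neg, Complex.ofReal_natCast]
  ring

lemma weight_le_rpow_neg_two (hA : 0 < A) (hσ : 0 ≤ σ) (hp : Real.exp (8 * A) ≤ p) :
    weight A σ p ≤ (p : ℝ) ^ (-2 : ℝ) := by
  have hp0 : (0 : ℝ) < p := (Real.exp_pos _).trans_le hp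
  have hp1 : (1 : ℝ) ≤ p := (Real.one_le_exp (by positivity)).trans hp
  have hlog : 8 * A ≤ Real.log p := (Real.le_log_iff_exp_le hp0).mpr hp
  have hgauss : Real.log p * 2 ≤ Real.log p ^ 2 / (4 * A) := by
    rw [le_div_iff₀ (by positivity)]
    nlinarith
  calc weight A σ p ≤ 1 * Real.exp (Real.log p * -2) := by
        refine mul_le_mul (Real.rpow_le_one_of_one_le_of_nonpos hp1 (by linarith)) ?_
          (Real.exp_pos _).le zero_le_one
        rw [Real.exp_le_exp]
        linarith
    _ = (p : ℝ) ^ (-2 : ℝ) := by rw [one_mul, Real.rpow_def_of_pos hp0]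

lemma exists_norm_smoothSum_sub_le {a : ℕ → ℂ} {B : ℝ} (ha : ∀ p, p.Prime → ‖a p‖ ≤ B) :
    ∃ C : ℝ, ∀ A σ t : ℝ, 0 < A → 0 ≤ σ →
      ‖smoothSum a A σ t - ∑ p ∈ ⌊Real.exp (8 * A)⌋₊.primesLE,
        weight A σ p • a p * conj (phase p t)‖ ≤ C := by
  have hB : 0 ≤ B := (norm_nonneg _).trans (ha 2 Nat.prime_two)
  refine ⟨∑' p : Nat.Primes, B * ((p : ℕ) : ℝ) ^ (-2 : ℝ), fun A σ t hA hσ => ?_⟩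
  have hterm (p : Nat.Primes) := div_cpow_mul_gauss_eq (A := A) (σ := σ) (t := t) a p.2.ne_zero
  rw [smoothSum, tsum_congr hterm, ← sum_primes_subtype_primesLE]
  refine norm_tsum_sub_sum_le ((summable_primes_rpow one_lt_two).mul_left B)
    (fun p => by positivity) fun p hp => ?_
  have hlarge : Real.exp (8 * A) ≤ (p : ℕ) := by
    refine (Nat.lt_of_floor_lt (lt_of_not_ge fun hle => hp ?_)).le
    exact Finset.mem_subtype.mpr (Nat.mem_primesLE.mpr ⟨hle, p.2⟩)
  rw [norm_mul, norm_smul, RCLike.norm_conj, norm_phase, mul_one,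
    Real.norm_of_nonneg (weight_nonneg _ _ _), mul_comm]
  exact mul_le_mul (ha p p.2) (weight_le_rpow_neg_two hA hσ hlarge) (weight_nonneg _ _ _) hB

end Truncation

/-! ### Growth comparisons -/

section Growth

lemma eventually_mul_sqrt_add_le_exp (C D : ℝ) {b : ℝ} (hb : 0 < b) :
    ∀ᶠ l : ℝ in atTop, C * (√l + D) ≤ Real.exp (b * l) := by
  have hone : (fun l : ℝ => √l + D) =O[atTop] fun l : ℝ => l ^ 1 := by
    refine .add (.of_bound 1 ?_) ((isLittleO_const_left.mpr (.inr ?_)).isBigO)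
    · filter_upwards [eventually_ge_atTop 1] with l hl
      rw [one_mul, pow_one, Real.norm_of_nonneg (Real.sqrt_nonneg l),
        Real.norm_of_nonneg (by linarith)]
      exact Real.sqrt_le_self_iff.mpr (.inr hl)
    · simpa only [Function.comp_def, pow_one, Real.norm_eq_abs]
        using tendsto_abs_atTop_atTop (G := ℝ)
  have hlittle := (hone.trans_isLittleO (isLittleO_pow_exp_pos_mul_atTop 1 hb)).const_mul_left C
  filter_upwards [hlittle.eventuallyLE] with l hl
  exact (le_abs_self _).trans (hl.trans_eq (Real.norm_of_nonneg (Real.exp_pos _).le))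

lemma eventually_add_mul_sq_log_le (C D : ℝ) {b : ℝ} (hb : 0 < b) :
    ∀ᶠ l : ℝ in atTop, C + D * Real.log l ^ 2 ≤ b * l := by
  have hlittle : (fun l : ℝ => C + D * Real.log l ^ 2) =o[atTop] fun l : ℝ => b * l :=
    ((isLittleO_const_id_atTop C).add
      (Real.isLittleO_pow_log_id_atTop.const_mul_left D)).const_mul_right hb.ne'
  filter_upwards [hlittle.eventuallyLE, eventually_ge_atTop 0] with l hl hl0
  exact (le_abs_self _).trans (hl.trans_eq (Real.norm_of_nonneg (by positivity)))

lemma eventually_le_mul_rpow_div_log (M : ℝ) {c s : ℝ} (hc : 0 < c) (hs : 0 < s) :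
    ∀ᶠ l : ℝ in atTop, M ≤ c * (l ^ s / Real.log l) := by
  filter_upwards [((isLittleO_log_rpow_atTop hs).const_mul_left M).const_mul_right hc.ne'
    |>.eventuallyLE, eventually_gt_atTop 1] with l hl hl1
  have hlog : 0 < Real.log l := Real.log_pos hl1
  rw [← mul_div_assoc, le_div_iff₀ hlog]
  exact (le_abs_self _).trans (hl.trans_eq (Real.norm_of_nonneg (by positivity)))

lemma eventually_mul_sq_log_sq_mul_sqrt_add_le_exp (C D : ℝ) :
    ∀ᶠ l : ℝ in atTop, C * ((Real.log l ^ 2) ^ 2 * (√l + D)) ≤ Real.exp l := by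
  filter_upwards [eventually_add_mul_sq_log_le 0 2 one_half_pos,
    eventually_mul_sqrt_add_le_exp C D one_half_pos] with l hlog hsqrt
  have hpow : (Real.log l ^ 2) ^ 2 ≤ Real.exp (1 / 2 * l) := by
    calc (Real.log l ^ 2) ^ 2 ≤ Real.exp (Real.log l ^ 2) ^ 2 := by
          gcongr
          linarith [Real.add_one_le_exp (Real.log l ^ 2)]
      _ = Real.exp (2 * Real.log l ^ 2) := by rw [← Real.exp_nat_mul, Nat.cast_ofNat]
      _ ≤ _ := Real.exp_le_exp.mpr (by linarith)
  calc _ = (Real.log l ^ 2) ^ 2 * (C * (√l + D)) := by ring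
    _ ≤ (Real.log l ^ 2) ^ 2 * Real.exp (1 / 2 * l) := by gcongr
    _ ≤ Real.exp (1 / 2 * l) * Real.exp (1 / 2 * l) := by gcongr
    _ = Real.exp l := by
        rw [← Real.exp_add]
        ring_nf

lemma eventually_error_le {B D : ℝ} (hB : 0 ≤ B) (hD : 0 ≤ D) :
    ∀ᶠ l : ℝ in atTop, ∀ t : ℝ, 0 ≤ t → t ≤ 2 * Real.exp l →
      D * t ^ B * ((Real.log l ^ 2) ^ 2 * (√l + 1) *
        Real.exp (Real.log l ^ 2 * (4 + 4 * √l - √l ^ 2 / 2))) ≤ 1 := by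
  have hlog := Real.tendsto_log_atTop
  filter_upwards [eventually_mul_sq_log_sq_mul_sqrt_add_le_exp D 1,
    ((tendsto_pow_atTop two_ne_zero).comp hlog).eventually_ge_atTop (4 * (2 * B + 1)),
    eventually_ge_atTop 400] with l hpoly hlogsq hl t ht htl
  have hsq : √l ^ 2 = l := Real.sq_sqrt (by linarith)
  have hroot : 20 ≤ √l := Real.le_sqrt_of_sq_le (by linarith)
  have htB : t ^ B ≤ Real.exp ((l + 1) * B) := by
    have htwo : (2 : ℝ) ≤ Real.exp 1 := by linarith [Real.add_one_le_exp (1 : ℝ)]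
    rw [Real.exp_mul, add_comm, Real.exp_add]
    gcongr
    exact htl.trans (by gcongr)
  have hgauss : Real.log l ^ 2 * (4 + 4 * √l - √l ^ 2 / 2) ≤ -((2 * B + 1) * l) := by
    have hquad : 4 + 4 * √l - √l ^ 2 / 2 ≤ -(l / 4) := by nlinarith
    simp only [Function.comp] at hlogsq
    nlinarith
  calc _ = t ^ B * (D * ((Real.log l ^ 2) ^ 2 * (√l + 1))) *
        Real.exp (Real.log l ^ 2 * (4 + 4 * √l - √l ^ 2 / 2)) := by ring
    _ ≤ Real.exp ((l + 1) * B) * Real.exp l * Real.exp (-((2 * B + 1) * l)) := by gcongr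
    _ = Real.exp (-(B * (l - 1))) := by
        rw [← Real.exp_add, ← Real.exp_add]
        ring_nf
    _ ≤ 1 := by
        rw [Real.exp_le_one_iff, neg_nonpos]
        exact mul_nonneg hB (by linarith)

end Growth

/-! ### A common ordinate -/

section Sizes

lemma card_dyadicPrimes_le (x : ℝ) : (dyadicPrimes x).card ≤ ⌊x⌋₊ := by
  refine (Finset.card_filter_le _ _).trans ?_
  rw [Nat.card_Ioc]
  exact Nat.sub_le _ _

lemma prod_sq_dyadicPrimes_le (x : ℝ) : ∏ p ∈ dyadicPrimes x, p ^ 2 ≤ 16 ^ ⌊x⌋₊ := by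
  have hsubset : dyadicPrimes x ⊆ ⌊x⌋₊.primesLE := fun p hp =>
    Nat.mem_primesLE.mpr ⟨le_floor_of_mem_dyadicPrimes hp, prime_of_mem_dyadicPrimes hp⟩
  have hprimorial : ∏ p ∈ dyadicPrimes x, p ≤ 4 ^ ⌊x⌋₊ :=
    (Finset.prod_le_prod_of_subset_of_one_le' hsubset
      fun p hp _ => (Nat.mem_primesLE.mp hp).2.one_le).trans (primorial_le_four_pow _)
  calc ∏ p ∈ dyadicPrimes x, p ^ 2 = (∏ p ∈ dyadicPrimes x, p) ^ 2 := Finset.prod_pow _ _ _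
    _ ≤ (4 ^ ⌊x⌋₊) ^ 2 := Nat.pow_le_pow_left hprimorial 2
    _ = 16 ^ ⌊x⌋₊ := by
        rw [pow_right_comm]
        norm_num

lemma two_pow_card_dyadicPrimes_le {x : ℝ} (hx : 0 ≤ x) :
    (2 : ℝ) ^ (dyadicPrimes x).card ≤ Real.exp x := by
  calc (2 : ℝ) ^ (dyadicPrimes x).card ≤ 2 ^ ⌊x⌋₊ :=
        pow_le_pow_right₀ one_le_two (card_dyadicPrimes_le x)
    _ ≤ Real.exp 1 ^ ⌊x⌋₊ := by
        gcongr
        exact Real.exp_one_gt_two.le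
    _ = Real.exp ⌊x⌋₊ := Real.exp_one_pow _
    _ ≤ Real.exp x := Real.exp_le_exp.mpr (Nat.floor_le hx)

lemma prod_sq_mul_two_pow_card_dyadicPrimes_le {x : ℝ} (hx : 0 ≤ x) :
    ((∏ p ∈ dyadicPrimes x, p ^ 2 : ℕ) : ℝ) * 2 ^ (dyadicPrimes x).card ≤ Real.exp (4 * x) := by
  have hexp : (16 : ℝ) ≤ Real.exp 3 := by
    have hlog : Real.log 16 = 4 * Real.log 2 := by
      rw [show (16 : ℝ) = 2 ^ 4 by norm_num, Real.log_pow, Nat.cast_ofNat]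
    rw [← Real.log_le_iff_le_exp (by norm_num), hlog]
    linarith [Real.log_two_lt_d9]
  calc _ ≤ (Real.exp 3) ^ ⌊x⌋₊ * Real.exp x := by
        gcongr
        · exact (Nat.cast_le.mpr (prod_sq_dyadicPrimes_le x)).trans (by push_cast; gcongr)
        · exact two_pow_card_dyadicPrimes_le hx
    _ = Real.exp (⌊x⌋₊ * 3 + x) := by rw [← Real.exp_nat_mul, Real.exp_add]
    _ ≤ Real.exp (4 * x) := Real.exp_le_exp.mpr (by linarith [Nat.floor_le hx])

variable {η : ℝ}

lemma eventually_two_pow_card_mul_le (hη : 0 < η) (K : ℝ) :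
    ∀ᶠ T : ℝ in atTop, ∀ F : Finset ℝ, (F.card : ℝ) ≤ K * T ^ (1 - 8 * η) →
      2 ^ (dyadicPrimes (η * Real.log T)).card * (F.card * (2 * (√(Real.log T) + 3))) ≤ T / 8 := by
  filter_upwards [Real.tendsto_log_atTop.eventually
      (eventually_mul_sqrt_add_le_exp (16 * K) 3 (show 0 < 7 * η by positivity)),
    eventually_gt_atTop 1] with T hsqrt hT F hF
  have hl : 0 < Real.log T := Real.log_pos hT
  calc _ ≤ Real.exp (η * Real.log T) * (K * T ^ (1 - 8 * η) * (2 * (√(Real.log T) + 3))) := by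
        gcongr
        exact two_pow_card_dyadicPrimes_le (by positivity)
    _ = Real.exp (η * Real.log T) * T ^ (1 - 8 * η) * (16 * K * (√(Real.log T) + 3)) / 8 := by ring
    _ ≤ Real.exp (η * Real.log T) * T ^ (1 - 8 * η) * Real.exp (7 * η * Real.log T) / 8 := by
        gcongr
    _ = Real.exp (Real.log T) / 8 := by
        rw [Real.rpow_def_of_pos (by linarith), ← Real.exp_add, ← Real.exp_add]
        ring_nf
    _ = T / 8 := by rw [Real.exp_log (by linarith)]

lemma prod_sq_mul_two_pow_card_le_exp_quarter (hη : 0 ≤ η) (hη' : η ≤ 1 / 16) {l : ℝ}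
    (hl : 0 ≤ l) :
    ((∏ p ∈ dyadicPrimes (η * l), p ^ 2 : ℕ) : ℝ) * 2 ^ (dyadicPrimes (η * l)).card ≤
      Real.exp (l / 4) :=
  (prod_sq_mul_two_pow_card_dyadicPrimes_le (by positivity)).trans
    (Real.exp_le_exp.mpr (by nlinarith))

lemma eventually_two_mul_prod_sq_mul_le (hη : 0 ≤ η) (hη' : η ≤ 1 / 16) :
    ∀ᶠ T : ℝ in atTop, 2 * ((∏ p ∈ dyadicPrimes (η * Real.log T), p ^ 2 : ℕ) : ℝ) *
      2 ^ (dyadicPrimes (η * Real.log T)).card ≤ T / 8 := by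
  filter_upwards [Real.tendsto_log_atTop.eventually_ge_atTop 8, eventually_gt_atTop 0]
    with T hl hT
  set y := Real.exp (Real.log T / 4) with hy
  have hy3 : 3 ≤ y := by linarith [Real.add_one_le_exp (Real.log T / 4)]
  have hyT : y ^ 4 = T := by
    rw [hy, ← Real.exp_nat_mul, Nat.cast_ofNat, mul_div_cancel₀ _ four_ne_zero, Real.exp_log hT]
  calc _ ≤ 2 * y := by
        rw [mul_assoc]
        gcongr
        exact prod_sq_mul_two_pow_card_le_exp_quarter hη hη' (by linarith)
    _ ≤ y ^ 4 / 8 := by nlinarith [pow_le_pow_left₀ zero_le_three hy3 3]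
    _ = T / 8 := by rw [hyT]

lemma eventually_pow_mul_prod_sq_mul_le (hη : 0 ≤ η) (hη' : η ≤ 1 / 16) (B : ℝ) :
    ∀ᶠ T : ℝ in atTop, ∀ N : ℕ, (N : ℝ) ≤ Real.exp (8 * Real.log (Real.log T) ^ 2) →
      8 * (N : ℝ) ^ 4 * ((∏ p ∈ dyadicPrimes (η * Real.log T), p ^ 2 : ℕ) : ℝ) *
        2 ^ (dyadicPrimes (η * Real.log T)).card * (B * N) ^ 2 ≤ T := by
  filter_upwards [Real.tendsto_log_atTop.eventually
      (eventually_add_mul_sq_log_le (8 * B ^ 2) 48 one_half_pos),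
    eventually_ge_atTop 1] with T hlog hT N hN
  have hl : 0 ≤ Real.log T := Real.log_nonneg hT
  calc _ = 8 * B ^ 2 * (N : ℝ) ^ 6 *
        (((∏ p ∈ dyadicPrimes (η * Real.log T), p ^ 2 : ℕ) : ℝ) *
          2 ^ (dyadicPrimes (η * Real.log T)).card) := by ring
    _ ≤ Real.exp (8 * B ^ 2) * Real.exp (8 * Real.log (Real.log T) ^ 2) ^ 6 *
          Real.exp (Real.log T / 4) := by
        gcongr
        · linarith [Real.add_one_le_exp (8 * B ^ 2)]
        · exact prod_sq_mul_two_pow_card_le_exp_quarter hη hη' hl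
    _ = Real.exp (8 * B ^ 2 + 48 * Real.log (Real.log T) ^ 2 + Real.log T / 4) := by
        rw [← Real.exp_nat_mul, ← Real.exp_add, ← Real.exp_add]
        push_cast
        ring_nf
    _ ≤ Real.exp (Real.log T) := Real.exp_le_exp.mpr (by linarith)
    _ = T := Real.exp_log (by linarith)

end Sizes

section Coefficients

variable {a : ℕ → ℂ} {A B σ : ℝ}

lemma norm_weight_smul_le (ha : ∀ p, p.Prime → ‖a p‖ ≤ B) (hA : 0 ≤ A) {p : ℕ} (hp : p.Prime) :
    ‖weight A σ p • a p‖ ≤ (p : ℝ) ^ (-σ) * B := by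
  rw [norm_smul, Real.norm_of_nonneg (weight_nonneg _ _ _)]
  exact mul_le_mul (weight_le_rpow hA _ _) (ha p hp) (norm_nonneg _) (by positivity)

lemma sum_norm_sq_weight_smul_le (ha : ∀ p, p.Prime → ‖a p‖ ≤ B) (hA : 0 ≤ A) (hσ : 1 / 2 < σ)
    (N : ℕ) : ∑ p ∈ N.primesLE, ‖weight A σ p • a p‖ ^ 2 ≤
      (∑' p : Nat.Primes, ((p : ℕ) : ℝ) ^ (-(2 * σ))) * B ^ 2 := by
  calc _ ≤ ∑ p ∈ N.primesLE, (p : ℝ) ^ (-(2 * σ)) * B ^ 2 := by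
        refine Finset.sum_le_sum fun p hp => ?_
        calc _ ≤ ((p : ℝ) ^ (-σ) * B) ^ 2 := by
              gcongr
              exact norm_weight_smul_le ha hA (Nat.mem_primesLE.mp hp).2
          _ = _ := by
              rw [mul_pow, ← Real.rpow_mul_natCast p.cast_nonneg, Nat.cast_ofNat, neg_mul,
                mul_comm σ]
    _ ≤ _ := by
        rw [← Finset.sum_mul, ← sum_primes_subtype_primesLE fun p : ℕ => (p : ℝ) ^ (-(2 * σ))]
        gcongr
        exact Summable.sum_le_tsum (f := fun p : Nat.Primes => ((p : ℕ) : ℝ) ^ (-(2 * σ))) _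
          (fun p _ => by positivity) (summable_primes_rpow (by linarith))

lemma sum_norm_weight_smul_le (ha : ∀ p, p.Prime → ‖a p‖ ≤ B) (hA : 0 ≤ A) (hσ : 0 ≤ σ) (N : ℕ) :
    ∑ p ∈ N.primesLE, ‖weight A σ p • a p‖ ≤ B * N := by
  have hB : 0 ≤ B := (norm_nonneg _).trans (ha 2 Nat.prime_two)
  have hcard : N.primesLE.card ≤ N := by
    rw [Nat.primesLE_eq_filter_Icc_one]
    exact (Finset.card_filter_le _ _).trans_eq (Nat.card_Icc 1 N)
  calc _ ≤ N.primesLE.card • B := Finset.sum_le_card_nsmul _ _ _ fun p hp => by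
        have hp' := (Nat.mem_primesLE.mp hp).2
        refine (norm_weight_smul_le ha hA hp').trans (mul_le_of_le_one_left hB ?_)
        exact Real.rpow_le_one_of_one_le_of_nonpos (by exact_mod_cast hp'.one_le) (by linarith)
    _ ≤ B * N := by
        rw [nsmul_eq_mul, mul_comm]
        gcongr

end Coefficients

section Centre

variable {ι : Type*} {a : ι → ℕ → ℂ} {B σ η : ℝ}

lemma exists_eventually_norm_sum_centred_le [Finite ι] (ha : ∀ j p, p.Prime → ‖a j p‖ ≤ B)
    (hσ : 1 / 2 < σ) (hη : 0 < η) (hη' : η ≤ 1 / 16) (K : ℝ) :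
    ∃ V : ℝ, ∀ᶠ T : ℝ in atTop, ∀ β : ℕ → ℂ, (∀ p, ‖β p‖ ≤ 1) →
      (∀ p ∉ dyadicPrimes (η * Real.log T), β p = 0) →
      ∀ F : Finset ℝ, (F.card : ℝ) ≤ K * T ^ (1 - 8 * η) →
        ∃ t ∈ Set.Ioc T (2 * T), (∀ x ∈ F, √(Real.log T) + 3 < |t - x|) ∧
          ∀ j, ‖∑ p ∈ ⌊Real.exp (8 * Real.log (Real.log T) ^ 2)⌋₊.primesLE,
            weight (Real.log (Real.log T) ^ 2) σ p • a j p * centred β p t‖ ≤ V := by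
  have := Fintype.ofFinite ι
  set G : ℝ := 4 * ((∑' p : Nat.Primes, ((p : ℕ) : ℝ) ^ (-(2 * σ))) * B ^ 2)
  have hG : 0 ≤ G :=
    mul_nonneg zero_le_four (mul_nonneg (tsum_nonneg fun p => by positivity) (sq_nonneg B))
  refine ⟨√(2 * (Fintype.card ι * (2 * G + 1)) + 1), ?_⟩
  filter_upwards [eventually_two_pow_card_mul_le hη K, eventually_two_mul_prod_sq_mul_le hη.le hη',
    eventually_pow_mul_prod_sq_mul_le hη.le hη' B, eventually_gt_atTop 0]
    with T hfar hprod hpow hT β hβ hβ0 F hF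
  obtain ⟨t, ht, htF, hsmall⟩ := exists_ordinate hβ (fun p hp => prime_of_mem_dyadicPrimes hp) hβ0
    (fun p hp => (Nat.mem_primesLE.mp hp).symm) hT (by positivity) hG (hfar F hF) hprod
    (d := fun j p => weight (Real.log (Real.log T) ^ 2) σ p • a j p)
    (fun j => mul_le_mul_of_nonneg_left
      (sum_norm_sq_weight_smul_le (ha j) (sq_nonneg _) hσ _) zero_le_four)
    (fun j => le_trans (by
      gcongr
      exact sum_norm_weight_smul_le (ha j) (sq_nonneg _) (by linarith) _)
      (hpow _ (Nat.floor_le (Real.exp_pos _).le)))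
  exact ⟨t, ht, htF, fun j => Real.le_sqrt_of_sq_le (hsmall j)⟩

lemma eventually_dyadicPrimes_subset_primesLE (hη : η ≤ 1) :
    ∀ᶠ l : ℝ in atTop,
      dyadicPrimes (η * l) ⊆ ⌊Real.exp (8 * Real.log l ^ 2)⌋₊.primesLE := by
  filter_upwards [Real.tendsto_log_atTop.eventually_ge_atTop 1, eventually_gt_atTop 0]
    with l hlog hl p hp
  refine Nat.mem_primesLE.mpr ⟨(le_floor_of_mem_dyadicPrimes hp).trans (Nat.floor_le_floor ?_),
    prime_of_mem_dyadicPrimes hp⟩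
  calc η * l ≤ l := mul_le_of_le_one_left hl.le hη
    _ = Real.exp (Real.log l) := (Real.exp_log hl).symm
    _ ≤ Real.exp (8 * Real.log l ^ 2) := Real.exp_le_exp.mpr (by nlinarith)

variable [Fintype ι]

lemma IsPrimeOrthogonal.exists_le_re_mean_log {κ : ι → ℝ} (h : IsPrimeOrthogonal a κ)
    (hκ : ∀ j, 0 < κ j) (hB : 0 < B) (hσ0 : 0 ≤ σ) (hσ1 : σ ≤ 1) (hη : 0 < η) (hη' : η ≤ 1) :
    ∃ c : ℝ, 0 < c ∧ ∀ᶠ l : ℝ in atTop, ∀ (θ : ι → ℝ) (j : ι),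
      c * (l ^ (1 - σ) / Real.log l) ≤ (Complex.exp (-θ j * Complex.I) *
        ∑ p ∈ dyadicPrimes (η * l), weight (Real.log l ^ 2) σ p • a j p *
          (direction a θ B (dyadicPrimes (η * l)) p / 2)).re := by
  obtain ⟨c, hc, hmean⟩ := h.exists_le_re_mean hκ hB hσ0 hσ1
  have hscale : Tendsto (fun l : ℝ => η * l) atTop atTop := tendsto_id.const_mul_atTop hη
  refine ⟨c * η ^ (1 - σ), by positivity, ?_⟩
  filter_upwards [hscale.eventually hmean, hscale.eventually_gt_atTop 1, eventually_gt_atTop 0]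
    with l hmean_l hηl hl θ j
  have hlog : 0 < Real.log (η * l) := Real.log_pos hηl
  have hlog_le : Real.log (η * l) ≤ Real.log l :=
    Real.log_le_log (by linarith) (mul_le_of_le_one_left hl.le hη')
  calc c * η ^ (1 - σ) * (l ^ (1 - σ) / Real.log l)
      = c * ((η * l) ^ (1 - σ) / Real.log l) := by
        rw [Real.mul_rpow hη.le hl.le]
        ring
    _ ≤ c * ((η * l) ^ (1 - σ) / Real.log (η * l)) := by gcongr
    _ ≤ _ := hmean_l _ (by gcongr) θ j

lemma sum_mul_conj_phase_eq {S S' : Finset ℕ} (hS : S ⊆ S') (d : ℕ → ℂ) {β : ℕ → ℂ}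
    (hβ : ∀ p ∉ S, β p = 0) (t : ℝ) :
    ∑ p ∈ S', d p * conj (phase p t) =
      ∑ p ∈ S', d p * centred β p t + ∑ p ∈ S, d p * (β p / 2) := by
  rw [Finset.sum_subset hS fun p _ hp => by simp [hβ p hp], ← Finset.sum_add_distrib]
  refine Finset.sum_congr rfl fun p _ => ?_
  rw [centred]
  ring

lemma sub_add_le_re_mul {ζ u v w : ℂ} {m V C : ℝ} (hζ : ‖ζ‖ ≤ 1) (hu : ‖u‖ ≤ V)
    (hv : m ≤ (ζ * v).re) (hw : ‖w - (u + v)‖ ≤ C) : m - (V + C) ≤ (ζ * w).re := by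
  have hdiff : ‖ζ * v - ζ * w‖ ≤ V + C := by
    calc ‖ζ * v - ζ * w‖ = ‖ζ‖ * ‖-u - (w - (u + v))‖ := by
          rw [← norm_mul]
          ring_nf
      _ ≤ ‖-u - (w - (u + v))‖ := mul_le_of_le_one_left (norm_nonneg _) hζ
      _ ≤ V + C := norm_sub_le_of_le ((norm_neg u).trans_le hu) hw
  have hre := (Complex.re_le_norm (ζ * v - ζ * w)).trans hdiff
  rw [Complex.sub_re] at hre
  linarith

/-- The mean `β / 2` of the resonating measure carries the whole main term; the centred sum and the
primes beyond the cutoff only contribute bounded errors. -/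
lemma IsPrimeOrthogonal.exists_centre {κ : ι → ℝ} (h : IsPrimeOrthogonal a κ)
    (hκ : ∀ j, 0 < κ j) (hB : 0 < B) (ha : ∀ p, p.Prime → ∑ i, ‖a i p‖ ≤ B) (hσ : 1 / 2 < σ)
    (hσ1 : σ ≤ 1) (hη : 0 < η) (hη' : η ≤ 1 / 16) (K : ℝ) :
    ∃ c M : ℝ, 0 < c ∧ ∀ᶠ T : ℝ in atTop, ∀ (θ : ι → ℝ) (F : Finset ℝ),
      (F.card : ℝ) ≤ K * T ^ (1 - 8 * η) →
        ∃ t ∈ Set.Ioc T (2 * T), (∀ x ∈ F, √(Real.log T) + 3 < |t - x|) ∧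
          ∀ j, c * (Real.log T ^ (1 - σ) / Real.log (Real.log T)) - M ≤
            (Complex.exp (-θ j * Complex.I) *
              smoothSum (a j) (Real.log (Real.log T) ^ 2) σ t).re := by
  have ha' (j : ι) (p : ℕ) (hp : p.Prime) : ‖a j p‖ ≤ B :=
    (Finset.single_le_sum (fun i _ => norm_nonneg (a i p)) (Finset.mem_univ j)).trans (ha p hp)
  obtain ⟨c, hc, hmean⟩ :=
    h.exists_le_re_mean_log hκ hB (by linarith) hσ1 hη (by linarith)
  obtain ⟨V, hcentred⟩ := exists_eventually_norm_sum_centred_le ha' hσ hη hη' K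
  choose C hC using fun j => exists_norm_smoothSum_sub_le (ha' j)
  obtain ⟨C', hC'⟩ := (Set.finite_range C).bddAbove
  refine ⟨c, V + C', hc, ?_⟩
  filter_upwards [Real.tendsto_log_atTop.eventually hmean, hcentred,
    Real.tendsto_log_atTop.eventually (eventually_dyadicPrimes_subset_primesLE
      (show η ≤ 1 by linarith)),
    Real.tendsto_log_atTop.eventually (Real.tendsto_log_atTop.eventually_gt_atTop 0)]
    with T hmean_T hcentred_T hsubset hloglog θ F hF
  obtain ⟨t, ht, htF, hsmall⟩ := hcentred_T _
    (norm_direction_le (fun p hp => ha p (prime_of_mem_dyadicPrimes hp)) hB.le θ)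
    (fun p hp => direction_of_notMem θ hp) F hF
  refine ⟨t, ht, htF, fun j => sub_add_le_re_mul ?_ (hsmall j) (hmean_T θ j) ?_⟩
  · rw [← Complex.ofReal_neg, Complex.norm_exp_ofReal_mul_I]
  · rw [← sum_mul_conj_phase_eq hsubset (fun p => weight _ σ p • a j p)
      fun p hp => direction_of_notMem θ hp]
    exact (hC j _ σ t (pow_pos hloglog 2) (by linarith)).trans (hC' (Set.mem_range_self j))

end Centre

/-! ### Joint extreme values -/

section Zeros

variable {ι : Type*} {L : ℂ → ℂ} {σ δ : ℝ}

lemma ZeroDensity.mono {δ' : ℝ} (h : ZeroDensity L σ δ) (hδ : δ' ≤ δ) : ZeroDensity L σ δ' := by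
  obtain ⟨C, hC⟩ := h
  refine ⟨|C|, ?_⟩
  filter_upwards [hC, eventually_ge_atTop 1] with T hT hT1
  refine ⟨hT.1, hT.2.trans ?_⟩
  gcongr
  exact le_abs_self C

lemma ZeroDensity.exists_card_im_le (h : ZeroDensity L σ δ) :
    ∃ K : ℝ, ∀ᶠ T : ℝ in atTop, ∃ F : Finset ℝ,
      (∀ ρ ∈ zeroSet L σ (2 * T), ρ.im ∈ F) ∧ (F.card : ℝ) ≤ K * T ^ (1 - δ) := by
  classical
  obtain ⟨C, hC⟩ := h
  refine ⟨C * 2 ^ (1 - δ), ?_⟩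
  filter_upwards [(tendsto_id.const_mul_atTop two_pos).eventually hC, eventually_ge_atTop 0]
    with T ⟨hfin, hcard⟩ hT
  refine ⟨hfin.toFinset.image Complex.im,
    fun ρ hρ => Finset.mem_image_of_mem _ (hfin.mem_toFinset.mpr hρ), ?_⟩
  calc ((hfin.toFinset.image Complex.im).card : ℝ) ≤ (zeroSet L σ (2 * T)).ncard := by
        exact_mod_cast Finset.card_image_le.trans_eq (Set.ncard_eq_toFinset_card _ hfin).symm
    _ ≤ C * (2 * T) ^ (1 - δ) := hcard
    _ = _ := by rw [Real.mul_rpow zero_le_two hT, mul_assoc]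

lemma exists_sparse_ordinates [Finite ι] {L : ι → ℂ → ℂ} (hzero : ∀ j, ZeroDensity (L j) σ δ)
    (hδ : δ ≤ 1) :
    ∃ K : ℝ, ∀ᶠ T : ℝ in atTop, ∃ F : Finset ℝ, T ∈ F ∧ 2 * T ∈ F ∧
      (∀ j, ∀ ρ ∈ zeroSet (L j) σ (2 * T), ρ.im ∈ F) ∧ (F.card : ℝ) ≤ K * T ^ (1 - δ) := by
  classical
  have := Fintype.ofFinite ι
  choose K hK using fun j => (hzero j).exists_card_im_le
  refine ⟨2 + ∑ j, K j, ?_⟩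
  filter_upwards [eventually_all.mpr hK, eventually_ge_atTop 1] with T hT hT1
  choose F hF hcard using hT
  refine ⟨{T, 2 * T} ∪ Finset.univ.biUnion F, by simp, by simp, fun j ρ hρ =>
    Finset.mem_union_right _ (Finset.mem_biUnion.mpr ⟨j, Finset.mem_univ j, hF j ρ hρ⟩), ?_⟩
  have hunion : ({T, 2 * T} ∪ Finset.univ.biUnion F).card ≤ 2 + ∑ j, (F j).card :=
    (Finset.card_union_le _ _).trans (add_le_add Finset.card_le_two Finset.card_biUnion_le)
  calc _ ≤ 2 + ∑ j, ((F j).card : ℝ) := by exact_mod_cast hunion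
    _ ≤ 2 * T ^ (1 - δ) + ∑ j, K j * T ^ (1 - δ) := by
        gcongr with j
        · exact le_mul_of_one_le_right zero_le_two (Real.one_le_rpow hT1 (by linarith))
        · exact hcard j
    _ = _ := by rw [add_mul, Finset.sum_mul]

lemma Icc_sub_add_subset_of_lt_abs {u v t h : ℝ} (ht : t ∈ Set.Icc u v) (hu : h < |t - u|)
    (hv : h < |t - v|) : Set.Icc (t - h) (t + h) ⊆ Set.Icc u v := by
  rw [abs_of_nonneg (sub_nonneg.mpr ht.1)] at hu
  rw [abs_of_nonpos (sub_nonpos.mpr ht.2)] at hv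
  exact Set.Icc_subset_Icc (by linarith) (by linarith)

lemma HasFiniteOrder.ne_zero_of_lt_abs (hL : HasFiniteOrder L) {F : Finset ℝ} {T t h : ℝ}
    (hT : 0 < T) (ht : Set.Icc (t - h) (t + h) ⊆ Set.Icc T (2 * T))
    (hzero : ∀ ρ ∈ zeroSet L σ (2 * T), ρ.im ∈ F) (hF : ∀ x ∈ F, h < |t - x|) {s : ℂ}
    (hs : σ ≤ s.re) (him : |s.im - t| ≤ h) : L s ≠ 0 := by
  intro hLs
  obtain ⟨hlow, hhigh⟩ := ht (Set.mem_Icc_iff_abs_le.mp (by rwa [abs_sub_comm]))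
  have hs1 : s ≠ 1 := by
    rintro rfl
    exact hT.not_ge hlow
  refine (hF s.im (hzero s ⟨hL.analyticAt hs1, hLs, hs, hT.le.trans hlow, hhigh⟩)).not_ge ?_
  rwa [abs_sub_comm]

end Zeros

section Values

variable {L : ℂ → ℂ} {a : ℕ → ℂ} {σ : ℝ}

lemma exists_eventually_logValue {R : Type*} [Fintype R] {ν : R → ℕ → ℂ} (hL : HasFiniteOrder L)
    (hν : HasBoundedRoots L a ν) (hσ : 1 / 2 < σ) (hσ1 : σ < 1) {c : ℝ} (hc : 0 < c) (M : ℝ) :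
    ∀ᶠ T : ℝ in atTop, ∀ t ∈ Set.Icc T (2 * T), ∀ ζ : ℂ, ‖ζ‖ ≤ 1 →
      (∀ s : ℂ, σ ≤ s.re → |s.im - t| ≤ √(Real.log T) + 3 → L s ≠ 0) →
      c * (Real.log T ^ (1 - σ) / Real.log (Real.log T)) - M ≤
        (ζ * smoothSum a (Real.log (Real.log T) ^ 2) σ t).re →
      ∃ y ∈ Set.Icc (t - √(Real.log T)) (t + √(Real.log T)),
        ∃ w, IsLogValue L (σ + y * Complex.I) w ∧
          c / 2 * (Real.log T ^ (1 - σ) / Real.log (Real.log T)) ≤ (ζ * w).re := by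
  obtain ⟨D, B, R, hD, hB, hlarge⟩ := exists_large_logValue hL hν hσ hσ1
  have hlog := Real.tendsto_log_atTop
  filter_upwards [hlog.eventually (eventually_error_le hB.le hD.le),
    hlog.eventually (eventually_le_mul_rpow_div_log (D + 1 + M) (half_pos hc) (sub_pos.mpr hσ1)),
    hlog.eventually (eventually_mul_sqrt_add_le_exp 1 R one_pos),
    hlog.eventually_ge_atTop 1, hlog.eventually (hlog.eventually_ge_atTop 1),
    eventually_gt_atTop 0] with T herror hmain hheight hl hll hT t ht ζ hζ hzero hsmooth
  rw [one_mul, one_mul, Real.exp_log hT] at hheight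
  have herror_t := herror t (hT.le.trans ht.1) (by rw [Real.exp_log hT]; exact ht.2)
  refine hlarge (Real.log (Real.log T) ^ 2) (√(Real.log T)) t _ ζ (one_le_pow₀ hll)
    (Real.one_le_sqrt.mpr hl) (by linarith [ht.1]) (by positivity) hζ hzero ?_
  linarith

lemma eventually_sqrt_log_le (hσ : 0 ≤ σ) :
    ∀ᶠ T : ℝ in atTop, 2 * √(Real.log T) ≤
      2 * Real.log T ^ ((1 + σ) / 2) * Real.log (Real.log T) ^ ((1 : ℝ) / 2) := by
  have hlog := Real.tendsto_log_atTop
  filter_upwards [hlog.eventually_ge_atTop 1, hlog.eventually (hlog.eventually_ge_atTop 1)]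
    with T hl hll
  have hsqrt : √(Real.log T) ≤ Real.log T ^ ((1 + σ) / 2) := by
    rw [Real.sqrt_eq_rpow]
    exact Real.rpow_le_rpow_of_exponent_le hl (by linarith)
  calc 2 * √(Real.log T) ≤ 2 * Real.log T ^ ((1 + σ) / 2) := by gcongr
    _ ≤ _ := le_mul_of_one_le_right (by positivity) (Real.one_le_rpow hll (by norm_num))

end Values

section Selberg

lemma IsSelbergPoly.exists_hasBoundedRoots {L : ℂ → ℂ} {a : ℕ → ℂ} (h : IsSelbergPoly L a)
    (ha : ∃ n ≠ 0, a n ≠ 0) : ∃ (r : ℕ) (ν : Fin r → ℕ → ℂ), HasBoundedRoots L a ν := by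
  obtain ⟨r, ν, hν⟩ := h.poly_euler
  have hlocal {p : ℕ} (hp : p.Prime) := localSeries_mul_prod_eq_one h.dirichlet ha hν hp
  exact ⟨r, ν, hν, fun j p hp => norm_localRoot_le_one h.ramanujan hp (hlocal hp) j,
    fun p hp => coeff_prime_eq_sum_localRoots (hlocal hp)⟩

lemma SSOC.isPrimeOrthogonal {k : ℕ} {a : Fin k → ℕ → ℂ} {κ : Fin k → ℝ} (h : SSOC a κ) :
    IsPrimeOrthogonal a κ := by
  have hlittle : (fun x : ℝ => x / Real.log x ^ (2 : ℝ)) =o[atTop] fun x => x / Real.log x := by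
    have hinv : (fun x : ℝ => (Real.log x)⁻¹) =o[atTop] fun _ => (1 : ℝ) :=
      (isLittleO_one_iff ℝ).mpr Real.tendsto_log_atTop.inv_tendsto_atTop
    refine ((isBigO_refl (fun x : ℝ => x / Real.log x) atTop).mul_isLittleO hinv).congr
      (fun x => ?_) fun x => mul_one _
    rw [Real.rpow_two, sq, div_mul_eq_div_div, div_eq_mul_inv (x / Real.log x)]
  exact ⟨fun j => by simpa using (h 2 two_pos j j).trans_isLittleO hlittle,
    fun i j hij => by simpa [hij] using (h 2 two_pos i j).trans_isLittleO hlittle⟩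

end Selberg

section Main

variable {ι : Type*} [Finite ι] {a : ι → ℕ → ℂ} {L : ι → ℂ → ℂ} {κ : ι → ℝ} {σ δ : ℝ}

lemma exists_common_ordinate {R : ι → Type*} [∀ j, Fintype (R j)] {ν : ∀ j, R j → ℕ → ℂ}
    (hL : ∀ j, HasFiniteOrder (L j)) (hν : ∀ j, HasBoundedRoots (L j) (a j) (ν j))
    (ha : IsPrimeOrthogonal a κ) (hκ : ∀ j, 0 < κ j) (hσ : 1 / 2 < σ) (hσ1 : σ ≤ 1)
    (hδ : 0 < δ) (hzero : ∀ j, ZeroDensity (L j) σ δ) :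
    ∃ c M : ℝ, 0 < c ∧ ∀ᶠ T : ℝ in atTop, ∀ θ : ι → ℝ,
      ∃ t : ℝ, Set.Icc (t - (√(Real.log T) + 3)) (t + (√(Real.log T) + 3)) ⊆ Set.Icc T (2 * T) ∧
        ∀ j, (∀ s : ℂ, σ ≤ s.re → |s.im - t| ≤ √(Real.log T) + 3 → L j s ≠ 0) ∧
          c * (Real.log T ^ (1 - σ) / Real.log (Real.log T)) - M ≤
            (Complex.exp (-θ j * Complex.I) *
              smoothSum (a j) (Real.log (Real.log T) ^ 2) σ t).re := by
  have := Fintype.ofFinite ι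
  set η : ℝ := min δ (1 / 2) / 8 with hη
  have hηδ : 8 * η = min δ (1 / 2) := by
    rw [hη]
    ring
  have hη' : η ≤ 1 / 16 := by linarith [min_le_right δ (1 / 2)]
  obtain ⟨K, hsparse⟩ := exists_sparse_ordinates (δ := 8 * η)
    (fun j => (hzero j).mono (hηδ.trans_le (min_le_left _ _))) (by linarith)
  have hB : ∀ p, p.Prime → ∑ i, ‖a i p‖ ≤ ∑ i, (Fintype.card (R i) : ℝ) + 1 := fun p hp =>
    (Finset.sum_le_sum fun i _ => (hν i).norm_coeff_prime_le p hp).trans (le_add_of_nonneg_right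
      zero_le_one)
  obtain ⟨c, M, hc, hcentre⟩ := ha.exists_centre hκ (by positivity) hB hσ hσ1
    (show 0 < η by positivity) hη' K
  refine ⟨c, M, hc, ?_⟩
  filter_upwards [hsparse, hcentre, eventually_gt_atTop 0]
    with T ⟨F, hTF, hTF', hzeroF, hcard⟩ hcentre_T hT θ
  obtain ⟨t, ht, hfar, hlarge⟩ := hcentre_T θ F hcard
  have hstrip := Icc_sub_add_subset_of_lt_abs (Set.Ioc_subset_Icc_self ht) (hfar T hTF)
    (hfar _ hTF')
  exact ⟨t, hstrip, fun j => ⟨fun s hs him =>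
    (hL j).ne_zero_of_lt_abs hT hstrip (hzeroF j) hfar hs him, hlarge j⟩⟩

end Main

end JointExtreme

open JointExtreme in
theorem theorem1_general {ι : Type*} [Finite ι] {L : ι → ℂ → ℂ} {a : ι → ℕ → ℂ}
    {R : ι → Type*} [∀ j, Fintype (R j)] {ν : ∀ j, R j → ℕ → ℂ} {κ : ι → ℝ} {σ δ : ℝ}
    (hσ : 1 / 2 < σ) (hσ1 : σ < 1) (hL : ∀ j, HasFiniteOrder (L j))
    (hν : ∀ j, HasBoundedRoots (L j) (a j) (ν j)) (hκ : ∀ j, 0 < κ j)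
    (ha : IsPrimeOrthogonal a κ) (hδ : 0 < δ) (hzero : ∀ j, ZeroDensity (L j) σ δ) :
    ∃ c : ℝ, 0 < c ∧ ∀ᶠ T : ℝ in atTop, ∀ θ : ι → ℝ, ∃ t : ι → ℝ,
      (∀ j, t j ∈ Set.Icc T (2 * T)) ∧ (∀ i j, |t i - t j| ≤ 2 * √(Real.log T)) ∧
      ∀ j, ∃ w : ℂ, IsLogValue (L j) (σ + t j * Complex.I) w ∧
        c * (Real.log T ^ (1 - σ) / Real.log (Real.log T)) ≤
          (Complex.exp (-(θ j : ℂ) * Complex.I) * w).re := by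
  obtain ⟨c, M, hc, hordinate⟩ := exists_common_ordinate hL hν ha hκ hσ hσ1.le hδ hzero
  refine ⟨c / 2, half_pos hc, ?_⟩
  filter_upwards [hordinate, eventually_all.mpr fun j =>
    exists_eventually_logValue (hL j) (hν j) hσ hσ1 hc M] with T hordinate_T hvalue θ
  obtain ⟨t, hstrip, ht⟩ := hordinate_T θ
  have hsqrt := Real.sqrt_nonneg (Real.log T)
  have htT : t ∈ Set.Icc T (2 * T) := hstrip ⟨by linarith, by linarith⟩
  have hζ (j : ι) : ‖Complex.exp (-θ j * Complex.I)‖ ≤ 1 := by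
    rw [← Complex.ofReal_neg, Complex.norm_exp_ofReal_mul_I]
  choose y hy hw using fun j => hvalue j t htT _ (hζ j) (ht j).1 (ht j).2
  refine ⟨y, fun j => hstrip (Set.Icc_subset_Icc (by linarith) (by linarith) (hy j)),
    fun i j => (Real.dist_le_of_mem_Icc (hy i) (hy j)).trans_eq (by ring), hw⟩

theorem theorem1 (σ₀ : ℝ) (hσ : 1 / 2 < σ₀) (hσ' : σ₀ < 1)
    (k : ℕ) (L : Fin k → ℂ → ℂ) (a : Fin k → ℕ → ℂ)
    (hL : ∀ j, JointExtreme.IsSelbergPoly (L j) (a j))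
    (hdistinct : Function.Injective L)
    (κ : Fin k → ℝ) (hκ : ∀ j, 0 < κ j) (hssoc : JointExtreme.SSOC a κ)
    (δ : ℝ) (hδ : 0 < δ) (hzero : ∀ j, JointExtreme.ZeroDensity (L j) σ₀ δ) :
    ∃ c : ℝ, 0 < c ∧ ∀ θ : Fin k → ℝ, ∃ T₀ : ℝ, ∀ T : ℝ, T₀ ≤ T →
      ∃ t : Fin k → ℝ,
        (∀ j, t j ∈ Set.Icc T (2 * T)) ∧
        (∀ i j, |t i - t j| ≤
          2 * Real.log T ^ ((1 + σ₀) / 2) * Real.log (Real.log T) ^ ((1 : ℝ) / 2)) ∧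
        ∀ j, ∃ w : ℂ, JointExtreme.IsLogValue (L j) (σ₀ + t j * Complex.I) w ∧
          c * (Real.log T ^ (1 - σ₀) / Real.log (Real.log T)) ≤
            (Complex.exp (-(θ j : ℂ) * Complex.I) * w).re := by
  have horth := hssoc.isPrimeOrthogonal
  have hne (j : Fin k) := JointExtreme.exists_ne_zero_of_primeCorr (hκ j) (horth.diag j)
  choose r ν hν using fun j => (hL j).exists_hasBoundedRoots (hne j)
  obtain ⟨c, hc, hvalues⟩ :=
    theorem1_general hσ hσ' (fun j => (hL j).continuation) hν hκ horth hδ hzero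
  refine ⟨c, hc, fun θ => eventually_atTop.mp ?_⟩
  filter_upwards [hvalues, JointExtreme.eventually_sqrt_log_le (σ := σ₀) (by linarith)]
    with T hT hgap
  obtain ⟨t, ht, hclose, hw⟩ := hT θ
  exact ⟨t, ht, fun i j => (hclose i j).trans hgap, hw⟩
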